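/- **Doubly-degenerate $\mathbf{Bicat}_s$-categories.** A *$\mathbf{Bicat}_s$-category* is a category enriched in the category of bicategories and strict functors, with the cartesian product. It is *doubly degenerate* if it has exactly one 0-cell and one 1-cell. It is then given by a category $C$ (2-cells as objects, 3-cells as morphisms) with a monoidal structure $(a,b)\mapsto a/b$ with unit $1$ ("vertical" composition, weakly associative and unital; $a/b$ is $a$ above $b$) and a second tensor product $C\times C\to C$, $(a,b)\mapsto a|b$ ("horizontal" composition), which is strictly associative and strictly unital with the same unit $1$ and is a strict functor of one-object bicategories. So on objects and morphisms $(a|b)/(c|d)=(a/c)|(b/d)$, and the vertical constraint isomorphisms $\alpha,\lambda,\rho$ at horizontal composites are the horizontal composites of the constraints. Moreover the identity is picked out by a strict functor from the terminal bicategory, so $1/1=1$ and the vertical constraints at $1$ are identities. **Weak maps.** $\mathbf{Bicat}_s$-categories are the strict algebras of the 2-monad $HV$ on the 2-category of $\mathbf{Cat}$-graph-graphs. Here $V$ freely adds weak vertical composites (the free bicategory construction on homs), $H$ freely adds strict horizontal composites (the free category construction), and they are composed along the distributive law $VH\to HV$ given by interchange. Explicitly, for a doubly-degenerate $C$ the 2-cells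 of $HVC$ are the *grids* in $C$: finite lists $(w_1,\dots,w_n)$ of bracketed words with units in the objects of $C$. Morphisms of grids are lists of morphisms of the free monoidal category on the category $C$. A grid is evaluated by composing each word vertically and then composing the results horizontally. A *weak map* $(F,\tau):C\to D$ is a weak map of $HV$-algebras: a functor $F:C\to D$ with isomorphisms $$\tau_g:\ \mathrm{ev}_D(Fg)\ \cong\ F(\mathrm{ev}_C\, g)$$ natural in the grid $g$, such that $\tau$ is the identity at a grid with a single letter, and such that, for a grid of grids $N$ (a list of words of grids, all grids in one word having the same length) with flattening $\mu N$, the component $\tau_{\mu N}$ is the evaluation of the components of $\tau$ at the inner grids followed by the component of $\tau$ at the grid of their values. A *transformation* $(F,\tau)\Rightarrow(G,\sigma)$ is a transformation of weak maps of $HV$-algebras: a natural transformation $\theta:F\Rightarrow G$ with $\sigma_g\circ \mathrm{ev}_D(\theta_g)=\theta_{\mathrm{ev}_C g}\circ\tau_g$ for every grid $g$. Doubly-degenerate $\mathbf{Bicat}_s$-categories, weak maps and transformations form a strict 2-category $\mathbf{ddBicat}_s\text{-}\mathbf{Cat}$. Let $\mathbf{BrMonCat}$ be the strict 2-category of braided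 monoidal categories, braided strong monoidal functors and monoidal transformations. **Theorem.** There is a strict 2-functor $$U:\mathbf{ddBicat}_s\text{-}\mathbf{Cat}\longrightarrow\mathbf{BrMonCat}$$ with the following properties. 1. On objects, $UX$ is the underlying category with its vertical monoidal structure and the braiding $$a/b=(1|a)/(b|1)=(1/b)|(a/1)\ \cong\ b|a\ \cong\ (b/1)|(1/a)=(b|1)/(1|a)=b/a ,$$ whose isomorphisms are horizontal composites of vertical unit constraints; in particular this is a braiding. 2. On 1-cells, $U(F,\tau)$ is the functor $F$ with unit constraint $1\cong F1$ the component of $\tau$ at the empty grid, and monoidal constraint $Fa/Fb\cong F(a/b)$ the component of $\tau$ at the one-column grid with entries $a$ above $b$; in particular these make $F$ a braided strong monoidal functor. 3. On 2-cells, $U\theta=\theta$; in particular $\theta$ is a monoidal transformation. Moreover, $U$ is part of a biadjoint biequivalence: there are a pseudofunctor $G:\mathbf{BrMonCat}\to\mathbf{ddBicat}_s\text{-}\mathbf{Cat}$, adjoint equivalences $1\simeq GU$ and $UG\simeq 1$ in the respective bicategories of pseudofunctors, pseudonatural transformations and modifications, and invertible modifications filling the two triangles $U\Rightarrow UGU\Rightarrow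 U$ and $G\Rightarrow GUG\Rightarrow G$, which satisfy the two swallowtail equations. -/

import Mathlib

/-!
# Doubly-degenerate `Bicat_s`-categories and braided monoidal categories

A `Bicat_s`-category is a category enriched in the category of bicategories and strict functors
(with cartesian product).  It is *doubly degenerate* if it has one 0-cell and one 1-cell.
`Bicat_s`-categories are the strict algebras of a composite 2-monad `HV` on the 2-category
`Cat-Gph-Gph` (with icon-like 2-cells), where `V` freely adds weak vertical composites and `H`
freely adds strict horizontal composites, composed along the distributive law `VH → HV` given by
interchange.  Weak maps are the weak (pseudo) maps of `HV`-algebras, and transformations are the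
`HV`-algebra 2-cells.  This file spells these out for doubly-degenerate algebras.
-/

open CategoryTheory

universe v u v' u' v'' u'' w w' v₁ u₁ w₁ v₂ u₂ w₂

namespace DDB

/-! ### Cells of the free structures -/

section Words

variable {ι : Type w} {κ : Type w'}

/-- Formal vertical composites (bracketed words with units) of letters from `ι`, i.e. the objects
of the free monoidal category on `ι`.  `tensor p q` is `p` placed above `q`. -/
inductive Word (ι : Type w) : Type w
  | of (i : ι) : Word ι
  | unit : Word ι
  | tensor (p q : Word ι) : Word ι

namespace Word

/-- Relabelling of the letters. -/
def map {ι : Type w} {κ : Type w'} (f : ι → κ) : Word ι → Word κ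
  | of i => of (f i)
  | unit => unit
  | tensor p q => tensor (map f p) (map f q)

/-- Substitution of words for letters (the multiplication of the monad `V`). -/
def bind {ι : Type w} {κ : Type w'} (f : ι → Word κ) : Word ι → Word κ
  | of i => f i
  | unit => unit
  | tensor p q => tensor (bind f p) (bind f q)

end Word

/-- A formal horizontal composite (list) of formal vertical composites of letters from `ι`.
If `A` is a doubly-degenerate `Cat`-graph-graph with category of 2-cells `C`, then `HV A` has one
0-cell, its 1-cells are the natural numbers (lists of the unique 1-cell), and its 2-cells `n → n`
are the grids of length `n` in `C`; there are no 2-cells `n → m` for `n ≠ m`. -/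
abbrev Grid (ι : Type w) : Type w := List (Word ι)

/-- Relabelling of the letters. -/
def Grid.map {ι : Type w} {κ : Type w'} (f : ι → κ) (g : Grid ι) : Grid κ :=
  List.map (Word.map f) g

/-- A 2-cell of `HVHV A`, for a doubly-degenerate `A` as above: a formal horizontal composite of
formal vertical composites of grids.  Only 2-cells over the same 1-cell are vertically composable,
hence all the grids in one vertical composite have the same length `n`, and an empty vertical
composite remembers its length `n`. -/
abbrev Nested (ι : Type w) : Type w := List (Σ n : ℕ, Word (Fin n → Word ι))

/-- A nested grid, seen as a grid whose letters are grids. -/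
def Nested.rows {ι : Type w} (N : Nested ι) : Grid (Grid ι) :=
  List.map (fun p => p.2.map (fun r => List.ofFn r)) N

/-- The multiplication `HVHV → HHVV → HV`: the distributive law turns a vertical composite of rows
of length `n` into a row of `n` vertical composites, and then brackets are removed. -/
def Nested.flatten {ι : Type w} (N : Nested ι) : Grid ι :=
  List.flatMap (fun p => List.ofFn fun k => p.2.bind fun r => r k) N

/-- Relabelling of the letters. -/
def Nested.map (f : ι → κ) (N : Nested ι) : Nested κ :=
  List.map (fun p => ⟨p.1, p.2.map fun r k => (r k).map f⟩) N

theorem Word.map_map {κ' : Type*} (f : ι → κ) (f' : κ → κ') : ∀ p : Word ι,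
    (p.map f).map f' = p.map (fun i => f' (f i))
  | .of _ => rfl
  | .unit => rfl
  | .tensor p q => congrArg₂ _ (Word.map_map f f' p) (Word.map_map f f' q)

theorem Grid.map_map {κ' : Type*} (f : ι → κ) (f' : κ → κ') (g : Grid ι) :
    (g.map f).map f' = g.map (fun i => f' (f i)) := by
  simp only [Grid.map, List.map_map]
  exact congrFun (congrArg _ (funext fun p => Word.map_map f f' p)) g

theorem Word.bind_map {μ : Type*} (f : ι → Word κ) (k : κ → μ) :
    ∀ p : Word ι, (p.bind f).map k = p.bind (fun i => (f i).map k)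
  | .of _ => rfl
  | .unit => rfl
  | .tensor p q => congrArg₂ _ (Word.bind_map f k p) (Word.bind_map f k q)

theorem Word.map_bind {μ : Type*} (k : μ → ι) (f : ι → Word κ)  :
    ∀ p : Word μ, (p.map k).bind f = p.bind (fun i => f (k i))
  | .of _ => rfl
  | .unit => rfl
  | .tensor p q => congrArg₂ _ (Word.map_bind k f p) (Word.map_bind k f q)

theorem Nested.flatten_map (f : ι → κ) (N : Nested ι) :
    Nested.flatten (Nested.map f N) = Grid.map f (Nested.flatten N) := by
  simp only [Nested.flatten, Nested.map, Grid.map, List.flatMap_map, List.map_flatMap]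
  congr 1; funext p
  rw [List.map_ofFn]
  congr 1; funext k
  simp only [Word.map_bind, Function.comp, Word.bind_map]

theorem Nested.rows_map (f : ι → κ) (N : Nested ι) :
    Nested.rows (Nested.map f N) = Grid.map (Grid.map f) (Nested.rows N) := by
  simp only [Nested.rows, Nested.map, Grid.map, List.map_map]
  congr 1; funext p
  simp only [Function.comp, Word.map_map]
  exact congrArg (fun k => Word.map k p.2) (funext fun r => (List.map_ofFn ).symm)

end Words

/-! ### Evaluation of vertical words in a monoidal category -/

section VerticalEvaluation

open MonoidalCategory

variable {C : Type u} [Category.{v} C] {D : Type u'} [Category.{v'} D]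
variable {ι : Type w} {κ : Type w'}

theorem comp_heq_comp {a a' b b' c c' : C} {f : a ⟶ b} {f' : a' ⟶ b'} {g : b ⟶ c}
    {g' : b' ⟶ c'} (ha : a = a') (hb : b = b') (hc : c = c') (hf : f ≍ f')
    (hg : g ≍ g') : f ≫ g ≍ f' ≫ g' := by
  subst ha hb hc; cases hf; cases hg; rfl

theorem map_heq (F : C ⥤ D) {a b a' b' : C} {k : a ⟶ b} {l : a' ⟶ b'} (ha : a = a') (hb : b = b')
    (h : k ≍ l) : F.map k ≍ F.map l := by
  subst ha hb; cases h; rfl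

theorem eqToHom_comp_heq_comp {a b c d : C} (h : a = b) (f : b ⟶ c) (h' : c = d) :
    eqToHom h ≫ f ≫ eqToHom h' ≍ f := by
  subst h h'; simp

theorem eqToHom_comp_heq_comp' {a b c d e : C} (h : a = b) (f : b ⟶ c) (g : c ⟶ d) (h' : d = e) :
    eqToHom h ≫ f ≫ g ≫ eqToHom h' ≍ f ≫ g := by
  subst h h'; simp

/-- Formal morphisms between words in a category `C`.  Modulo the equations of a monoidal category
these are the morphisms of the free monoidal category on the category `C`, i.e. of the hom-category
`V C`; equivalently, words with the same number of letters are uniquely isomorphic up to a family of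
morphisms between corresponding letters.  (The equations may be left out, as we only evaluate these
morphisms in monoidal categories.) -/
inductive Word.Hom {C : Type u} [Category.{v} C] : Word C → Word C → Type (max u v)
  | of {a b : C} (f : a ⟶ b) : Hom (.of a) (.of b)
  | id (p : Word C) : Hom p p
  | comp {p q r : Word C} (φ : Hom p q) (ψ : Hom q r) : Hom p r
  | tensor {p p' q q' : Word C} (φ : Hom p p') (ψ : Hom q q') : Hom (.tensor p q) (.tensor p' q')
  | associator (p q r : Word C) : Hom (.tensor (.tensor p q) r) (.tensor p (.tensor q r))
  | associatorInv (p q r : Word C) : Hom (.tensor p (.tensor q r)) (.tensor (.tensor p q) r)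
  | leftUnitor (p : Word C) : Hom (.tensor .unit p) p
  | leftUnitorInv (p : Word C) : Hom p (.tensor .unit p)
  | rightUnitor (p : Word C) : Hom (.tensor p .unit) p
  | rightUnitorInv (p : Word C) : Hom p (.tensor p .unit)

/-- The action of `V` on a functor, on morphisms. -/
def Word.Hom.map (F : C ⥤ D) : ∀ {p q : Word C}, Word.Hom p q →
    Word.Hom (p.map F.obj) (q.map F.obj)
  | _, _, .of f => .of (F.map f)
  | _, _, .id _ => .id _
  | _, _, .comp φ ψ => .comp (Word.Hom.map F φ) (Word.Hom.map F ψ)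
  | _, _, .tensor φ ψ => .tensor (Word.Hom.map F φ) (Word.Hom.map F ψ)
  | _, _, .associator _ _ _ => .associator _ _ _
  | _, _, .associatorInv _ _ _ => .associatorInv _ _ _
  | _, _, .leftUnitor _ => .leftUnitor _
  | _, _, .leftUnitorInv _ => .leftUnitorInv _
  | _, _, .rightUnitor _ => .rightUnitor _
  | _, _, .rightUnitorInv _ => .rightUnitorInv _

/-- The formal morphism given by a family of morphisms between letters. -/
def Word.homOf {x y : ι → C} (f : ∀ i, x i ⟶ y i) : ∀ p : Word ι, Word.Hom (p.map x) (p.map y)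
  | .of i => .of (f i)
  | .unit => .id _
  | .tensor p q => .tensor (Word.homOf f p) (Word.homOf f q)

/-- Morphisms of grids (the morphisms of the hom-categories of `HV A`): the lengths agree, and there
is a morphism of words in each place. -/
inductive Grid.Hom {C : Type u} [Category.{v} C] : Grid C → Grid C → Type (max u v)
  | nil : Hom [] []
  | cons {p q : Word C} {g h : Grid C} (φ : Word.Hom p q) (Φ : Hom g h) : Hom (p :: g) (q :: h)

/-- The action of `HV` on a functor, on morphisms. -/
def Grid.Hom.map (F : C ⥤ D) : ∀ {g h : Grid C}, Grid.Hom g h →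
    Grid.Hom (g.map F.obj) (h.map F.obj)
  | _, _, .nil => .nil
  | _, _, .cons φ Φ => .cons (φ.map F) (Grid.Hom.map F Φ)

/-- The morphism of grids given by a family of morphisms between letters. -/
def Grid.homOf {x y : ι → C} (f : ∀ i, x i ⟶ y i) : ∀ g : Grid ι, Grid.Hom (g.map x) (g.map y)
  | [] => .nil
  | p :: g => .cons (Word.homOf f p) (Grid.homOf f g)

variable [MonoidalCategory C] [MonoidalCategory D]

/-- The value of a word, given values of its letters. -/
def Word.eval (x : ι → C) : Word ι → C
  | .of i => x i
  | .unit => 𝟙_ C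
  | .tensor p q => Word.eval x p ⊗ Word.eval x q

/-- A family of morphisms between values of letters induces one between values of words. -/
def Word.evalMap {x y : ι → C} (f : ∀ i, x i ⟶ y i) : ∀ p : Word ι, p.eval x ⟶ p.eval y
  | .of i => f i
  | .unit => 𝟙 _
  | .tensor p q => Word.evalMap f p ⊗ₘ Word.evalMap f q

/-- The value of a formal morphism under a functor. -/
def Word.Hom.eval (F : C ⥤ D) : ∀ {p q : Word C}, Word.Hom p q → (p.eval F.obj ⟶ q.eval F.obj)
  | _, _, .of f => F.map f
  | _, _, .id _ => 𝟙 _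
  | _, _, .comp φ ψ => Word.Hom.eval F φ ≫ Word.Hom.eval F ψ
  | _, _, .tensor φ ψ => Word.Hom.eval F φ ⊗ₘ Word.Hom.eval F ψ
  | _, _, .associator _ _ _ => (α_ _ _ _).hom
  | _, _, .associatorInv _ _ _ => (α_ _ _ _).inv
  | _, _, .leftUnitor _ => (λ_ _).hom
  | _, _, .leftUnitorInv _ => (λ_ _).inv
  | _, _, .rightUnitor _ => (ρ_ _).hom
  | _, _, .rightUnitorInv _ => (ρ_ _).inv

theorem tensorHom_heq {a a' b b' c c' d d' : C} {f : a ⟶ b} {f' : a' ⟶ b'} {g : c ⟶ d}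
    {g' : c' ⟶ d'} (ha : a = a') (hb : b = b') (hc : c = c') (hd : d = d') (hf : f ≍ f')
    (hg : g ≍ g') : f ⊗ₘ g ≍ f' ⊗ₘ g' := by
  subst ha hb hc hd; cases hf; cases hg; rfl

theorem Word.eval_map (f : ι → κ) (x : κ → C) :
    ∀ p : Word ι, (p.map f).eval x = p.eval (fun i => x (f i))
  | .of _ => rfl
  | .unit => rfl
  | .tensor p q => congrArg₂ _ (Word.eval_map f x p) (Word.eval_map f x q)

theorem Word.evalMap_id (x : ι → C) : ∀ p : Word ι, p.evalMap (fun i => 𝟙 (x i)) = 𝟙 _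
  | .of _ => rfl
  | .unit => rfl
  | .tensor p q => by simp [Word.evalMap, Word.evalMap_id x p, Word.evalMap_id x q, Word.eval]

theorem Word.evalMap_comp {x y z : ι → C} (f : ∀ i, x i ⟶ y i) (f' : ∀ i, y i ⟶ z i) :
    ∀ p : Word ι, p.evalMap (fun i => f i ≫ f' i) = p.evalMap f ≫ p.evalMap f'
  | .of _ => rfl
  | .unit => (Category.id_comp _).symm
  | .tensor p q => by
      rw [Word.evalMap, Word.evalMap_comp f f' p, Word.evalMap_comp f f' q,
        ← MonoidalCategory.tensorHom_comp_tensorHom]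
      rfl

theorem Word.evalMap_map (k : κ → ι) {x y : ι → C} (f : ∀ i, x i ⟶ y i) : ∀ (p : Word κ),
    (p.map k).evalMap f ≍ p.evalMap (fun i => f (k i))
  | .of _ => HEq.rfl
  | .unit => HEq.rfl
  | .tensor p q => tensorHom_heq (Word.eval_map _ _ p) (Word.eval_map _ _ p)
      (Word.eval_map _ _ q) (Word.eval_map _ _ q) (Word.evalMap_map k f p) (Word.evalMap_map k f q)

end VerticalEvaluation

section VerticalFunctors

open MonoidalCategory

variable {C : Type u} [Category.{v} C] {D : Type u'} [Category.{v'} D]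
variable {E : Type u''} [Category.{v''} E] [MonoidalCategory E] {ι : Type w}

theorem Word.homOf_eval (F : C ⥤ E) {x y : ι → C} (f : ∀ i, x i ⟶ y i) :
    ∀ p : Word ι, (Word.homOf f p).eval F ≍ p.evalMap (fun i => F.map (f i))
  | .of _ => HEq.rfl
  | .unit => HEq.rfl
  | .tensor p q => tensorHom_heq (Word.eval_map _ _ p) (Word.eval_map _ _ p)
      (Word.eval_map _ _ q) (Word.eval_map _ _ q) (Word.homOf_eval F f p) (Word.homOf_eval F f q)

theorem Word.Hom.map_eval (F : C ⥤ D) (G : D ⥤ E) : ∀ {p q : Word C} (φ : Word.Hom p q),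
    (φ.map F).eval G ≍ φ.eval (F ⋙ G)
  | _, _, .of f => HEq.rfl
  | p, _, .id _ => by
      have h : (p.map F.obj).eval G.obj = p.eval (F ⋙ G).obj := Word.eval_map _ _ _
      show 𝟙 ((p.map F.obj).eval G.obj) ≍ 𝟙 (p.eval (F ⋙ G).obj)
      rw [h]
  | _, _, .comp φ ψ => comp_heq_comp (Word.eval_map _ _ _) (Word.eval_map _ _ _) (Word.eval_map _ _ _)
      (Word.Hom.map_eval F G φ) (Word.Hom.map_eval F G ψ)
  | _, _, .tensor φ ψ => tensorHom_heq (Word.eval_map _ _ _) (Word.eval_map _ _ _)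
      (Word.eval_map _ _ _) (Word.eval_map _ _ _)
      (Word.Hom.map_eval F G φ) (Word.Hom.map_eval F G ψ)
  | _, _, .associator p q r => by
      have hp : (p.map F.obj).eval G.obj = p.eval (F ⋙ G).obj := Word.eval_map _ _ _
      have hq : (q.map F.obj).eval G.obj = q.eval (F ⋙ G).obj := Word.eval_map _ _ _
      have hr : (r.map F.obj).eval G.obj = r.eval (F ⋙ G).obj := Word.eval_map _ _ _
      show (α_ ((p.map F.obj).eval G.obj) ((q.map F.obj).eval G.obj)
        ((r.map F.obj).eval G.obj)).hom ≍ (α_ (p.eval (F ⋙ G).obj) _ _).hom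
      rw [hp, hq, hr]
  | _, _, .associatorInv p q r => by
      have hp : (p.map F.obj).eval G.obj = p.eval (F ⋙ G).obj := Word.eval_map _ _ _
      have hq : (q.map F.obj).eval G.obj = q.eval (F ⋙ G).obj := Word.eval_map _ _ _
      have hr : (r.map F.obj).eval G.obj = r.eval (F ⋙ G).obj := Word.eval_map _ _ _
      show (α_ ((p.map F.obj).eval G.obj) ((q.map F.obj).eval G.obj)
        ((r.map F.obj).eval G.obj)).inv ≍ (α_ (p.eval (F ⋙ G).obj) _ _).inv
      rw [hp, hq, hr]
  | _, p, .leftUnitor _ => by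
      have h : (p.map F.obj).eval G.obj = p.eval (F ⋙ G).obj := Word.eval_map _ _ _
      show (λ_ ((p.map F.obj).eval G.obj)).hom ≍ (λ_ (p.eval (F ⋙ G).obj)).hom
      rw [h]
  | p, _, .leftUnitorInv _ => by
      have h : (p.map F.obj).eval G.obj = p.eval (F ⋙ G).obj := Word.eval_map _ _ _
      show (λ_ ((p.map F.obj).eval G.obj)).inv ≍ (λ_ (p.eval (F ⋙ G).obj)).inv
      rw [h]
  | _, p, .rightUnitor _ => by
      have h : (p.map F.obj).eval G.obj = p.eval (F ⋙ G).obj := Word.eval_map _ _ _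
      show (ρ_ ((p.map F.obj).eval G.obj)).hom ≍ (ρ_ (p.eval (F ⋙ G).obj)).hom
      rw [h]
  | p, _, .rightUnitorInv _ => by
      have h : (p.map F.obj).eval G.obj = p.eval (F ⋙ G).obj := Word.eval_map _ _ _
      show (ρ_ ((p.map F.obj).eval G.obj)).inv ≍ (ρ_ (p.eval (F ⋙ G).obj)).inv
      rw [h]

end VerticalFunctors

/-! ### Doubly-degenerate `Bicat_s`-categories -/

section Evaluation

open MonoidalCategory

/-- The remaining structure of a doubly-degenerate `Bicat_s`-category, on its only hom-bicategory.

The unique hom-bicategory has one 0-cell (the only 1-cell), so it is a monoidal category `C`, whose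
tensor product `a ⊗ b` is the weak vertical composition "`a` above `b`".  The composition of the
enriched category is a strict functor from the product of this one-object bicategory with itself
(`hObj`, `hHom`; strictness is `interchange_obj`, `interchange_hom` and the preservation of the
constraints; that the units are preserved is `unit_hObj (𝟙_ C)`).  The identity of the enriched
category is a strict functor from the terminal bicategory; its value on the identity 2-cell is `𝟙_ C`
as strict functors preserve identities, and strictness gives the last four fields.  Composition is
strictly associative and unital.  Equations between morphisms whose (co)domains are only
propositionally equal are written with heterogeneous equality. -/
class HorizontalStructure (C : Type u) [Category.{v} C] [MonoidalCategory C] where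
  /-- Horizontal composition of 2-cells (objects of `C`), written `a | b` on paper. -/
  hObj : C → C → C
  /-- Horizontal composition of 3-cells (morphisms of `C`). -/
  hHom : ∀ {a a' b b' : C}, (a ⟶ a') → (b ⟶ b') → (hObj a b ⟶ hObj a' b')
  hHom_id : ∀ a b : C, hHom (𝟙 a) (𝟙 b) = 𝟙 (hObj a b)
  hHom_comp : ∀ {a a' a'' b b' b'' : C} (f : a ⟶ a') (f' : a' ⟶ a'') (g : b ⟶ b') (g' : b' ⟶ b''),
    hHom (f ≫ f') (g ≫ g') = hHom f g ≫ hHom f' g'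
  hObj_assoc : ∀ a b c : C, hObj (hObj a b) c = hObj a (hObj b c)
  hHom_assoc : ∀ {a a' b b' c c' : C} (f : a ⟶ a') (g : b ⟶ b') (k : c ⟶ c'),
    hHom (hHom f g) k ≍ hHom f (hHom g k)
  unit_hObj : ∀ a : C, hObj (𝟙_ C) a = a
  unit_hHom : ∀ {a a' : C} (f : a ⟶ a'), hHom (𝟙 (𝟙_ C)) f ≍ f
  hObj_unit : ∀ a : C, hObj a (𝟙_ C) = a
  hHom_unit : ∀ {a a' : C} (f : a ⟶ a'), hHom f (𝟙 (𝟙_ C)) ≍ f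
  interchange_obj : ∀ a b c d : C, hObj (a ⊗ c) (b ⊗ d) = hObj a b ⊗ hObj c d
  interchange_hom : ∀ {a a' b b' c c' d d' : C}
    (f : a ⟶ a') (g : b ⟶ b') (k : c ⟶ c') (l : d ⟶ d'),
    hHom (f ⊗ₘ k) (g ⊗ₘ l) ≍ hHom f g ⊗ₘ hHom k l
  hHom_associator : ∀ a a' b b' c c' : C,
    hHom (α_ a b c).hom (α_ a' b' c').hom ≍ (α_ (hObj a a') (hObj b b') (hObj c c')).hom
  hHom_leftUnitor : ∀ a a' : C, hHom (λ_ a).hom (λ_ a').hom ≍ (λ_ (hObj a a')).hom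
  hHom_rightUnitor : ∀ a a' : C, hHom (ρ_ a).hom (ρ_ a').hom ≍ (ρ_ (hObj a a')).hom
  unit_tensor_unit : 𝟙_ C ⊗ 𝟙_ C = 𝟙_ C
  associator_unit : (α_ (𝟙_ C) (𝟙_ C) (𝟙_ C)).hom ≍ 𝟙 (𝟙_ C)
  leftUnitor_unit : (λ_ (𝟙_ C)).hom ≍ 𝟙 (𝟙_ C)
  rightUnitor_unit : (ρ_ (𝟙_ C)).hom ≍ 𝟙 (𝟙_ C)

open HorizontalStructure

variable {C : Type u} [Category.{v} C] [MonoidalCategory C] [HorizontalStructure C]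
variable {D : Type u'} [Category.{v'} D] [MonoidalCategory D] [HorizontalStructure D]
variable {E : Type u''} [Category.{v''} E] [MonoidalCategory E] [HorizontalStructure E]
variable {ι : Type w} {κ : Type w'}

/-- The value of a grid: evaluate vertically, then compose horizontally.  For `x = id` this is the
`HV`-algebra structure on objects. -/
def Grid.eval (x : ι → C) : Grid ι → C
  | [] => 𝟙_ C
  | p :: g => hObj (p.eval x) (Grid.eval x g)

/-- A family of morphisms between values of letters induces one between values of grids. -/
def Grid.evalMap {x y : ι → C} (f : ∀ i, x i ⟶ y i) : ∀ g : Grid ι, g.eval x ⟶ g.eval y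
  | [] => 𝟙 _
  | p :: g => hHom (p.evalMap f) (Grid.evalMap f g)

/-- The value of a morphism of grids under a functor. -/
def Grid.Hom.eval (F : C ⥤ D) : ∀ {g h : Grid C}, Grid.Hom g h → (g.eval F.obj ⟶ h.eval F.obj)
  | _, _, .nil => 𝟙 _
  | _, _, .cons φ Φ => hHom (φ.eval F) (Grid.Hom.eval F Φ)

theorem hHom_heq {a a' b b' c c' d d' : C} {f : a ⟶ b} {f' : a' ⟶ b'} {g : c ⟶ d}
    {g' : c' ⟶ d'} (ha : a = a') (hb : b = b') (hc : c = c') (hd : d = d') (hf : f ≍ f')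
    (hg : g ≍ g') : hHom f g ≍ hHom f' g' := by
  subst ha hb hc hd; cases hf; cases hg; rfl

theorem Grid.eval_map (f : ι → κ) (x : κ → C) :
    ∀ g : Grid ι, (g.map f).eval x = g.eval (fun i => x (f i))
  | [] => rfl
  | p :: g => congrArg₂ hObj (Word.eval_map f x p) (Grid.eval_map f x g)

theorem Grid.eval_append (x : ι → C) (g h : Grid ι) :
    Grid.eval x (g ++ h) = hObj (Grid.eval x g) (Grid.eval x h) := by
  induction g with
  | nil => exact (unit_hObj _).symm
  | cons p g ih =>
    change hObj _ (Grid.eval x (g ++ h)) = _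
    rw [ih, ← hObj_assoc]; rfl

theorem Grid.eval_ofFn_unit (x : ι → C) (n : ℕ) :
    Grid.eval x (List.ofFn fun _ : Fin n => Word.unit) = 𝟙_ C := by
  induction n with
  | zero => rfl
  | succ n ih =>
    rw [List.ofFn_succ]
    change hObj (𝟙_ C) _ = _
    rw [unit_hObj, ih]

theorem Grid.eval_ofFn_tensor (x : ι → C) (n : ℕ) (r s : Fin n → Word ι) :
    Grid.eval x (List.ofFn fun k => Word.tensor (r k) (s k)) =
      Grid.eval x (List.ofFn r) ⊗ Grid.eval x (List.ofFn s) := by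
  induction n with
  | zero => exact (unit_tensor_unit).symm
  | succ n ih =>
    simp only [List.ofFn_succ, Grid.eval, ih, Word.eval, interchange_obj]

theorem Grid.eval_row (x : ι → C) (n : ℕ) (p : Word (Fin n → Word ι)) :
    Grid.eval x (List.ofFn fun k => p.bind fun r => r k) =
      p.eval (fun r => Grid.eval x (List.ofFn r)) := by
  induction p with
  | of r => rfl
  | unit => exact Grid.eval_ofFn_unit x n
  | tensor p q hp hq => exact (Grid.eval_ofFn_tensor x n _ _).trans (congrArg₂ _ hp hq)

/-- The associativity axiom of the `HV`-algebra structure. -/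
theorem Nested.eval_flatten (x : ι → C) (N : Nested ι) :
    N.flatten.eval x = N.rows.eval (fun g => g.eval x) := by
  induction N with
  | nil => rfl
  | cons p N ih =>
    change Grid.eval x (_ ++ Nested.flatten N) = hObj _ _
    rw [Grid.eval_append, Grid.eval_row, Word.eval_map]
    exact congrArg _ ih

theorem Grid.evalMap_id (x : ι → C) : ∀ g : Grid ι, g.evalMap (fun i => 𝟙 (x i)) = 𝟙 _
  | [] => rfl
  | p :: g => by simp [Grid.evalMap, Word.evalMap_id, Grid.evalMap_id x g, Grid.eval, hHom_id]

theorem Grid.evalMap_comp {x y z : ι → C} (f : ∀ i, x i ⟶ y i) (f' : ∀ i, y i ⟶ z i) :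
    ∀ g : Grid ι, g.evalMap (fun i => f i ≫ f' i) = g.evalMap f ≫ g.evalMap f'
  | [] => (Category.id_comp _).symm
  | p :: g => by
      rw [Grid.evalMap, Word.evalMap_comp, Grid.evalMap_comp f f' g, hHom_comp]
      rfl

theorem Grid.evalMap_map (k : κ → ι) {x y : ι → C} (f : ∀ i, x i ⟶ y i) : ∀ (g : Grid κ),
    (g.map k).evalMap f ≍ g.evalMap (fun i => f (k i))
  | [] => HEq.rfl
  | p :: g => hHom_heq (Word.eval_map _ _ p) (Word.eval_map _ _ p)
      (Grid.eval_map _ _ g) (Grid.eval_map _ _ g) (Word.evalMap_map k f p) (Grid.evalMap_map k f g)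

theorem evalMap_heq {x y x' y' : ι → C} (hx : x = x') (hy : y = y') (f : ∀ i, x i ⟶ y i)
    (f' : ∀ i, x' i ⟶ y' i) (hf : ∀ i, f i ≍ f' i) (g : Grid ι) :
    g.evalMap f ≍ g.evalMap f' := by
  subst hx hy
  have : f = f' := funext fun i => eq_of_heq (hf i)
  subst this; rfl

end Evaluation

section EvaluationFunctors

open MonoidalCategory

variable {C : Type u} [Category.{v} C] {D : Type u'} [Category.{v'} D]
variable {E : Type u''} [Category.{v''} E] [MonoidalCategory E] [HorizontalStructure E] {ι : Type w}

theorem Grid.homOf_eval (F : C ⥤ E) {x y : ι → C} (f : ∀ i, x i ⟶ y i) :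
    ∀ g : Grid ι, (Grid.homOf f g).eval F ≍ g.evalMap (fun i => F.map (f i))
  | [] => HEq.rfl
  | p :: g => hHom_heq (Word.eval_map _ _ p) (Word.eval_map _ _ p)
      (Grid.eval_map _ _ g) (Grid.eval_map _ _ g) (Word.homOf_eval F f p) (Grid.homOf_eval F f g)

theorem Grid.Hom.map_eval (F : C ⥤ D) (G : D ⥤ E) : ∀ {g h : Grid C} (Φ : Grid.Hom g h),
    (Φ.map F).eval G ≍ Φ.eval (F ⋙ G)
  | _, _, .nil => HEq.rfl
  | _, _, .cons φ Φ => hHom_heq (Word.eval_map _ _ _) (Word.eval_map _ _ _)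
      (Grid.eval_map _ _ _) (Grid.eval_map _ _ _) (φ.map_eval F G) (Grid.Hom.map_eval F G Φ)

end EvaluationFunctors

section WeakMaps

open MonoidalCategory HorizontalStructure

variable {C : Type u} [Category.{v} C] [MonoidalCategory C] [HorizontalStructure C]
variable {D : Type u'} [Category.{v'} D] [MonoidalCategory D] [HorizontalStructure D]
variable {E : Type u''} [Category.{v''} E] [MonoidalCategory E] [HorizontalStructure E]
variable {ι : Type w} {κ : Type w'}

/-! ### Weak maps and transformations -/

/-- Given the components `τ g` at grids `g` in `C`, the component at a grid of letters `i : ι` that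
stand for the objects `x i` (i.e. the component at `g.map x`, up to equality of objects). -/
def constraintAt (F : C ⥤ D)
    (τ : ∀ g : Grid C, g.eval F.obj ≅ F.obj (g.eval (𝟭 C).obj)) (x : ι → C) (g : Grid ι) :
    g.eval (fun i => F.obj (x i)) ≅ F.obj (g.eval x) :=
  eqToIso (Grid.eval_map x F.obj g).symm ≪≫ τ (g.map x) ≪≫
    eqToIso (congrArg F.obj (Grid.eval_map x (𝟭 C).obj g))

theorem WeakMap.unit_eq (F : C ⥤ D) (c : C) :
    Grid.eval F.obj [Word.of c] = F.obj (Grid.eval (𝟭 C).obj [Word.of c]) :=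
  (hObj_unit (F.obj c)).trans (congrArg F.obj (hObj_unit c).symm)

variable (C D) in
/-- A weak map of doubly-degenerate `Bicat_s`-categories, i.e. a weak map of `HV`-algebras.

Its underlying 1-cell in `Cat-Gph-Gph` is a functor `C ⥤ D`.  Its constraint is an invertible 2-cell
`τ : d ∘ HV(F) ⇒ F ∘ c` of `Cat-Gph-Gph`, where `c` and `d` are the algebra structures; as its target
is doubly degenerate, such a 2-cell is just a natural isomorphism between the functors on
hom-categories, with components at all grids. -/
structure WeakMap where
  /-- the underlying functor -/
  functor : C ⥤ D
  /-- the components of the constraint 2-cell -/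
  constraint : ∀ g : Grid C, g.eval functor.obj ≅ functor.obj (g.eval (𝟭 C).obj)
  /-- the constraint is a natural transformation -/
  naturality : ∀ {g h : Grid C} (Φ : Grid.Hom g h),
    Φ.eval functor ≫ (constraint h).hom = (constraint g).hom ≫ functor.map (Φ.eval (𝟭 C))
  /-- the unit axiom of a weak map of algebras -/
  unit : ∀ c : C, (constraint [Word.of c]).hom = eqToHom (WeakMap.unit_eq functor c)
  /-- the multiplication axiom `τ μ = (τ ∘ HV(c)) · (d ∘ HV(τ))` of a weak map of algebras -/
  mult : ∀ N : Nested C,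
    (constraint N.flatten).hom =
      eqToHom (N.eval_flatten functor.obj) ≫
        Grid.evalMap (fun g => (constraint g).hom) N.rows ≫
        (constraintAt functor constraint (fun g => g.eval (𝟭 C).obj) N.rows).hom ≫
        eqToHom (congrArg functor.obj (N.eval_flatten (𝟭 C).obj).symm)

/-- A transformation of weak maps, i.e. a 2-cell of `HV`-algebras: a 2-cell in `Cat-Gph-Gph` between
the underlying 1-cells (here, a natural transformation) compatible with the constraints. -/
structure WeakMap.Transformation (F G : WeakMap C D) where
  /-- the underlying natural transformation -/
  nat : F.functor ⟶ G.functor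
  /-- compatibility with the constraint 2-cells -/
  comm : ∀ g : Grid C,
    Grid.evalMap (fun c => nat.app c) g ≫ (G.constraint g).hom =
      (F.constraint g).hom ≫ nat.app (g.eval (𝟭 C).obj)

namespace WeakMap

/-- The constraint of a weak map at a grid of letters standing for objects. -/
def at_ (F : WeakMap C D) (x : ι → C) (g : Grid ι) :
    g.eval (fun i => F.functor.obj (x i)) ≅ F.functor.obj (g.eval x) :=
  constraintAt F.functor F.constraint x g

theorem at_heq (F : WeakMap C D) (x : ι → C) (g : Grid ι) :
    (F.at_ x g).hom ≍ (F.constraint (g.map x)).hom := by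
  simp [at_, constraintAt]

theorem at_id (F : WeakMap C D) (g : Grid C) : F.at_ (𝟭 C).obj g = F.constraint g := by
  have : g.map (𝟭 C).obj = g := by
    have h : ∀ p : Word C, p.map (𝟭 C).obj = p := fun p => by
      induction p with
      | of => rfl
      | unit => rfl
      | tensor p q hp hq => simp [Word.map, hp, hq]
    have h' : Word.map (𝟭 C).obj = fun p => p := funext h
    rw [Grid.map, h', List.map_id']
  apply Iso.ext; apply eq_of_heq
  refine (F.at_heq _ _).trans ?_
  rw [this]

theorem constraint_heq (F : WeakMap C D) {g h : Grid C} (e : g = h) :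
    (F.constraint g).hom ≍ (F.constraint h).hom := by
  subst e; rfl

theorem at_congr (F : WeakMap C D) {x y : ι → C} (e : x = y) (g : Grid ι) :
    (F.at_ x g).hom ≍ (F.at_ y g).hom := by
  subst e; rfl

theorem at_map_heq (F : WeakMap C D) (f : ι → κ) (x : κ → C) (g : Grid ι) :
    (F.at_ x (g.map f)).hom ≍ (F.at_ (fun i => x (f i)) g).hom := by
  refine (F.at_heq _ _).trans (HEq.trans ?_ (F.at_heq _ _).symm)
  exact F.constraint_heq (Grid.map_map f x g)

theorem at_natural (F : WeakMap C D) {x y : ι → C} (f : ∀ i, x i ⟶ y i) (g : Grid ι) :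
    Grid.evalMap (fun i => F.functor.map (f i)) g ≫ (F.at_ y g).hom =
      (F.at_ x g).hom ≫ F.functor.map (g.evalMap f) := by
  have h := F.naturality (Grid.homOf f g)
  apply eq_of_heq
  refine HEq.trans (comp_heq_comp (Grid.eval_map _ _ _).symm (Grid.eval_map _ _ _).symm
    (congrArg F.functor.obj (Grid.eval_map y (𝟭 C).obj g).symm)
    (Grid.homOf_eval F.functor f g).symm (F.at_heq y g)) ((heq_of_eq h).trans ?_)
  refine comp_heq_comp (Grid.eval_map _ _ _) (congrArg F.functor.obj (Grid.eval_map x (𝟭 C).obj g))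
    (congrArg F.functor.obj (Grid.eval_map y (𝟭 C).obj g)) (F.at_heq x g).symm ?_
  have := Grid.homOf_eval (𝟭 C) f g
  have key : ∀ {a b a' b' : C} (k : a ⟶ b) (l : a' ⟶ b'), a = a' → b = b' → k ≍ l →
      F.functor.map k ≍ F.functor.map l := by
    intro a b a' b' k l h1 h2 h3; subst h1 h2; cases h3; rfl
  exact key _ _ (Grid.eval_map x (𝟭 C).obj g) (Grid.eval_map y (𝟭 C).obj g) this

theorem at_mult (F : WeakMap C D) (x : ι → C) (N : Nested ι) :
    (F.at_ x N.flatten).hom ≍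
      Grid.evalMap (fun g => (F.at_ x g).hom) N.rows ≫
        (F.at_ (fun g => Grid.eval x g) N.rows).hom := by
  refine (F.at_heq x _).trans ?_
  refine (F.constraint_heq (Nested.flatten_map x N)).symm.trans ?_
  rw [F.mult]
  have e1 : (fun g : Grid ι => Grid.eval F.functor.obj (Grid.map x g)) =
    fun g => Grid.eval (fun i => F.functor.obj (x i)) g := funext fun g => Grid.eval_map _ _ g
  have e2 : (fun g : Grid ι => Grid.eval (𝟭 C).obj (Grid.map x g)) =
    fun g => Grid.eval x g := funext fun g => Grid.eval_map _ _ g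
  have e3 : ∀ y : Grid C → D, Grid.eval y (Nested.rows (Nested.map x N)) =
     Grid.eval (fun g => y (Grid.map x g)) N.rows := fun y => by
    rw [Nested.rows_map, Grid.eval_map]
  have e4 : ∀ y : Grid C → C, Grid.eval y (Nested.rows (Nested.map x N)) =
     Grid.eval (fun g => y (Grid.map x g)) N.rows := fun y => by
    rw [Nested.rows_map, Grid.eval_map]
  refine HEq.trans (b := Grid.evalMap (fun g => (F.constraint g).hom)
    (Nested.rows (Nested.map x N)) ≫ (F.at_ (fun g => g.eval (𝟭 C).obj)
      (Nested.rows (Nested.map x N))).hom) ?_ ?_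
  · rw [← Category.assoc (Grid.evalMap _ _)]
    exact eqToHom_comp_heq_comp _ _ _
  · refine comp_heq_comp ?_ ?_ ?_ ?_ ?_
    · rw [e3, e1]
    · rw [e3]; exact congrArg (fun z => Grid.eval (fun i => F.functor.obj (z i)) N.rows) e2
    · rw [e4, e2]
    · have h1 := Grid.evalMap_map (Grid.map x) (fun g => (F.constraint g).hom) (Nested.rows N)
      rw [Nested.rows_map]
      refine h1.trans ?_
      refine evalMap_heq e1 (funext fun i => congrArg F.functor.obj (congrFun e2 i)) _ _ ?_ _
      intro g
      exact (F.at_heq x g).symm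
    · rw [Nested.rows_map]
      refine (F.at_map_heq _ _ _).trans ?_
      exact F.at_congr e2 _

theorem at_hom_natural (F : C ⥤ D) (G : WeakMap D E) {g h : Grid C} (Φ : Grid.Hom g h) :
    Φ.eval (F ⋙ G.functor) ≫ (G.at_ F.obj h).hom =
      (G.at_ F.obj g).hom ≫ G.functor.map (Φ.eval F) := by
  apply eq_of_heq
  have hN := G.naturality (Φ.map F)
  have e : ∀ g : Grid C, Grid.eval G.functor.obj (g.map F.obj) =
    Grid.eval (F ⋙ G.functor).obj g := fun g => Grid.eval_map _ _ g
  have e' : ∀ g : Grid C, G.functor.obj (Grid.eval (𝟭 D).obj (g.map F.obj)) =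
    G.functor.obj (Grid.eval F.obj g) := fun g => congrArg G.functor.obj (Grid.eval_map _ _ g)
  have h1 : (Φ.map F).eval G.functor ≫ (G.constraint (h.map F.obj)).hom ≍
      Φ.eval (F ⋙ G.functor) ≫ (G.at_ F.obj h).hom :=
    comp_heq_comp (e g) (e h) (e' h) (Φ.map_eval F G.functor) (G.at_heq _ h).symm
  have h2 : (G.constraint (g.map F.obj)).hom ≫ G.functor.map ((Φ.map F).eval (𝟭 D)) ≍
      (G.at_ F.obj g).hom ≫ G.functor.map (Φ.eval F) :=
    comp_heq_comp (e g) (e' g) (e' h) (G.at_heq _ g).symm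
      (map_heq _ (Grid.eval_map _ _ _) (Grid.eval_map _ _ _) (Φ.map_eval F (𝟭 D)))
  exact h1.symm.trans ((heq_of_eq hN).trans h2)

/-- The identity weak map. -/
def id (C : Type u) [Category.{v} C] [MonoidalCategory C] [HorizontalStructure C] :
    WeakMap C C where
  functor := 𝟭 C
  constraint g := Iso.refl _
  naturality Φ := (Category.comp_id _).trans (Category.id_comp _).symm
  unit c := rfl
  mult N := by
    apply eq_of_heq
    simp only [constraintAt, Iso.refl_hom, Iso.refl_trans, Iso.trans_hom, eqToIso.hom, eqToHom_trans]
    have h := Grid.evalMap_id (fun g : Grid C => g.eval (𝟭 C).obj) N.rows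
    have h' : Grid.evalMap (fun g : Grid C => 𝟙 (Grid.eval (𝟭 C).obj g)) N.rows =
      eqToHom rfl := h
    erw [h', eqToHom_trans, eqToHom_trans]
    rfl

/-- The constraint of a composite: `(G ∘ τ) · (σ ∘ HV(F))`. -/
def compConstraint (F : WeakMap C D) (G : WeakMap D E) (g : Grid C) :
    g.eval (F.functor ⋙ G.functor).obj ≅ (F.functor ⋙ G.functor).obj (g.eval (𝟭 C).obj) :=
  constraintAt G.functor G.constraint F.functor.obj g ≪≫ G.functor.mapIso (F.constraint g)

theorem compConstraint_at (F : WeakMap C D) (G : WeakMap D E) (x : ι → C) (g : Grid ι) :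
    constraintAt (F.functor ⋙ G.functor) (F.compConstraint G) x g =
      G.at_ (fun i => F.functor.obj (x i)) g ≪≫ G.functor.mapIso (F.at_ x g) := by
  apply Iso.ext; apply eq_of_heq
  refine HEq.trans (b := (F.compConstraint G (g.map x)).hom) ?_ ?_
  · simp [constraintAt]
  · have a1 : Grid.eval G.functor.obj (Grid.map F.functor.obj (Grid.map x g)) =
        Grid.eval (fun i => G.functor.obj (F.functor.obj (x i))) g := by
      rw [Grid.map_map, Grid.eval_map]
    refine comp_heq_comp (Grid.eval_map _ _ _) ?_ ?_ (G.at_map_heq x F.functor.obj g) ?_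
    · exact congrArg G.functor.obj (Grid.eval_map _ _ _)
    · exact congrArg (fun c => G.functor.obj (F.functor.obj c)) (Grid.eval_map _ _ _)
    · exact map_heq _ (Grid.eval_map _ _ _) (congrArg F.functor.obj (Grid.eval_map _ _ _))
        (F.at_heq x g).symm

/-- Composition of weak maps. -/
def comp (F : WeakMap C D) (G : WeakMap D E) : WeakMap C E where
  functor := F.functor ⋙ G.functor
  constraint := F.compConstraint G
  naturality {g h} Φ := by
    have h1 := at_hom_natural F.functor G Φ
    have h2 : Φ.eval (F.functor ⋙ G.functor) ≫ (G.at_ F.functor.obj h).hom ≫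
        G.functor.map (F.constraint h).hom =
      ((G.at_ F.functor.obj g).hom ≫ G.functor.map (F.constraint g).hom) ≫
        G.functor.map (F.functor.map (Φ.eval (𝟭 C))) := by
      rw [← Category.assoc, h1, Category.assoc, Category.assoc, ← G.functor.map_comp, F.naturality,
        G.functor.map_comp]
    exact h2
  unit c := by
    apply eq_of_heq
    change (G.at_ F.functor.obj [Word.of c]).hom ≫ G.functor.map (F.constraint [Word.of c]).hom ≍ _
    have h1 : (G.at_ F.functor.obj [Word.of c]).hom ≍ _ := G.at_heq F.functor.obj [Word.of c]
    have h2 : (G.at_ F.functor.obj [Word.of c]).hom = eqToHom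
      (WeakMap.unit_eq G.functor (F.functor.obj c)) :=
      eq_of_heq (h1.trans (heq_of_eq (G.unit (F.functor.obj c))))
    rw [F.unit, eqToHom_map, h2]
    exact heq_of_eq (eqToHom_trans _ _)
  mult N := by
    apply eq_of_heq
    rw [compConstraint_at]
    change (G.at_ F.functor.obj N.flatten).hom ≫ G.functor.map (F.constraint N.flatten).hom ≍ _
    refine HEq.trans ?_ (eqToHom_comp_heq_comp' _ _ _ _).symm
    have hs : Grid.evalMap (fun g => (F.compConstraint G g).hom) N.rows =
      Grid.evalMap (fun g => (G.at_ F.functor.obj g).hom) N.rows ≫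
        Grid.evalMap (fun g => G.functor.map (F.constraint g).hom) N.rows :=
      Grid.evalMap_comp (fun g => (G.at_ F.functor.obj g).hom)
        (fun g => G.functor.map (F.constraint g).hom) N.rows
    have hn := G.at_natural (fun g => (F.constraint g).hom) N.rows
    have hF := F.mult N
    rw [hs, Category.assoc, Iso.trans_hom]
    refine HEq.trans (b := (Grid.evalMap (fun g => (G.at_ F.functor.obj g).hom) N.rows ≫
      (G.at_ (fun g : Grid C => g.eval F.functor.obj) N.rows).hom) ≫ G.functor.map
       (Grid.evalMap (fun g => (F.constraint g).hom) N.rows ≫ (F.at_ (fun g : Grid C => g.eval (𝟭 C).obj) N.rows).hom)) ?_ ?_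
    · refine comp_heq_comp (N.eval_flatten _) (congrArg G.functor.obj (N.eval_flatten _)) ?_
        (G.at_mult _ N) ?_
      · exact congrArg (fun c => G.functor.obj (F.functor.obj c)) (N.eval_flatten _)
      · refine map_heq _ (N.eval_flatten _) (congrArg F.functor.obj (N.eval_flatten _)) ?_
        rw [hF, ← Category.assoc (Grid.evalMap _ _)]
        exact eqToHom_comp_heq_comp _ _ _
    · apply heq_of_eq
      rw [G.functor.map_comp, Category.assoc]
      refine congrArg (_ ≫ ·) ?_
      exact (Category.assoc _ _ _).symm.trans
        ((congrArg (· ≫ G.functor.map (F.at_ (fun g : Grid C => g.eval (𝟭 C).obj) N.rows).hom)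
          hn.symm).trans (Category.assoc _ _ _))

theorem ext' {F G : WeakMap C D} (h : F.functor = G.functor)
    (h' : ∀ g, (F.constraint g).hom ≍ (G.constraint g).hom) : F = G := by
  obtain ⟨F, τ, _, _, _⟩ := F
  obtain ⟨G, σ, _, _, _⟩ := G
  obtain rfl : F = G := h
  obtain rfl : τ = σ := funext fun g => Iso.ext (eq_of_heq (h' g))
  rfl

theorem id_comp' (F : WeakMap C D) : (WeakMap.id C).comp F = F := by
  refine ext' rfl fun g => heq_of_eq ?_
  change (F.at_ (𝟭 C).obj g).hom ≫ F.functor.map (𝟙 _) = _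
  rw [at_id, F.functor.map_id]
  exact Category.comp_id _

theorem comp_id' (F : WeakMap C D) : F.comp (WeakMap.id D) = F := by
  refine ext' rfl fun g => heq_of_eq ?_
  change ((WeakMap.id D).at_ F.functor.obj g).hom ≫ (F.constraint g).hom = _
  have : ((WeakMap.id D).at_ F.functor.obj g).hom = 𝟙 _ := by
    refine eq_of_heq (((WeakMap.id D).at_heq F.functor.obj g).trans ?_)
    change 𝟙 (Grid.eval (𝟭 D).obj (g.map F.functor.obj)) ≍ 𝟙 (Grid.eval F.functor.obj g)
    rw [show Grid.eval (𝟭 D).obj (g.map F.functor.obj) = Grid.eval F.functor.obj g from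
      Grid.eval_map _ _ g]
  rw [this]
  exact Category.id_comp _

theorem assoc' {E' : Type*} [Category E'] [MonoidalCategory E'] [HorizontalStructure E']
    (F : WeakMap C D) (G : WeakMap D E) (H : WeakMap E E') :
    (F.comp G).comp H = F.comp (G.comp H) := by
  refine ext' rfl fun g => heq_of_eq ?_
  change (H.at_ (F.functor ⋙ G.functor).obj g).hom ≫ H.functor.map ((G.at_ F.functor.obj g).hom ≫
    G.functor.map (F.constraint g).hom) = (constraintAt (G.functor ⋙ H.functor)
      (G.compConstraint H) F.functor.obj g).hom ≫ H.functor.map (G.functor.map (F.constraint g).hom)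
  rw [compConstraint_at, H.functor.map_comp]
  exact (Category.assoc _ _ _).symm

namespace Transformation

@[ext]
theorem ext' {F G : WeakMap C D} {θ φ : Transformation F G} (h : θ.nat = φ.nat) : θ = φ := by
  cases θ; cases φ; cases h; rfl

/-- The identity transformation. -/
def id (F : WeakMap C D) : Transformation F F where
  nat := 𝟙 _
  comm g := by
    have := Grid.evalMap_id F.functor.obj g
    erw [this, Category.id_comp, Category.comp_id]

/-- Vertical composition of transformations. -/
def comp {F G H : WeakMap C D} (θ : Transformation F G) (φ : Transformation G H) :
    Transformation F H where
  nat := θ.nat ≫ φ.nat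
  comm g := by
    have := Grid.evalMap_comp (fun c => θ.nat.app c) (fun c => φ.nat.app c) g
    erw [this, Category.assoc, φ.comm, ← Category.assoc, θ.comm, Category.assoc]
    rfl

instance : Category (WeakMap C D) where
  Hom F G := Transformation F G
  id F := Transformation.id F
  comp θ φ := Transformation.comp θ φ
  id_comp _ := Transformation.ext' (Category.id_comp _)
  comp_id _ := Transformation.ext' (Category.comp_id _)
  assoc _ _ _ := Transformation.ext' (Category.assoc _ _ _)

/-- Whiskering of a transformation by a weak map on the source side. -/
def whiskerLeft (F : WeakMap C D) {G H : WeakMap D E} (θ : Transformation G H) :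
    Transformation (F.comp G) (F.comp H) where
  nat := Functor.whiskerLeft F.functor θ.nat
  comm g := by
    have h1 : Grid.evalMap (fun c => θ.nat.app (F.functor.obj c)) g ≫ (H.at_ F.functor.obj g).hom =
        (G.at_ F.functor.obj g).hom ≫ θ.nat.app (g.eval F.functor.obj) := by
      apply eq_of_heq
      have e : ∀ K : D ⥤ E, Grid.eval K.obj (g.map F.functor.obj) =
        Grid.eval (fun c => K.obj (F.functor.obj c)) g := fun K => Grid.eval_map _ _ g
      have e' : Grid.eval (𝟭 D).obj (g.map F.functor.obj) = Grid.eval F.functor.obj g :=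
        Grid.eval_map _ _ g
      have hn : θ.nat.app (Grid.eval (𝟭 D).obj (g.map F.functor.obj)) ≍
          θ.nat.app (Grid.eval F.functor.obj g) := by rw [e']
      exact (comp_heq_comp (e G.functor) (e H.functor) (congrArg _ e')
        (Grid.evalMap_map F.functor.obj (fun d => θ.nat.app d) g) (H.at_heq _ g).symm).symm.trans
        ((heq_of_eq (θ.comm (g.map F.functor.obj))).trans
          (comp_heq_comp (e G.functor) (congrArg _ e') (congrArg _ e') (G.at_heq _ g).symm hn))
    change Grid.evalMap (fun c => θ.nat.app (F.functor.obj c)) g ≫ (H.at_ F.functor.obj g).hom ≫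
      H.functor.map (F.constraint g).hom = ((G.at_ F.functor.obj g).hom ≫
        G.functor.map (F.constraint g).hom) ≫ θ.nat.app _
    rw [Category.assoc, θ.nat.naturality, ← Category.assoc, h1, Category.assoc]

/-- Whiskering of a transformation by a weak map on the target side. -/
def whiskerRight {F G : WeakMap C D} (θ : Transformation F G) (H : WeakMap D E) :
    Transformation (F.comp H) (G.comp H) where
  nat := Functor.whiskerRight θ.nat H.functor
  comm g := by
    have h1 := H.at_natural (fun c => θ.nat.app c) g
    change Grid.evalMap (fun c => H.functor.map (θ.nat.app c)) g ≫ (H.at_ G.functor.obj g).hom ≫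
      H.functor.map (G.constraint g).hom = ((H.at_ F.functor.obj g).hom ≫
        H.functor.map (F.constraint g).hom) ≫ H.functor.map (θ.nat.app _)
    have h2 : H.functor.map (Grid.evalMap (fun c => θ.nat.app c) g ≫ (G.constraint g).hom) =
      H.functor.map ((F.constraint g).hom ≫ θ.nat.app _) := congrArg _ (θ.comm g)
    rw [H.functor.map_comp, H.functor.map_comp] at h2
    rw [Category.assoc, ← h2]
    exact (Category.assoc _ _ _).symm.trans ((congrArg (· ≫ _) h1).trans (Category.assoc _ _ _))

theorem eqToHom_nat {F G : WeakMap C D} (h : F = G) :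
    (eqToHom h : F ⟶ G).nat = eqToHom (congrArg WeakMap.functor h) := by
  subst h; rfl

/-- The invertible transformation with a given identity-like underlying transformation between equal
weak maps. -/
def isoOfEq {F G : WeakMap C D} (h : F = G) (e : F.functor ≅ G.functor)
    (he : e.hom = eqToHom (congrArg WeakMap.functor h)) : F ≅ G where
  hom := ⟨e.hom, by rw [he, ← eqToHom_nat h]; exact (eqToHom h : F ⟶ G).comm⟩
  inv := ⟨e.inv, by
    have : e.inv = eqToHom (congrArg WeakMap.functor h).symm := by
      rw [← cancel_epi e.hom, e.hom_inv_id, he]; simp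
    rw [this, ← eqToHom_nat h.symm]; exact (eqToHom h.symm : G ⟶ F).comm⟩
  hom_inv_id := Transformation.ext' e.hom_inv_id
  inv_hom_id := Transformation.ext' e.inv_hom_id

theorem isoOfEq_eq {F G : WeakMap C D} (h : F = G) (e : F.functor ≅ G.functor)
    (he : e.hom = eqToHom (congrArg WeakMap.functor h)) : isoOfEq h e he = eqToIso h := by
  apply Iso.ext; apply Transformation.ext'
  exact he.trans (eqToHom_nat h).symm

end Transformation

end WeakMap

/-! ### The braiding and the vertical structure -/

/-- The standard braiding
`a ⊗ b = (1 | a) ⊗ (b | 1) = (1 ⊗ b) | (a ⊗ 1) ≅ b | a ≅ (b ⊗ 1) | (1 ⊗ a) = (b | 1) ⊗ (1 | a) = b ⊗ a`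
on the vertical monoidal structure of a doubly-degenerate `Bicat_s`-category. -/
def standardBraiding (a b : C) : a ⊗ b ⟶ b ⊗ a :=
  eqToHom (by rw [interchange_obj, unit_hObj, hObj_unit]) ≫
    hHom (λ_ b).hom (ρ_ a).hom ≫ hHom (ρ_ b).inv (λ_ a).inv ≫
    eqToHom (by rw [interchange_obj, unit_hObj, hObj_unit])

/-- The unit constraint of a weak map: its constraint at the empty grid. -/
def WeakMap.unitConstraint (F : WeakMap C D) : 𝟙_ D ⟶ F.functor.obj (𝟙_ C) :=
  (F.constraint []).hom

/-- The vertical monoidality constraint of a weak map: its constraint at the grid with one column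
that has the entries `a` and `b`. -/
def WeakMap.verticalConstraint (F : WeakMap C D) (a b : C) :
    F.functor.obj a ⊗ F.functor.obj b ⟶ F.functor.obj (a ⊗ b) :=
  eqToHom (hObj_unit _).symm ≫ (F.constraint [.tensor (.of a) (.of b)]).hom ≫
    eqToHom (congrArg F.functor.obj (hObj_unit _))

end WeakMaps

/-! ### The 2-category of doubly-degenerate `Bicat_s`-categories -/

/-- A doubly-degenerate `Bicat_s`-category. -/
structure DDBicatsCat where
  carrier : Type u
  [category : Category.{v} carrier]
  [vertical : MonoidalCategory carrier]
  [horizontal : HorizontalStructure carrier]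

namespace DDBicatsCat

attribute [instance] category vertical horizontal

instance : CategoryStruct DDBicatsCat.{v, u} where
  Hom X Y := WeakMap X.carrier Y.carrier
  id X := WeakMap.id X.carrier
  comp F G := WeakMap.comp F G

open WeakMap

/-- The 2-category of doubly-degenerate `Bicat_s`-categories, weak maps and transformations. -/
instance : Bicategory DDBicatsCat.{v, u} where
  homCategory X Y := inferInstanceAs (Category (WeakMap X.carrier Y.carrier))
  whiskerLeft F _ _ θ := Transformation.whiskerLeft F θ
  whiskerRight θ H := Transformation.whiskerRight θ H
  associator F G H := Transformation.isoOfEq (WeakMap.assoc' F G H)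
    (Functor.associator F.functor G.functor H.functor) rfl
  leftUnitor F := Transformation.isoOfEq (WeakMap.id_comp' F) F.functor.leftUnitor rfl
  rightUnitor F := Transformation.isoOfEq (WeakMap.comp_id' F) F.functor.rightUnitor rfl
  whiskerLeft_id F G := Transformation.ext' (Functor.whiskerLeft_id' _)
  whiskerLeft_comp F _ _ _ θ φ := Transformation.ext' (Functor.whiskerLeft_comp _ _ _)
  id_whiskerRight F G := Transformation.ext' (Functor.whiskerRight_id' _)
  comp_whiskerRight θ φ G := Transformation.ext' (Functor.whiskerRight_comp _ _ _)
  id_whiskerLeft θ := Transformation.ext' (by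
    ext c; exact ((Category.id_comp _).trans (Category.comp_id _)).symm)
  comp_whiskerLeft F G _ _ θ := Transformation.ext' (by
    ext c; exact ((Category.id_comp _).trans (Category.comp_id _)).symm)
  whiskerRight_id θ := Transformation.ext' (by
    ext c; exact ((Category.id_comp _).trans (Category.comp_id _)).symm)
  whiskerRight_comp θ G H := Transformation.ext' (by
    ext c; exact ((Category.id_comp _).trans (Category.comp_id _)).symm)
  whisker_assoc F _ _ θ G := Transformation.ext' (by
    ext c; exact ((Category.id_comp _).trans (Category.comp_id _)).symm)
  whisker_exchange {X Y Z F G H K} θ φ := Transformation.ext' (by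
    ext c; exact (φ.nat.naturality (θ.nat.app c)).symm)
  pentagon F G H K := Transformation.ext' (Functor.pentagon _ _ _ _)
  triangle F G := Transformation.ext' (Functor.triangle _ _)

instance : Bicategory.Strict DDBicatsCat.{v, u} where
  id_comp F := WeakMap.id_comp' F
  comp_id F := WeakMap.comp_id' F
  assoc F G H := WeakMap.assoc' F G H
  leftUnitor_eqToIso _ := Transformation.isoOfEq_eq _ _ _
  rightUnitor_eqToIso _ := Transformation.isoOfEq_eq _ _ _
  associator_eqToIso _ _ _ := Transformation.isoOfEq_eq _ _ _

end DDBicatsCat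

/-! ### The 2-category of braided monoidal categories -/

section BraidedMonoidal

open MonoidalCategory

/-- A braided monoidal category. -/
structure BrMonCat where
  carrier : Type u
  [category : Category.{v} carrier]
  [monoidal : MonoidalCategory carrier]
  [braided : BraidedCategory carrier]

namespace BrMonCat

attribute [instance] category monoidal braided

/-- A braided (strong) monoidal functor. -/
structure Hom (A B : BrMonCat.{v, u}) where
  functor : A.carrier ⥤ B.carrier
  [braided : functor.Braided]

attribute [instance] Hom.braided

/-- A monoidal natural transformation. -/
structure Hom₂ {A B : BrMonCat.{v, u}} (F G : Hom A B) where
  nat : F.functor ⟶ G.functor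
  [isMonoidal : NatTrans.IsMonoidal nat]

attribute [instance] Hom₂.isMonoidal

open Functor.LaxMonoidal in
theorem Hom.ext' {A B : BrMonCat.{v, u}} {F G : Hom A B} (h : F.functor = G.functor)
    (hε : ε F.functor ≍ ε G.functor)
    (hμ : ∀ a b, μ F.functor a b ≍ μ G.functor a b) : F = G := by
  obtain @⟨F, bF⟩ := F
  obtain @⟨G, bG⟩ := G
  obtain rfl : F = G := h
  have hε' : bF.ε = bG.ε := eq_of_heq hε
  have hμ' : ∀ a b, bF.μ a b = bG.μ a b := fun a b => eq_of_heq (hμ a b)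
  have hη : bF.η = bG.η := by
    rw [← Category.comp_id bF.η, ← bG.ε_η, ← hε', ← Category.assoc, bF.η_ε, Category.id_comp]
  have hδ : ∀ a b, bF.δ a b = bG.δ a b := fun a b => by
    rw [← Category.comp_id (bF.δ a b), ← bG.μ_δ, ← hμ', ← Category.assoc, bF.δ_μ,
      Category.id_comp]
  congr 1
  exact Functor.Braided.ext hε' (funext fun a => funext fun b => hμ' a b) hη
    (funext fun a => funext fun b => hδ a b)

@[ext]
theorem Hom₂.ext' {A B : BrMonCat.{v, u}} {F G : Hom A B} {θ φ : Hom₂ F G}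
    (h : θ.nat = φ.nat) : θ = φ := by
  cases θ; cases φ; cases h; rfl

instance : CategoryStruct BrMonCat.{v, u} where
  Hom := Hom
  id A := ⟨𝟭 A.carrier⟩
  comp F G := ⟨F.functor ⋙ G.functor⟩

instance (A B : BrMonCat.{v, u}) : Category (Hom A B) where
  Hom := Hom₂
  id F := ⟨𝟙 F.functor⟩
  comp θ φ := ⟨θ.nat ≫ φ.nat⟩
  id_comp _ := Hom₂.ext' (Category.id_comp _)
  comp_id _ := Hom₂.ext' (Category.comp_id _)
  assoc _ _ _ := Hom₂.ext' (Category.assoc _ _ _)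

/-- An invertible 2-cell from a monoidal natural isomorphism. -/
def isoMk {A B : BrMonCat.{v, u}} {F G : Hom A B} (e : F.functor ≅ G.functor)
    [NatTrans.IsMonoidal e.hom] : F ≅ G where
  hom := ⟨e.hom⟩
  inv := ⟨e.inv⟩
  hom_inv_id := Hom₂.ext' e.hom_inv_id
  inv_hom_id := Hom₂.ext' e.inv_hom_id

/-- The 2-category of braided monoidal categories, braided monoidal functors and monoidal
transformations. -/
instance : Bicategory BrMonCat.{v, u} where
  homCategory A B := inferInstanceAs (Category (Hom A B))
  whiskerLeft F _ _ θ := ⟨Functor.whiskerLeft F.functor θ.nat⟩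
  whiskerRight θ H := ⟨Functor.whiskerRight θ.nat H.functor⟩
  associator F G H := isoMk (Functor.associator F.functor G.functor H.functor)
  leftUnitor F := isoMk F.functor.leftUnitor
  rightUnitor F := isoMk F.functor.rightUnitor
  whiskerLeft_id F G := Hom₂.ext' (Functor.whiskerLeft_id' _)
  whiskerLeft_comp F _ _ _ θ φ := Hom₂.ext' (Functor.whiskerLeft_comp _ _ _)
  id_whiskerRight F G := Hom₂.ext' (Functor.whiskerRight_id' _)
  comp_whiskerRight θ φ G := Hom₂.ext' (Functor.whiskerRight_comp _ _ _)
  id_whiskerLeft θ := Hom₂.ext' (by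
    ext c; exact ((Category.id_comp _).trans (Category.comp_id _)).symm)
  comp_whiskerLeft F G _ _ θ := Hom₂.ext' (by
    ext c; exact ((Category.id_comp _).trans (Category.comp_id _)).symm)
  whiskerRight_id θ := Hom₂.ext' (by
    ext c; exact ((Category.id_comp _).trans (Category.comp_id _)).symm)
  whiskerRight_comp θ G H := Hom₂.ext' (by
    ext c; exact ((Category.id_comp _).trans (Category.comp_id _)).symm)
  whisker_assoc F _ _ θ G := Hom₂.ext' (by
    ext c; exact ((Category.id_comp _).trans (Category.comp_id _)).symm)
  whisker_exchange {X Y Z F G H K} θ φ := Hom₂.ext' (by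
    ext c; exact (φ.nat.naturality (θ.nat.app c)).symm)
  pentagon F G H K := Hom₂.ext' (Functor.pentagon _ _ _ _)
  triangle F G := Hom₂.ext' (Functor.triangle _ _)

theorem eqToHom_nat {A B : BrMonCat.{v, u}} {F G : A ⟶ B} (h : F = G) :
    (eqToHom h : F ⟶ G).nat = eqToHom (congrArg Hom.functor h) := by
  subst h; rfl

theorem isoMk_eq {A B : BrMonCat.{v, u}} {F G : A ⟶ B} (h : F = G)
    (e : F.functor ≅ G.functor) [NatTrans.IsMonoidal e.hom]
    (he : e.hom = eqToHom (congrArg Hom.functor h)) : (isoMk e : F ≅ G) = eqToIso h := by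
  apply Iso.ext; apply Hom₂.ext'
  exact he.trans (eqToHom_nat h).symm

open Functor.LaxMonoidal in
instance : Bicategory.Strict BrMonCat.{v, u} :=
  have h1 : ∀ {A B : BrMonCat.{v, u}} (F : A ⟶ B), 𝟙 A ≫ F = F := fun F =>
    Hom.ext' rfl (by
      change ε F.functor ≫ F.functor.map (𝟙 _) ≍ _
      rw [F.functor.map_id, Category.comp_id]) fun a b => by
      change μ F.functor a b ≫ F.functor.map (𝟙 _) ≍ _
      rw [F.functor.map_id, Category.comp_id]
  have h2 : ∀ {A B : BrMonCat.{v, u}} (F : A ⟶ B), F ≫ 𝟙 B = F := fun F =>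
    Hom.ext' rfl (heq_of_eq (Category.id_comp _)) fun a b => heq_of_eq (Category.id_comp _)
  have h3 : ∀ {A B C D : BrMonCat.{v, u}} (F : A ⟶ B) (G : B ⟶ C) (H : C ⟶ D),
      (F ≫ G) ≫ H = F ≫ G ≫ H := fun F G H =>
    Hom.ext' rfl (by
      change ε H.functor ≫ H.functor.map (ε G.functor ≫ G.functor.map (ε F.functor)) ≍
        (ε H.functor ≫ H.functor.map (ε G.functor)) ≫ H.functor.map (G.functor.map (ε F.functor))
      rw [H.functor.map_comp, Category.assoc]) fun a b => by
      change μ H.functor _ _ ≫ H.functor.map (μ G.functor _ _ ≫ G.functor.map (μ F.functor a b)) ≍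
        (μ H.functor _ _ ≫ H.functor.map (μ G.functor _ _)) ≫
          H.functor.map (G.functor.map (μ F.functor a b))
      rw [H.functor.map_comp, Category.assoc]
  { id_comp := h1
    comp_id := h2
    assoc := h3
    leftUnitor_eqToIso := fun F => isoMk_eq (h1 F) _ rfl
    rightUnitor_eqToIso := fun F => isoMk_eq (h2 F) _ rfl
    associator_eqToIso := fun F G H => isoMk_eq (h3 F G H) _ rfl }

end BrMonCat

end BraidedMonoidal

/-! ### Biadjoint biequivalences -/

section Biequivalence

open Bicategory
open scoped Pseudofunctor.StrongTrans

section Triangles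

variable {B : Type u₁} [Bicategory.{w₁, v₁} B] {C : Type u₂} [Bicategory.{w₂, v₂} C]
  {F : B ⥤ᵖ C} {G : C ⥤ᵖ B}
  (unit : Pseudofunctor.id B ⟶ F.comp G) (counit : G.comp F ⟶ Pseudofunctor.id C)

/-- The component of the unit at `b`. -/
def unitApp (b : B) : b ⟶ G.obj (F.obj b) := unit.app b

/-- The component of the counit at `c`. -/
def counitApp (c : C) : F.obj (G.obj c) ⟶ c := counit.app c

/-- The naturality constraint of the unit at `f`. -/
def unitNat {b b' : B} (f : b ⟶ b') :
    f ≫ unitApp unit b' ≅ unitApp unit b ≫ G.map (F.map f) := unit.naturality f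

/-- The naturality constraint of the counit at `k`. -/
def counitNat {c c' : C} (k : c ⟶ c') :
    F.map (G.map k) ≫ counitApp counit c' ≅ counitApp counit c ≫ k := counit.naturality k

/-- The image under a pseudofunctor of a square that commutes up to an invertible 2-cell. -/
def mapSquare {B : Type u₁} [Bicategory.{w₁, v₁} B] {C : Type u₂} [Bicategory.{w₂, v₂} C]
    (F : B ⥤ᵖ C) {a b b' c : B} {f : a ⟶ b} {g : b ⟶ c} {f' : a ⟶ b'} {g' : b' ⟶ c}
    (σ : f ≫ g ≅ f' ≫ g') : F.map f ≫ F.map g ≅ F.map f' ≫ F.map g' :=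
  (F.mapComp f g).symm ≪≫ F.map₂Iso σ ≪≫ F.mapComp f' g'

/-- The naturality constraint at `f` of the transformation `F ⇒ F G F ⇒ F`. -/
def leftTriangleNat {b b' : B} (f : b ⟶ b') :
    F.map f ≫ F.map (unitApp unit b') ≫ counitApp counit (F.obj b') ≅
      (F.map (unitApp unit b) ≫ counitApp counit (F.obj b)) ≫ F.map f :=
  (α_ _ _ _).symm ≪≫ whiskerRightIso (mapSquare F (unitNat unit f)) _ ≪≫ α_ _ _ _ ≪≫
    whiskerLeftIso _ (counitNat counit (F.map f)) ≪≫ (α_ _ _ _).symm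

/-- The naturality constraint at `k` of the transformation `G ⇒ G F G ⇒ G`. -/
def rightTriangleNat {c c' : C} (k : c ⟶ c') :
    G.map k ≫ unitApp unit (G.obj c') ≫ G.map (counitApp counit c') ≅
      (unitApp unit (G.obj c) ≫ G.map (counitApp counit c)) ≫ G.map k :=
  (α_ _ _ _).symm ≪≫ whiskerRightIso (unitNat unit (G.map k)) _ ≪≫ α_ _ _ _ ≪≫
    whiskerLeftIso _ (mapSquare G (counitNat counit k)) ≪≫ (α_ _ _ _).symm

end Triangles

/-- A biadjoint biequivalence between bicategories: pseudofunctors in both directions, adjoint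
equivalences (in the bicategories of pseudofunctors, pseudonatural transformations and modifications)
`1 ≃ G F` and `F G ≃ 1`, and invertible modifications filling the two triangles, subject to the two
swallowtail equations. -/
structure BiadjointBiequivalence (B : Type u₁) [Bicategory.{w₁, v₁} B]
    (C : Type u₂) [Bicategory.{w₂, v₂} C] where
  /-- the pseudofunctor `F` -/
  functor : B ⥤ᵖ C
  /-- the pseudofunctor `G` -/
  inverse : C ⥤ᵖ B
  /-- the adjoint equivalence `1 ≃ G F` -/
  unit : Bicategory.Equivalence (Pseudofunctor.id B) (functor.comp inverse)
  /-- the adjoint equivalence `F G ≃ 1` -/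
  counit : Bicategory.Equivalence (inverse.comp functor) (Pseudofunctor.id C)
  /-- the components of the modification from `F ⇒ F G F ⇒ F` to the identity -/
  leftTriangulator : ∀ b : B,
    functor.map (unitApp unit.hom b) ≫ counitApp counit.hom (functor.obj b) ≅ 𝟙 (functor.obj b)
  leftTriangulator_naturality : ∀ {b b' : B} (f : b ⟶ b'),
    functor.map f ◁ (leftTriangulator b').hom ≫ (ρ_ (functor.map f)).hom =
      (leftTriangleNat unit.hom counit.hom f).hom ≫
        (leftTriangulator b).hom ▷ functor.map f ≫ (λ_ (functor.map f)).hom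
  /-- the components of the modification from the identity to `G ⇒ G F G ⇒ G` -/
  rightTriangulator : ∀ c : C,
    𝟙 (inverse.obj c) ≅ unitApp unit.hom (inverse.obj c) ≫ inverse.map (counitApp counit.hom c)
  rightTriangulator_naturality : ∀ {c c' : C} (k : c ⟶ c'),
    (ρ_ (inverse.map k)).inv ≫ inverse.map k ◁ (rightTriangulator c').hom ≫
        (rightTriangleNat unit.hom counit.hom k).hom =
      (λ_ (inverse.map k)).inv ≫ (rightTriangulator c).hom ▷ inverse.map k
  swallowtail_unit : ∀ b : B,
    (ρ_ (unitApp unit.hom b)).inv ≫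
      unitApp unit.hom b ◁ (rightTriangulator (functor.obj b)).hom ≫
      (α_ _ _ _).inv ≫
      (unitNat unit.hom (unitApp unit.hom b)).hom ▷
        inverse.map (counitApp counit.hom (functor.obj b)) ≫
      (α_ _ _ _).hom ≫
      unitApp unit.hom b ◁ ((inverse.mapComp _ _).inv ≫
        inverse.map₂ (leftTriangulator b).hom ≫ (inverse.mapId _).hom) ≫
      (ρ_ (unitApp unit.hom b)).hom = 𝟙 (unitApp unit.hom b)
  swallowtail_counit : ∀ c : C,
    (λ_ (counitApp counit.hom c)).inv ≫
      ((functor.mapId _).inv ≫ functor.map₂ (rightTriangulator c).hom ≫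
        (functor.mapComp _ _).hom) ▷ counitApp counit.hom c ≫
      (α_ _ _ _).hom ≫
      functor.map (unitApp unit.hom (inverse.obj c)) ◁
        (counitNat counit.hom (counitApp counit.hom c)).hom ≫
      (α_ _ _ _).inv ≫
      (leftTriangulator (inverse.obj c)).hom ▷ counitApp counit.hom c ≫
      (λ_ (counitApp counit.hom c)).hom = 𝟙 (counitApp counit.hom c)

end Biequivalence

end DDB

/-! The first ingredient is an Eckmann-Hilton argument. Since `1` is a strict horizontal unit, each
cell is both `a | 1` and `1 | a`, and strict interchange turns a vertical composite into a row of
two columns. If all morphisms in a pasting split into columns (`IsColumns`), an equation between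
pastings follows from the two column equations (`IsColumns.unique`). The columns of the standard
braiding are composites of unit constraints, so the hexagons become coherence statements
(`standardBraided`). The same method compares the products: `tensorIsoHObj : a ⊗ b ≅ a | b` is
compatible with associativity, and it takes the middle-four interchange `tensorμ` to strict
interchange (`tensorIsoHObj_assoc`, `tensorIsoHObj_interchange`).

The second ingredient is that weak maps are the same data as braided strong monoidal functors. The
multiplication axiom, applied to small nested grids, expresses every component of `τ` through the
empty grid and the grids `a` above `b` (`wordConstraint_tensor`, `constraint_of_of`,
`constraint_cons`). Naturality of `τ` at formal constraints gives the monoidal axioms, and at the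
grid morphism underlying the braiding it gives braidedness (`verticalConstraint_braiding`).
Conversely, a braided functor yields constraints at all grids, whose multiplication axiom rests on
`horizontalμ_assoc` and `horizontalμ_interchange` (`BraidedLift.weakMap`). So `U` is surjective on
1-cells between given objects (`underlyingMap_lift`) and bijective on 2-cells
(`Transformation.ofMonoidal`).

The third ingredient is essential surjectivity. `Strictification B` has formal composites as objects
and morphisms of `B` between their values as morphisms. Horizontal composition concatenates lists
and merges the vertical factors separately, so it is strictly associative, unital and interchanging
on objects. On morphisms the strict equations amount to the compatibility of `⊗ : B × B → B` with
the constraints, which the braiding of `B` provides. The standard braiding of the result evaluates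
to the braiding of `B` (`eval_braiding`), so evaluation is a braided equivalence.

The rest is formal. With `E` the evaluation and `S` its adjoint inverse, the pseudofunctor
`strictification` sends `k` to a lift of `E ≫ k ≫ S`. Units and counits consist of (lifts of)
sections and evaluations. Triangles and swallowtails are checked on components, where they reduce to
naturality of `r : S ⋙ E ≅ 𝟭` and the triangle identities. -/

/-! ### Horizontal composites of morphisms -/

namespace DDB

open MonoidalCategory HorizontalStructure

section Columns

variable {C : Type u} [Category.{v} C] [MonoidalCategory C] [HorizontalStructure C]

/-- `f` is the horizontal composite of `f₁` and `f₂`, up to equality of the (co)domains. -/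
structure IsColumns {x y x₁ y₁ x₂ y₂ : C} (f : x ⟶ y) (f₁ : x₁ ⟶ y₁) (f₂ : x₂ ⟶ y₂) : Prop where
  source : x = hObj x₁ x₂
  target : y = hObj y₁ y₂
  heq : f ≍ hHom f₁ f₂

namespace IsColumns

variable {x y z x' y' x₁ y₁ z₁ x₂ y₂ z₂ x₁' y₁' x₂' y₂' : C}

theorem hHom (f₁ : x₁ ⟶ y₁) (f₂ : x₂ ⟶ y₂) : IsColumns (hHom f₁ f₂) f₁ f₂ :=
  ⟨rfl, rfl, HEq.rfl⟩

/-- This is how equations between pastings are proved: once both sides are presented by the same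
columns, no cast along interchange has to be moved through a composite. -/
theorem unique {f g : x ⟶ y} {f₁ : x₁ ⟶ y₁} {f₂ : x₂ ⟶ y₂}
    (hf : IsColumns f f₁ f₂) (hg : IsColumns g f₁ f₂) : f = g :=
  eq_of_heq (hf.heq.trans hg.heq.symm)

theorem comp {f : x ⟶ y} {g : y ⟶ z} {f₁ : x₁ ⟶ y₁} {f₂ : x₂ ⟶ y₂} {g₁ : y₁ ⟶ z₁} {g₂ : y₂ ⟶ z₂}
    (hf : IsColumns f f₁ f₂) (hg : IsColumns g g₁ g₂) :
    IsColumns (f ≫ g) (f₁ ≫ g₁) (f₂ ≫ g₂) := by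
  obtain ⟨rfl, rfl, hf⟩ := hf
  obtain ⟨_, rfl, hg⟩ := hg
  refine ⟨rfl, rfl, ?_⟩
  rw [eq_of_heq hf, eq_of_heq hg, hHom_comp]

theorem tensor {f : x ⟶ y} {g : x' ⟶ y'} {f₁ : x₁ ⟶ y₁} {f₂ : x₂ ⟶ y₂}
    {g₁ : x₁' ⟶ y₁'} {g₂ : x₂' ⟶ y₂'} (hf : IsColumns f f₁ f₂) (hg : IsColumns g g₁ g₂) :
    IsColumns (f ⊗ₘ g) (f₁ ⊗ₘ g₁) (f₂ ⊗ₘ g₂) := by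
  obtain ⟨rfl, rfl, hf⟩ := hf
  obtain ⟨rfl, rfl, hg⟩ := hg
  refine ⟨(interchange_obj _ _ _ _).symm, (interchange_obj _ _ _ _).symm, ?_⟩
  rw [eq_of_heq hf, eq_of_heq hg]
  exact (interchange_hom _ _ _ _).symm

theorem id (h : x = hObj x₁ x₂) : IsColumns (𝟙 x) (𝟙 x₁) (𝟙 x₂) := by
  subst h; exact ⟨rfl, rfl, by rw [hHom_id]⟩

theorem eqToHom (e : x = y) (h : x = hObj x₁ x₂) : IsColumns (eqToHom e) (𝟙 x₁) (𝟙 x₂) := by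
  subst e; exact .id h

theorem whiskerRight {f : x ⟶ y} {f₁ : x₁ ⟶ y₁} {f₂ : x₂ ⟶ y₂} (hf : IsColumns f f₁ f₂)
    (h : z = hObj z₁ z₂) : IsColumns (f ▷ z) (f₁ ▷ z₁) (f₂ ▷ z₂) := by
  simpa only [tensorHom_id] using hf.tensor (.id h)

theorem whiskerLeft {f : x ⟶ y} {f₁ : x₁ ⟶ y₁} {f₂ : x₂ ⟶ y₂} (h : z = hObj z₁ z₂)
    (hf : IsColumns f f₁ f₂) : IsColumns (z ◁ f) (z₁ ◁ f₁) (z₂ ◁ f₂) := by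
  simpa only [id_tensorHom] using (IsColumns.id h).tensor hf

theorem inv {e : x ≅ y} {e₁ : x₁ ≅ y₁} {e₂ : x₂ ≅ y₂} (h : IsColumns e.hom e₁.hom e₂.hom) :
    IsColumns e.inv e₁.inv e₂.inv := by
  obtain ⟨rfl, rfl, h⟩ := h
  refine ⟨rfl, rfl, heq_of_eq ?_⟩
  rw [← cancel_epi e.hom, e.hom_inv_id, eq_of_heq h, ← hHom_comp, e₁.hom_inv_id, e₂.hom_inv_id,
    hHom_id]

theorem associator (hx : x = hObj x₁ x₂) (hy : y = hObj y₁ y₂) (hz : z = hObj z₁ z₂) :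
    IsColumns (α_ x y z).hom (α_ x₁ y₁ z₁).hom (α_ x₂ y₂ z₂).hom := by
  subst hx hy hz
  exact ⟨by simp only [interchange_obj], by simp only [interchange_obj],
    (hHom_associator _ _ _ _ _ _).symm⟩

theorem associator_inv (hx : x = hObj x₁ x₂) (hy : y = hObj y₁ y₂) (hz : z = hObj z₁ z₂) :
    IsColumns (α_ x y z).inv (α_ x₁ y₁ z₁).inv (α_ x₂ y₂ z₂).inv :=
  (IsColumns.associator hx hy hz).inv

theorem leftUnitor (hx : x = hObj x₁ x₂) :
    IsColumns (λ_ x).hom (λ_ x₁).hom (λ_ x₂).hom := by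
  subst hx
  exact ⟨by rw [interchange_obj, unit_hObj], rfl, (hHom_leftUnitor _ _).symm⟩

theorem rightUnitor (hx : x = hObj x₁ x₂) :
    IsColumns (ρ_ x).hom (ρ_ x₁).hom (ρ_ x₂).hom := by
  subst hx
  exact ⟨by rw [interchange_obj, unit_hObj], rfl, (hHom_rightUnitor _ _).symm⟩

theorem of_heq {f : x ⟶ y} {g : x' ⟶ y'} {f₁ : x₁ ⟶ y₁} {f₂ : x₂ ⟶ y₂}
    {g₁ : x₁' ⟶ y₁'} {g₂ : x₂' ⟶ y₂'} (hf : IsColumns f f₁ f₂)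
    (hx : x' = x) (hy : y' = y) (h : g ≍ f)
    (hx₁ : x₁' = x₁) (hy₁ : y₁' = y₁) (h₁ : g₁ ≍ f₁)
    (hx₂ : x₂' = x₂) (hy₂ : y₂' = y₂) (h₂ : g₂ ≍ f₂) : IsColumns g g₁ g₂ := by
  subst hx hy hx₁ hy₁ hx₂ hy₂; cases h; cases h₁; cases h₂; exact hf

theorem congr_left {f : x ⟶ y} {f₁ : x₁ ⟶ y₁} {f₂ : x₂ ⟶ y₂} {g₁ : x₁' ⟶ y₁'}
    (hf : IsColumns f f₁ f₂) (hx₁ : x₁' = x₁) (hy₁ : y₁' = y₁) (h₁ : g₁ ≍ f₁) :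
    IsColumns f g₁ f₂ :=
  hf.of_heq rfl rfl HEq.rfl hx₁ hy₁ h₁ rfl rfl HEq.rfl

theorem congr_right {f : x ⟶ y} {f₁ : x₁ ⟶ y₁} {f₂ : x₂ ⟶ y₂} {g₂ : x₂' ⟶ y₂'}
    (hf : IsColumns f f₁ f₂) (hx₂ : x₂' = x₂) (hy₂ : y₂' = y₂) (h₂ : g₂ ≍ f₂) :
    IsColumns f f₁ g₂ :=
  hf.of_heq rfl rfl HEq.rfl rfl rfl HEq.rfl hx₂ hy₂ h₂

/-- The given morphism in the left column. -/
theorem left (f : x ⟶ y) : IsColumns f f (𝟙 (𝟙_ C)) :=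
  ⟨(hObj_unit _).symm, (hObj_unit _).symm, (hHom_unit f).symm⟩

/-- The given morphism in the right column. -/
theorem right (f : x ⟶ y) : IsColumns f (𝟙 (𝟙_ C)) f :=
  ⟨(unit_hObj _).symm, (unit_hObj _).symm, (unit_hHom f).symm⟩

/-- The constraint `λ_ (𝟙_ C)` is an identity up to `𝟙_ C ⊗ 𝟙_ C = 𝟙_ C`, so it can replace the
identity column when a neighbouring morphism has `𝟙_ C ⊗ 𝟙_ C` there. -/
theorem right_leftUnitor (f : x ⟶ y) : IsColumns f (λ_ (𝟙_ C)).hom f :=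
  (right f).congr_left unit_tensor_unit rfl leftUnitor_unit

end IsColumns

theorem unit_inv_heq : (λ_ (𝟙_ C)).inv ≍ 𝟙 (𝟙_ C) := by
  -- `unit_tensor_unit` has no variable side, so the source is generalised to make `subst` possible.
  have h : ∀ {x : C} (e : x ≅ 𝟙_ C), x = 𝟙_ C → e.hom ≍ 𝟙 (𝟙_ C) → e.inv ≍ 𝟙 (𝟙_ C) := by
    intro x e hx h
    subst hx
    rw [← Category.id_comp e.inv, ← eq_of_heq h, e.hom_inv_id, eq_of_heq h]
  exact h _ unit_tensor_unit leftUnitor_unit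

/-! ### The braiding -/

section Braiding

theorem unit_columns (a : C) : a = hObj (𝟙_ C) a := (unit_hObj a).symm

theorem columns_unit (a : C) : a = hObj a (𝟙_ C) := (hObj_unit a).symm

theorem tensor_columns {a b a₁ a₂ b₁ b₂ : C} (ha : a = hObj a₁ a₂) (hb : b = hObj b₁ b₂) :
    a ⊗ b = hObj (a₁ ⊗ b₁) (a₂ ⊗ b₂) := by
  rw [ha, hb, interchange_obj]

/-- The casts contribute identity columns, which leaves unit constraints only. Equations between
pastings of braidings thereby become pairs of equations between coherence maps. -/
theorem standardBraiding_columns (a b : C) :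
    IsColumns (standardBraiding a b) ((λ_ b).hom ≫ (ρ_ b).inv) ((ρ_ a).hom ≫ (λ_ a).inv) := by
  have e₁ := tensor_columns (unit_columns a) (columns_unit b)
  have e₂ := tensor_columns (columns_unit b) (unit_columns a)
  have h := (IsColumns.eqToHom e₁ e₁).comp ((IsColumns.hHom (λ_ b).hom (ρ_ a).hom).comp
    ((IsColumns.hHom (ρ_ b).inv (λ_ a).inv).comp (IsColumns.eqToHom e₂.symm rfl)))
  rw [Category.id_comp, Category.id_comp, Category.comp_id, Category.comp_id] at h
  exact h

/-- The inverse of the standard braiding. -/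
def standardBraidingInv (a b : C) : b ⊗ a ⟶ a ⊗ b :=
  eqToHom (tensor_columns (columns_unit b) (unit_columns a)) ≫
    hHom (ρ_ b).hom (λ_ a).hom ≫ hHom (λ_ b).inv (ρ_ a).inv ≫
    eqToHom (tensor_columns (unit_columns a) (columns_unit b)).symm

theorem standardBraidingInv_columns (a b : C) :
    IsColumns (standardBraidingInv a b) ((ρ_ b).hom ≫ (λ_ b).inv)
      ((λ_ a).hom ≫ (ρ_ a).inv) := by
  have e₁ := tensor_columns (unit_columns a) (columns_unit b)
  have e₂ := tensor_columns (columns_unit b) (unit_columns a)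
  have h := (IsColumns.eqToHom e₂ e₂).comp ((IsColumns.hHom (ρ_ b).hom (λ_ a).hom).comp
    ((IsColumns.hHom (λ_ b).inv (ρ_ a).inv).comp (IsColumns.eqToHom e₁.symm rfl)))
  rw [Category.id_comp, Category.id_comp, Category.comp_id, Category.comp_id] at h
  exact h

/-- The standard braiding, as an isomorphism. -/
@[simps]
def standardBraidingIso (a b : C) : a ⊗ b ≅ b ⊗ a where
  hom := standardBraiding a b
  inv := standardBraidingInv a b
  hom_inv_id := ((standardBraiding_columns a b).comp (standardBraidingInv_columns a b)).unique (by
    simpa using IsColumns.id (tensor_columns (unit_columns a) (columns_unit b)))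
  inv_hom_id := ((standardBraidingInv_columns a b).comp (standardBraiding_columns a b)).unique (by
    simpa using IsColumns.id (tensor_columns (columns_unit b) (unit_columns a)))

/-- In the forward hexagon `b ⊗ c` splits as `(b ⊗ c) | (1 ⊗ 1)`, so the right column of the
braiding with `a` has to start at `a ⊗ (1 ⊗ 1)`. The inserted `λ_ (𝟙_ C)` is an identity up to
equality of objects. -/
theorem standardBraiding_columns_right (a b : C) :
    IsColumns (standardBraiding a b) ((λ_ b).hom ≫ (ρ_ b).inv)
      (a ◁ (λ_ (𝟙_ C)).hom ≫ (ρ_ a).hom ≫ (λ_ a).inv ≫ (λ_ (𝟙_ C)).inv ▷ a) := by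
  refine (standardBraiding_columns a b).congr_right ?_ ?_ ?_
  · rw [unit_tensor_unit]
  · rw [unit_tensor_unit]
  · have h₁ : a ◁ (λ_ (𝟙_ C)).hom ≍ a ◁ 𝟙 (𝟙_ C) := by
      rw [← id_tensorHom, ← id_tensorHom]
      exact tensorHom_heq rfl rfl unit_tensor_unit rfl HEq.rfl leftUnitor_unit
    have h₂ : (λ_ (𝟙_ C)).inv ▷ a ≍ 𝟙 (𝟙_ C) ▷ a := by
      rw [← tensorHom_id, ← tensorHom_id]
      exact tensorHom_heq rfl unit_tensor_unit rfl rfl unit_inv_heq HEq.rfl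
    refine (comp_heq_comp (by rw [unit_tensor_unit]) rfl (by rw [unit_tensor_unit]) h₁
      (comp_heq_comp rfl rfl (by rw [unit_tensor_unit]) HEq.rfl
      (comp_heq_comp rfl rfl (by rw [unit_tensor_unit]) HEq.rfl h₂))).trans ?_
    simp

/-- The mirror image, for the reverse hexagon, where `a ⊗ b` splits as `(1 ⊗ 1) | (a ⊗ b)`. -/
theorem standardBraiding_columns_left (a b : C) :
    IsColumns (standardBraiding a b)
      ((λ_ (𝟙_ C)).hom ▷ b ≫ (λ_ b).hom ≫ (ρ_ b).inv ≫ b ◁ (λ_ (𝟙_ C)).inv)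
      ((ρ_ a).hom ≫ (λ_ a).inv) := by
  refine (standardBraiding_columns a b).congr_left ?_ ?_ ?_
  · rw [unit_tensor_unit]
  · rw [unit_tensor_unit]
  · have h₁ : (λ_ (𝟙_ C)).hom ▷ b ≍ 𝟙 (𝟙_ C) ▷ b := by
      rw [← tensorHom_id, ← tensorHom_id]
      exact tensorHom_heq unit_tensor_unit rfl rfl rfl leftUnitor_unit HEq.rfl
    have h₂ : b ◁ (λ_ (𝟙_ C)).inv ≍ b ◁ 𝟙 (𝟙_ C) := by
      rw [← id_tensorHom, ← id_tensorHom]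
      exact tensorHom_heq rfl rfl rfl unit_tensor_unit HEq.rfl unit_inv_heq
    refine (comp_heq_comp (by rw [unit_tensor_unit]) rfl (by rw [unit_tensor_unit]) h₁
      (comp_heq_comp rfl rfl (by rw [unit_tensor_unit]) HEq.rfl
      (comp_heq_comp rfl rfl (by rw [unit_tensor_unit]) HEq.rfl h₂))).trans ?_
    simp

/-- The vertical monoidal structure is braided by the standard braiding. -/
instance standardBraided : BraidedCategory C where
  braiding := standardBraidingIso
  braiding_naturality_right a b b' f := by
    -- With `f` in the left column and `a` in the right, only naturality of the unitors is at stake.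
    have h₁ := ((IsColumns.left f).whiskerLeft (unit_columns a)).comp (standardBraiding_columns a b')
    have h₂ := (standardBraiding_columns a b).comp ((IsColumns.left f).whiskerRight (unit_columns a))
    refine h₁.unique ?_
    simpa using h₂
  braiding_naturality_left {a a'} f b := by
    have h₁ := ((IsColumns.right f).whiskerRight (columns_unit b)).comp (standardBraiding_columns a' b)
    have h₂ := (standardBraiding_columns a b).comp ((IsColumns.right f).whiskerLeft (columns_unit b))
    refine h₁.unique ?_
    simpa using h₂
  hexagon_forward a b c := by
    -- The object `a` moves past `b` and `c`; it takes the right column and they take the left one.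
    have ha := unit_columns a
    have hb := columns_unit b
    have hc := columns_unit c
    have h₁ := (IsColumns.associator ha hb hc).comp
      ((standardBraiding_columns_right a (b ⊗ c)).comp (IsColumns.associator hb hc ha))
    have h₂ := ((standardBraiding_columns a b).whiskerRight hc).comp
      ((IsColumns.associator hb ha hc).comp ((standardBraiding_columns a c).whiskerLeft hb))
    refine h₁.unique ?_
    -- Each column now contains constraints only, so monoidal coherence closes both goals.
    convert h₂ using 1 <;> monoidal
  hexagon_reverse a b c := by
    have ha := unit_columns a
    have hb := unit_columns b
    have hc := columns_unit c
    have h₁ := (IsColumns.associator_inv ha hb hc).comp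
      ((standardBraiding_columns_left (a ⊗ b) c).comp (IsColumns.associator_inv hc ha hb))
    have h₂ := ((standardBraiding_columns b c).whiskerLeft ha).comp
      ((IsColumns.associator_inv ha hc hb).comp ((standardBraiding_columns a c).whiskerRight hb))
    refine h₁.unique ?_
    convert h₂ using 1 <;> monoidal

end Braiding

end Columns
end DDB

/-! ### Comparison of the vertical and horizontal products -/

namespace DDB

open MonoidalCategory HorizontalStructure

section Comparison

variable {C : Type u} [Category.{v} C] [MonoidalCategory C] [HorizontalStructure C]

theorem tensor_eq_hObj_tensor_unit (a b : C) : a ⊗ b = hObj (a ⊗ 𝟙_ C) (𝟙_ C ⊗ b) :=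
  tensor_columns (columns_unit a) (unit_columns b)

/-- The comparison `a ⊗ b = (a | 1) ⊗ (1 | b) = (a ⊗ 1) | (1 ⊗ b) ≅ a | b`. -/
def tensorIsoHObj (a b : C) : a ⊗ b ≅ hObj a b where
  hom := eqToHom (tensor_eq_hObj_tensor_unit a b) ≫ hHom (ρ_ a).hom (λ_ b).hom
  inv := hHom (ρ_ a).inv (λ_ b).inv ≫ eqToHom (tensor_eq_hObj_tensor_unit a b).symm
  hom_inv_id := by
    simp only [Category.assoc]
    rw [← Category.assoc (hHom _ _), ← hHom_comp, Iso.hom_inv_id, Iso.hom_inv_id, hHom_id]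
    simp
  inv_hom_id := by
    simp only [Category.assoc, eqToHom_trans_assoc, eqToHom_refl, Category.id_comp]
    rw [← hHom_comp, Iso.inv_hom_id, Iso.inv_hom_id, hHom_id]

theorem tensorIsoHObj_columns (a b : C) :
    IsColumns (tensorIsoHObj a b).hom (ρ_ a).hom (λ_ b).hom := by
  have h := (IsColumns.eqToHom (tensor_eq_hObj_tensor_unit a b)
    (tensor_eq_hObj_tensor_unit a b)).comp (.hHom (ρ_ a).hom (λ_ b).hom)
  rw [Category.id_comp, Category.id_comp] at h
  exact h

theorem tensorIsoHObj_naturality {a a' b b' : C} (f : a ⟶ a') (g : b ⟶ b') :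
    (f ⊗ₘ g) ≫ (tensorIsoHObj a' b').hom = (tensorIsoHObj a b).hom ≫ hHom f g := by
  have h₁ := ((IsColumns.left f).tensor (IsColumns.right g)).comp (tensorIsoHObj_columns a' b')
  have h₂ := (tensorIsoHObj_columns a b).comp (.hHom f g)
  refine h₁.unique ?_
  simpa using h₂

theorem tensorIsoHObj_naturality_assoc {a a' b b' z : C} (f : a ⟶ a') (g : b ⟶ b')
    (h : hObj a' b' ⟶ z) :
    (f ⊗ₘ g) ≫ (tensorIsoHObj a' b').hom ≫ h = (tensorIsoHObj a b).hom ≫ hHom f g ≫ h := by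
  rw [← Category.assoc, tensorIsoHObj_naturality, Category.assoc]

/-- The right column `λ_ (𝟙_ C)` counts as an identity, and a morphism next to an identity column of
the unit is that morphism. -/
theorem tensorIsoHObj_unit (a : C) : (tensorIsoHObj a (𝟙_ C)).hom ≍ (ρ_ a).hom := by
  have h := (tensorIsoHObj_columns a (𝟙_ C)).congr_right (g₂ := 𝟙 (𝟙_ C)) unit_tensor_unit.symm rfl
    leftUnitor_unit.symm
  exact h.heq.trans (IsColumns.left (ρ_ a).hom).heq.symm

theorem tensorIsoHObj_unit_left (a : C) : (tensorIsoHObj (𝟙_ C) a).hom ≍ (λ_ a).hom := by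
  have h := (tensorIsoHObj_columns (𝟙_ C) a).congr_left (g₁ := 𝟙 (𝟙_ C)) unit_tensor_unit.symm rfl
    rightUnitor_unit.symm
  exact h.heq.trans (IsColumns.right (λ_ a).hom).heq.symm

theorem unit_comp_whisker_heq (a : C) :
    (λ_ (𝟙_ C)).hom ▷ a ≫ (λ_ a).hom ≍ (λ_ a).hom := by
  refine (comp_heq_comp (by rw [unit_tensor_unit]) rfl rfl (g' := (λ_ a).hom)
    (f' := 𝟙 (𝟙_ C) ▷ a) ?_ HEq.rfl).trans ?_
  · rw [← tensorHom_id, ← tensorHom_id]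
    exact tensorHom_heq unit_tensor_unit rfl rfl rfl leftUnitor_unit HEq.rfl
  · simp

theorem whisker_unit_comp_heq (a : C) :
    a ◁ (λ_ (𝟙_ C)).hom ≫ (ρ_ a).hom ≍ (ρ_ a).hom := by
  refine (comp_heq_comp (by rw [unit_tensor_unit]) rfl rfl (g' := (ρ_ a).hom)
    (f' := a ◁ 𝟙 (𝟙_ C)) ?_ HEq.rfl).trans ?_
  · rw [← id_tensorHom, ← id_tensorHom]
    exact tensorHom_heq rfl rfl unit_tensor_unit rfl HEq.rfl leftUnitor_unit
  · simp

/-- The columns are padded by `λ_ (𝟙_ C)` to be composable with those of `tensorμ`, which end in `(a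
⊗ c) ⊗ (1 ⊗ 1)` and `(1 ⊗ 1) ⊗ (b ⊗ d)`. -/
theorem tensorIsoHObj_columns' (a b : C) :
    IsColumns (tensorIsoHObj a b).hom (a ◁ (λ_ (𝟙_ C)).hom ≫ (ρ_ a).hom)
      ((λ_ (𝟙_ C)).hom ▷ b ≫ (λ_ b).hom) :=
  ((tensorIsoHObj_columns a b).congr_left (by rw [unit_tensor_unit]) rfl
    (whisker_unit_comp_heq a)).congr_right (by rw [unit_tensor_unit]) rfl (unit_comp_whisker_heq b)

/-- Both sides have the same three columns, bracketed differently; `hHom_assoc` identifies the two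
bracketings. -/
theorem tensorIsoHObj_assoc (a b c : C) :
    (tensorIsoHObj a b).hom ▷ c ≫ (tensorIsoHObj (hObj a b) c).hom ≫ eqToHom (hObj_assoc a b c) =
      (α_ a b c).hom ≫ a ◁ (tensorIsoHObj b c).hom ≫ (tensorIsoHObj a (hObj b c)).hom := by
  -- First `c` is split off to the right; then the left column is itself split into columns for `a`
  -- and `b`.
  have h₁ : IsColumns ((tensorIsoHObj a b).hom ▷ c ≫ (tensorIsoHObj (hObj a b) c).hom)
      (hHom ((ρ_ a).hom ▷ 𝟙_ C ≫ (ρ_ a).hom) ((λ_ b).hom ▷ 𝟙_ C ≫ (ρ_ b).hom)) (λ_ c).hom := by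
    have h := ((IsColumns.left (tensorIsoHObj a b).hom).whiskerRight (unit_columns c)).comp
      (tensorIsoHObj_columns (hObj a b) c)
    have h' := ((tensorIsoHObj_columns a b).whiskerRight (columns_unit (𝟙_ C))).comp
      (IsColumns.rightUnitor (x := hObj a b) rfl)
    simp only [id_whiskerRight, Category.id_comp] at h
    exact h.congr_left (by rw [h'.source]) (by rw [h'.target]) h'.heq.symm
  -- Here `a` is split off to the left, and the right column is split after naturality of the left
  -- unitor has brought it into the form `h'`.
  have h₂ : IsColumns ((α_ a b c).hom ≫ a ◁ (tensorIsoHObj b c).hom ≫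
      (tensorIsoHObj a (hObj b c)).hom)
      ((ρ_ a).hom ▷ 𝟙_ C ≫ (ρ_ a).hom) (hHom ((λ_ b).hom ▷ 𝟙_ C ≫ (ρ_ b).hom) (λ_ c).hom) := by
    have h := (IsColumns.associator (columns_unit a) (unit_columns b) (unit_columns c)).comp
      (((IsColumns.right_leftUnitor (tensorIsoHObj b c).hom).whiskerLeft (columns_unit a)).comp
      (tensorIsoHObj_columns a (hObj b c)))
    have h' := ((IsColumns.leftUnitor (columns_unit b)).whiskerRight (unit_columns c)).comp
      (tensorIsoHObj_columns b c)
    have h'' := h'.congr_right (by rw [unit_tensor_unit]) rfl (unit_comp_whisker_heq c).symm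
    refine h.of_heq rfl rfl HEq.rfl rfl rfl (heq_of_eq (by monoidal)) ?_ ?_ ?_
    · exact h''.source.symm
    · rfl
    · refine h''.heq.symm.trans (heq_of_eq ?_)
      rw [leftUnitor_naturality]
      simp
  rw [← Category.assoc]
  refine eq_of_heq ((comp_eqToHom_heq _ _).trans (h₁.heq.trans ((hHom_assoc _ _ _).trans h₂.heq.symm)))

/-- The braiding inside `tensorμ` exchanges `1 | b` with `c | 1`, so it too is made of unit
constraints, and both columns agree by coherence. Through this lemma a braided functor is seen to
respect strict interchange. -/
theorem tensorIsoHObj_interchange (a b c d : C) :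
    tensorμ a b c d ≫ (tensorIsoHObj (a ⊗ c) (b ⊗ d)).hom ≫ eqToHom (interchange_obj a b c d) =
      (tensorIsoHObj a b).hom ⊗ₘ (tensorIsoHObj c d).hom := by
  have ha := columns_unit a
  have hb := unit_columns b
  have hc := columns_unit c
  have hd := unit_columns d
  have hβ : IsColumns (β_ b c).hom ((λ_ c).hom ≫ (ρ_ c).inv) ((ρ_ b).hom ≫ (λ_ b).inv) :=
    standardBraiding_columns b c
  have hμ : IsColumns (tensorμ a b c d) _ _ := (IsColumns.associator ha hb (tensor_columns hc hd)).comp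
    (((IsColumns.associator_inv hb hc hd).whiskerLeft ha).comp
    (((hβ.whiskerRight hd).whiskerLeft ha).comp
    (((IsColumns.associator hc hb hd).whiskerLeft ha).comp
    (IsColumns.associator_inv ha hc (tensor_columns hb hd)))))
  have h := hμ.comp ((tensorIsoHObj_columns' (a ⊗ c) (b ⊗ d)).comp
    (IsColumns.eqToHom (interchange_obj a b c d) rfl))
  refine h.unique ?_
  convert (tensorIsoHObj_columns a b).tensor (tensorIsoHObj_columns c d) using 1 <;> monoidal

end Comparison
end DDB

/-! ### The constraints of a weak map -/

namespace DDB

open MonoidalCategory HorizontalStructure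

theorem heq_id_of_comp_heq_id {D : Type u} [Category.{v} D] {x y z c : D} {f : x ⟶ y} {t : y ⟶ z}
    (hx : x = c) (hy : y = c) (hz : z = c) (hf : f ≍ 𝟙 c) (h : f ≫ t ≍ 𝟙 c) : t ≍ 𝟙 c := by
  subst hx hy hz
  have hf := eq_of_heq hf
  subst hf
  rwa [Category.id_comp] at h

section

variable {C : Type u} [Category.{v} C] [MonoidalCategory C] [HorizontalStructure C]

theorem hHom_hHom_id_heq {a a' b b' : C} (f : a ⟶ a') (g : b ⟶ b') :
    hHom f (hHom g (𝟙 (𝟙_ C))) ≍ hHom f g :=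
  hHom_heq rfl rfl (hObj_unit _) (hObj_unit _) HEq.rfl (hHom_unit _)

theorem hObj_hObj_unit (a b : C) : hObj a (hObj b (𝟙_ C)) = hObj a b := by rw [hObj_unit]

theorem antidiagonal_eq (a b : C) : hObj (𝟙_ C ⊗ b) (hObj (a ⊗ 𝟙_ C) (𝟙_ C)) = a ⊗ b :=
  (hObj_hObj_unit _ _).trans (tensor_columns (unit_columns a) (columns_unit b)).symm

theorem diagonal_eq (a b : C) : hObj (a ⊗ 𝟙_ C) (hObj (𝟙_ C ⊗ b) (𝟙_ C)) = a ⊗ b :=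
  (hObj_hObj_unit _ _).trans (tensor_eq_hObj_tensor_unit a b).symm

end

theorem paste_squares {D : Type u} [Category.{v} D] {x y z x' y' z' : D} {f : x ⟶ y} {g : y ⟶ z}
    {f' : x' ⟶ y'} {g' : y' ⟶ z'} {a : x ⟶ x'} {b : y ⟶ y'} {c : z ⟶ z'} (h : a ≫ f' = f ≫ b)
    (h' : b ≫ g' = g ≫ c) : a ≫ f' ≫ g' = (f ≫ g) ≫ c := by
  rw [← Category.assoc, h, Category.assoc, h', Category.assoc]

theorem heq_of_comp_heq_comp {D : Type u} [Category.{v} D] {x y z x' y' z' : D} {f : x ⟶ y}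
    {f' : x' ⟶ y'} {t : y ⟶ z} {t' : y' ⟶ z'} [IsIso f'] (hy : y = y') (hz : z = z') (hx : x = x')
    (hf : f ≍ f') (h : f ≫ t ≍ f' ≫ t') : t ≍ t' := by
  subst hx hy hz
  obtain rfl := eq_of_heq hf
  exact heq_of_eq ((cancel_epi f).1 (eq_of_heq h))

namespace WeakMap

variable {C : Type u} [Category.{v} C] [MonoidalCategory C] [HorizontalStructure C]
variable {D : Type u'} [Category.{v'} D] [MonoidalCategory D] [HorizontalStructure D]
variable (F : WeakMap C D)

/-- Heterogeneous equality absorbs the casts of the multiplication axiom. The flattening and the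
rows are separate arguments, so that a concrete nested grid can be supplied with both in reduced
form. -/
theorem constraint_of_mult (N : Nested C) {g : Grid C} {R : Grid (Grid C)} (hg : N.flatten = g)
    (hR : N.rows = R) : (F.constraint g).hom ≍ Grid.evalMap (fun g => (F.constraint g).hom) R ≫
      (F.at_ (fun g => g.eval (𝟭 C).obj) R).hom := by
  subst hg hR
  rw [F.mult]
  exact eqToHom_comp_heq_comp' _ _ _ _

theorem hHom_id_heq {a b : D} (f : a ⟶ b) : hHom f (𝟙 (𝟙_ D)) ≍ f := hHom_unit f

/-- The constraint of a weak map at a word. -/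
def wordConstraint (p : Word C) : p.eval F.functor.obj ⟶ F.functor.obj (p.eval (𝟭 C).obj) :=
  eqToHom (hObj_unit _).symm ≫ (F.constraint [p]).hom ≫ eqToHom (congrArg F.functor.obj (hObj_unit _))

theorem wordConstraint_heq (p : Word C) : F.wordConstraint p ≍ (F.constraint [p]).hom :=
  eqToHom_comp_heq_comp _ _ _

theorem constraint_of (c : C) : (F.constraint [.of c]).hom ≍ 𝟙 (F.functor.obj c) := by
  rw [F.unit c]
  refine (eqToHom_heq_id_cod _ _ _).trans ?_
  rw [show Grid.eval (𝟭 C).obj [Word.of c] = c from hObj_unit c]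

theorem wordConstraint_of (c : C) : F.wordConstraint (.of c) = 𝟙 (F.functor.obj c) :=
  eq_of_heq ((F.wordConstraint_heq _).trans (F.constraint_of c))

theorem wordConstraint_unit : F.wordConstraint .unit = F.unitConstraint := by
  apply eq_of_heq
  refine (F.wordConstraint_heq _).trans ?_
  -- The empty vertical composite of grids of length zero flattens to the empty grid, while its rows
  -- form the grid `[unit]`. It has no inner grids, so only the outer component remains.
  have h := F.constraint_of_mult [⟨0, .unit⟩] (g := []) (R := [.unit]) rfl rfl
  refine HEq.trans ?_ h.symm
  have h₁ : Grid.evalMap (fun g => (F.constraint g).hom) [.unit] = 𝟙 _ := hHom_id _ _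
  rw [h₁]
  refine HEq.trans ?_ (heq_of_eq (Category.id_comp _).symm)
  exact (F.at_heq (fun g : Grid C => g.eval (𝟭 C).obj) [.unit]).symm

theorem verticalConstraint_congr {a a' b b' : C} (ha : a = a') (hb : b = b') :
    F.verticalConstraint a b ≍ F.verticalConstraint a' b' := by
  subst ha hb; rfl

theorem constraint_tensor_of (a b : C) :
    (F.constraint [.tensor (.of a) (.of b)]).hom ≍ F.verticalConstraint a b :=
  (F.wordConstraint_heq _).symm

theorem wordConstraint_tensor (p q : Word C) : F.wordConstraint (.tensor p q) =
    (F.wordConstraint p ⊗ₘ F.wordConstraint q) ≫ F.verticalConstraint _ _ := by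
  apply eq_of_heq
  refine (F.wordConstraint_heq _).trans ?_
  -- One block, with the one-column grid `[p]` above the one-column grid `[q]`.
  refine (F.constraint_of_mult [⟨1, .tensor (.of fun _ => p) (.of fun _ => q)⟩]
    (R := [.tensor (.of [p]) (.of [q])]) (by simp [Nested.flatten, Word.bind])
    (by simp [Nested.rows, Word.map])).trans ?_
  have ep : ∀ p : Word C, Grid.eval F.functor.obj [p] = p.eval F.functor.obj := fun p => hObj_unit _
  have ep' : ∀ p : Word C, Grid.eval (𝟭 C).obj [p] = p.eval (𝟭 C).obj := fun p => hObj_unit _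
  refine comp_heq_comp ?_ ?_ ?_ ((hHom_id_heq _).trans (tensorHom_heq (ep p) (congrArg _ (ep' p))
    (ep q) (congrArg _ (ep' q)) (F.wordConstraint_heq p).symm (F.wordConstraint_heq q).symm))
    ((F.at_heq _ _).trans ((F.constraint_tensor_of _ _).trans
    (F.verticalConstraint_congr (ep' p) (ep' q))))
  · change hObj (Grid.eval F.functor.obj [p] ⊗ Grid.eval F.functor.obj [q]) _ = _
    rw [ep, ep]; exact hObj_unit _
  · change hObj (F.functor.obj (Grid.eval (𝟭 C).obj [p]) ⊗
      F.functor.obj (Grid.eval (𝟭 C).obj [q])) _ = _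
    rw [ep', ep']; exact hObj_unit _
  · change F.functor.obj (hObj (Grid.eval (𝟭 C).obj [p] ⊗ Grid.eval (𝟭 C).obj [q]) _) = _
    rw [ep', ep']; exact congrArg _ (hObj_unit _)

theorem wordConstraint_naturality {p q : Word C} (φ : Word.Hom p q) :
    φ.eval F.functor ≫ F.wordConstraint q = F.wordConstraint p ≫ F.functor.map (φ.eval (𝟭 C)) := by
  have h := heq_of_eq (F.naturality (.cons φ .nil))
  have e := fun p : Word C => hObj_unit (p.eval F.functor.obj)
  have e' := fun p : Word C => congrArg F.functor.obj (hObj_unit (p.eval (𝟭 C).obj))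
  apply eq_of_heq
  refine (comp_heq_comp (e _) (e _) (e' _) ?_ (F.wordConstraint_heq q).symm).symm.trans (h.trans
    (comp_heq_comp (e _) (e' _) (e' _) (F.wordConstraint_heq p).symm
      (map_heq _ (hObj_unit _) (hObj_unit _) ?_)))
  · exact hHom_unit _
  · exact hHom_unit _

theorem verticalConstraint_naturality {a a' b b' : C} (f : a ⟶ a') (g : b ⟶ b') :
    (F.functor.map f ⊗ₘ F.functor.map g) ≫ F.verticalConstraint a' b' =
      F.verticalConstraint a b ≫ F.functor.map (f ⊗ₘ g) :=
  F.wordConstraint_naturality (.tensor (.of f) (.of g))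

/-- The monoidal axioms are naturality of `τ` at the formal constraints of the free monoidal
category; the unit axioms below arise in the same way. -/
theorem verticalConstraint_assoc (a b c : C) :
    F.verticalConstraint a b ▷ F.functor.obj c ≫ F.verticalConstraint (a ⊗ b) c ≫
      F.functor.map (α_ a b c).hom =
    (α_ (F.functor.obj a) (F.functor.obj b) (F.functor.obj c)).hom ≫
      F.functor.obj a ◁ F.verticalConstraint b c ≫ F.verticalConstraint a (b ⊗ c) := by
  have h := F.wordConstraint_naturality (.associator (.of a) (.of b) (.of c))
  simp only [wordConstraint_tensor, wordConstraint_of] at h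
  have h' : (α_ (F.functor.obj a) (F.functor.obj b) (F.functor.obj c)).hom ≫
      (𝟙 _ ⊗ₘ (𝟙 _ ⊗ₘ 𝟙 _) ≫ F.verticalConstraint b c) ≫ F.verticalConstraint a (b ⊗ c) =
    (((𝟙 _ ⊗ₘ 𝟙 _) ≫ F.verticalConstraint a b ⊗ₘ 𝟙 _) ≫ F.verticalConstraint (a ⊗ b) c) ≫
      F.functor.map (α_ a b c).hom := h
  simpa using h'.symm

theorem verticalConstraint_unit_left (a : C) :
    (λ_ (F.functor.obj a)).hom = F.unitConstraint ▷ F.functor.obj a ≫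
      F.verticalConstraint (𝟙_ C) a ≫ F.functor.map (λ_ a).hom := by
  have h := F.wordConstraint_naturality (.leftUnitor (.of a))
  simp only [wordConstraint_tensor, wordConstraint_of, wordConstraint_unit] at h
  have h' : (λ_ (F.functor.obj a)).hom ≫ 𝟙 _ =
    ((F.unitConstraint ⊗ₘ 𝟙 _) ≫ F.verticalConstraint (𝟙_ C) a) ≫ F.functor.map (λ_ a).hom := h
  simpa using h'

theorem verticalConstraint_unit_right (a : C) :
    (ρ_ (F.functor.obj a)).hom = F.functor.obj a ◁ F.unitConstraint ≫
      F.verticalConstraint a (𝟙_ C) ≫ F.functor.map (ρ_ a).hom := by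
  have h := F.wordConstraint_naturality (.rightUnitor (.of a))
  simp only [wordConstraint_tensor, wordConstraint_of, wordConstraint_unit] at h
  have h' : (ρ_ (F.functor.obj a)).hom ≫ 𝟙 _ =
    ((𝟙 _ ⊗ₘ F.unitConstraint) ≫ F.verticalConstraint a (𝟙_ C)) ≫ F.functor.map (ρ_ a).hom := h
  simpa using h'

instance : IsIso F.unitConstraint := inferInstanceAs (IsIso (F.constraint []).hom)

instance (a b : C) : IsIso (F.verticalConstraint a b) := by
  have : ∀ {x y z w : D} (e : x = y) (f : y ⟶ z) [IsIso f] (e' : z = w),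
      IsIso (eqToHom e ≫ f ≫ eqToHom e') := by
    intros; infer_instance
  unfold verticalConstraint
  exact @this _ _ _ _ _ _ (F.constraint [.tensor (.of a) (.of b)]).isIso_hom _

/-! #### Grids with two columns -/

theorem constraint_of_unit (a : C) :
    (F.constraint [.of a, .unit]).hom ≍ 𝟙 (F.functor.obj a) := by
  -- The second block has length zero: it contributes no column to the flattening but a column
  -- `unit` to the rows. Hence an additional unit column leaves the constraint an identity.
  have h := F.constraint_of_mult [⟨1, .of fun _ => .of a⟩, ⟨0, .unit⟩] (g := [.of a])
    (R := [.of [.of a], .unit]) (by simp [Nested.flatten, Word.bind])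
    (by simp [Nested.rows, Word.map])
  have e : hObj a (𝟙_ C) = a := hObj_unit a
  have h₁ := heq_id_of_comp_heq_id ?_ ?_ ?_ ?_ (h.symm.trans (F.constraint_of a))
  · refine ((F.at_heq _ _).trans (F.constraint_heq ?_)).symm.trans h₁
    change [Word.of (hObj a (𝟙_ C)), Word.unit] = _
    rw [e]
  · simp [Grid.eval, Word.eval, hObj_unit]
  · simp [Grid.eval, Word.eval, hObj_unit]
  · simp [Grid.eval, Word.eval, hObj_unit]
  · refine (hHom_heq rfl rfl (hObj_unit _) (hObj_unit _) HEq.rfl (hHom_unit _)).trans ?_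
    exact (hHom_unit _).trans (F.constraint_of a)

theorem constraint_unit_of (a : C) :
    (F.constraint [.unit, .of a]).hom ≍ 𝟙 (F.functor.obj a) := by
  have h := F.constraint_of_mult [⟨0, .unit⟩, ⟨1, .of fun _ => .of a⟩] (g := [.of a])
    (R := [.unit, .of [.of a]]) (by simp [Nested.flatten, Word.bind])
    (by simp [Nested.rows, Word.map])
  have e : hObj a (𝟙_ C) = a := hObj_unit a
  have h₁ := heq_id_of_comp_heq_id ?_ ?_ ?_ ?_ (h.symm.trans (F.constraint_of a))
  · refine ((F.at_heq _ _).trans (F.constraint_heq ?_)).symm.trans h₁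
    change [Word.unit, Word.of (hObj a (𝟙_ C))] = _
    rw [e]
  · simp [Grid.eval, Word.eval, hObj_unit, unit_hObj]
  · simp [Grid.eval, Word.eval, hObj_unit, unit_hObj]
  · simp [Grid.eval, Word.eval, hObj_unit, unit_hObj]
  · refine (unit_hHom _).trans ((hHom_unit _).trans (F.constraint_of a))

/-- The constraint at a grid with two columns and two rows. -/
theorem constraint_two_rows (p q p' q' : Word C) {a a' : C}
    (ha : Grid.eval (𝟭 C).obj [p, q] = a) (ha' : Grid.eval (𝟭 C).obj [p', q'] = a')
    (h : (F.constraint [p, q]).hom ≍ 𝟙 (F.functor.obj a))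
    (h' : (F.constraint [p', q']).hom ≍ 𝟙 (F.functor.obj a'))
    (e : Grid.eval F.functor.obj [p, q] = F.functor.obj a)
    (e' : Grid.eval F.functor.obj [p', q'] = F.functor.obj a') :
    (F.constraint [.tensor p p', .tensor q q']).hom ≍ F.verticalConstraint a a' := by
  subst ha ha'
  -- One block of two rows of length two. Both row constraints are identities by hypothesis, which
  -- leaves the outer constraint at a one-column grid.
  refine (F.constraint_of_mult [⟨2, .tensor (.of ![p, q]) (.of ![p', q'])⟩]
    (R := [.tensor (.of [p, q]) (.of [p', q'])]) (by simp [Nested.flatten, Word.bind])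
    (by simp [Nested.rows, Word.map])).trans ?_
  refine (comp_heq_comp (f' := 𝟙 (F.functor.obj _ ⊗ F.functor.obj _))
    (g' := F.verticalConstraint _ _) ?_ (hObj_unit _) ?_ ?_ ?_).trans (heq_of_eq (Category.id_comp _))
  · change hObj (Grid.eval F.functor.obj [p, q] ⊗ Grid.eval F.functor.obj [p', q']) _ = _
    rw [e, e']; exact hObj_unit _
  · exact congrArg F.functor.obj (hObj_unit _)
  · refine (hHom_unit _).trans ((tensorHom_heq e rfl e' rfl h h').trans ?_)
    rw [id_tensorHom_id]
  · exact (F.at_heq _ _).trans (F.constraint_tensor_of _ _)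

/-- Read by rows, this grid is `a | 1` above `1 | b`. -/
theorem constraint_diagonal (a b : C) :
    (F.constraint [.tensor (.of a) .unit, .tensor .unit (.of b)]).hom ≍
      F.verticalConstraint a b := by
  refine F.constraint_two_rows _ _ _ _ ?_ ?_ (F.constraint_of_unit a) (F.constraint_unit_of b) ?_ ?_
  all_goals simp [Grid.eval, Word.eval, hObj_unit, unit_hObj]

/-- Read by rows, this grid is `1 | a` above `b | 1`. -/
theorem constraint_antidiagonal (a b : C) :
    (F.constraint [.tensor .unit (.of b), .tensor (.of a) .unit]).hom ≍
      F.verticalConstraint a b := by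
  refine F.constraint_two_rows _ _ _ _ ?_ ?_ (F.constraint_unit_of a) (F.constraint_of_unit b) ?_ ?_
  all_goals simp [Grid.eval, Word.eval, hObj_unit, unit_hObj]

/-- The unit constraints in the standard braiding form a morphism from the antidiagonal grid of `a,
b` to the diagonal grid of `b, a`. At both grids `τ` is a vertical constraint, so naturality at this
morphism is braidedness. -/
theorem verticalConstraint_braiding (a b : C) :
    F.verticalConstraint a b ≫ F.functor.map (β_ a b).hom =
      (β_ (F.functor.obj a) (F.functor.obj b)).hom ≫ F.verticalConstraint b a := by
  have h := F.naturality (.cons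
    (.comp (.leftUnitor (.of b)) (.rightUnitorInv (.of b))) (.cons
    (.comp (.rightUnitor (.of a)) (.leftUnitorInv (.of a))) .nil))
  apply eq_of_heq
  refine (comp_heq_comp ?_ ?_ ?_ (F.constraint_antidiagonal a b).symm ?_).trans
    ((heq_of_eq h).symm.trans (comp_heq_comp ?_ ?_ ?_ ?_ (F.constraint_diagonal b a)))
  · exact (antidiagonal_eq _ _).symm
  · exact congrArg F.functor.obj (antidiagonal_eq _ _).symm
  · exact congrArg F.functor.obj (diagonal_eq _ _).symm
  · exact map_heq _ (antidiagonal_eq _ _).symm (diagonal_eq _ _).symm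
      ((standardBraiding_columns a b).heq.trans (hHom_hHom_id_heq _ _).symm)
  · exact antidiagonal_eq _ _
  · exact diagonal_eq _ _
  · exact congrArg F.functor.obj (diagonal_eq _ _)
  · exact (hHom_hHom_id_heq _ _).trans (standardBraiding_columns _ _).heq.symm

/-- The horizontal constraint of a weak map. -/
def horizontalConstraint (a b : C) :
    hObj (F.functor.obj a) (F.functor.obj b) ⟶ F.functor.obj (hObj a b) :=
  (tensorIsoHObj _ _).inv ≫ F.verticalConstraint a b ≫ F.functor.map (tensorIsoHObj a b).hom

/-- Naturality at the unitors from the diagonal grid to `[a, b]` reduces this component to the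
diagonal one, hence to the vertical constraint. -/
theorem constraint_of_of (a b : C) :
    (F.constraint [.of a, .of b]).hom ≍ F.horizontalConstraint a b := by
  have h := F.naturality (.cons (.rightUnitor (.of a)) (.cons (.leftUnitor (.of b)) .nil))
  have h₁ : (tensorIsoHObj (F.functor.obj a) (F.functor.obj b)).hom ≫ F.horizontalConstraint a b =
    F.verticalConstraint a b ≫ F.functor.map (tensorIsoHObj a b).hom :=
    (Iso.eq_inv_comp _).1 rfl
  refine heq_of_comp_heq_comp (hObj_hObj_unit _ _) (congrArg F.functor.obj (hObj_hObj_unit _ _))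
    (diagonal_eq (F.functor.obj a) (F.functor.obj b)) ?_
    ((heq_of_eq h).trans (HEq.trans ?_ (heq_of_eq h₁.symm)))
  · exact (hHom_hHom_id_heq _ _).trans (tensorIsoHObj_columns _ _).heq.symm
  · refine comp_heq_comp (diagonal_eq _ _) (congrArg F.functor.obj (diagonal_eq _ _))
      (congrArg F.functor.obj (hObj_hObj_unit _ _)) (F.constraint_diagonal a b)
      (map_heq _ (diagonal_eq _ _) (hObj_hObj_unit _ _) ?_)
    exact (hHom_hHom_id_heq _ _).trans (tensorIsoHObj_columns _ _).heq.symm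

theorem horizontalConstraint_congr {a a' b b' : C} (ha : a = a') (hb : b = b') :
    F.horizontalConstraint a b ≍ F.horizontalConstraint a' b' := by
  subst ha hb; rfl

/-- The grid is a row of two blocks, its first column and the rest. Recursively, `τ` is determined
by the unit and vertical constraints; this is why monoidality of a transformation already gives
compatibility with `τ` at every grid. -/
theorem constraint_cons (p : Word C) (g : Grid C) : (F.constraint (p :: g)).hom =
    hHom (F.wordConstraint p) (F.constraint g).hom ≫ F.horizontalConstraint _ _ := by
  apply eq_of_heq
  refine (F.constraint_of_mult [⟨1, .of fun _ => p⟩, ⟨g.length, .of g.get⟩]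
    (R := [.of [p], .of g]) (by simp [Nested.flatten, Word.bind])
    (by simp [Nested.rows, Word.map])).trans ?_
  have ep : Grid.eval F.functor.obj [p] = p.eval F.functor.obj := hObj_unit _
  have ep' : Grid.eval (𝟭 C).obj [p] = p.eval (𝟭 C).obj := hObj_unit _
  refine comp_heq_comp ?_ ?_ ?_ ((hHom_hHom_id_heq _ _).trans (hHom_heq ep (congrArg _ ep') rfl rfl
    (F.wordConstraint_heq p).symm HEq.rfl)) ((F.at_heq _ _).trans ((F.constraint_of_of _ _).trans
    (F.horizontalConstraint_congr ep' rfl)))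
  · change hObj (Grid.eval F.functor.obj [p]) (hObj (Grid.eval F.functor.obj g) _) = _
    rw [ep]; exact hObj_hObj_unit _ _
  · change hObj (F.functor.obj (Grid.eval (𝟭 C).obj [p]))
      (hObj (F.functor.obj (Grid.eval (𝟭 C).obj g)) _) = _
    rw [ep']; exact hObj_hObj_unit _ _
  · change F.functor.obj (hObj (Grid.eval (𝟭 C).obj [p]) (hObj (Grid.eval (𝟭 C).obj g) _)) = _
    rw [ep']; exact congrArg _ (hObj_hObj_unit _ _)

end WeakMap

namespace WeakMap.Transformation

variable {C : Type u} [Category.{v} C] [MonoidalCategory C] [HorizontalStructure C]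
variable {D : Type u'} [Category.{v'} D] [MonoidalCategory D] [HorizontalStructure D]
variable {F G : WeakMap C D}

theorem unitConstraint_comp (θ : Transformation F G) :
    F.unitConstraint ≫ θ.nat.app (𝟙_ C) = G.unitConstraint :=
  (θ.comm []).symm.trans (Category.id_comp _)

theorem verticalConstraint_comp (θ : Transformation F G) (a b : C) :
    F.verticalConstraint a b ≫ θ.nat.app (a ⊗ b) =
      (θ.nat.app a ⊗ₘ θ.nat.app b) ≫ G.verticalConstraint a b := by
  have h := θ.comm [.tensor (.of a) (.of b)]
  apply eq_of_heq
  have hF := fun F : WeakMap C D => F.constraint_tensor_of a b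
  have e : ∀ x : D, hObj x (𝟙_ D) = x := hObj_unit
  have e' : hObj (a ⊗ b) (𝟙_ C) = a ⊗ b := hObj_unit _
  have hθ : ∀ {a b : C}, a = b → θ.nat.app a ≍ θ.nat.app b := by
    intro a b h; subst h; rfl
  exact (comp_heq_comp (e _) (congrArg _ e') (congrArg _ e') (hF F) (hθ e')).symm.trans
    ((heq_of_eq h.symm).trans (comp_heq_comp (e _) (e _) (congrArg _ e') (hHom_unit _) (hF G)))

/-- Stated for a bare natural transformation, because it serves to construct a `Transformation`. -/
theorem wordConstraint_comp (nat : F.functor ⟶ G.functor)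
    (unit : F.unitConstraint ≫ nat.app (𝟙_ C) = G.unitConstraint)
    (tensor : ∀ a b, F.verticalConstraint a b ≫ nat.app (a ⊗ b) =
      (nat.app a ⊗ₘ nat.app b) ≫ G.verticalConstraint a b) : ∀ p : Word C,
    p.evalMap (fun c => nat.app c) ≫ G.wordConstraint p =
      F.wordConstraint p ≫ nat.app (p.eval (𝟭 C).obj)
  | .of c => by
    rw [wordConstraint_of, wordConstraint_of]
    exact (Category.comp_id _).trans (Category.id_comp _).symm
  | .unit => by
    rw [wordConstraint_unit, wordConstraint_unit]
    exact (Category.id_comp _).trans unit.symm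
  | .tensor p q => by
    have hp := wordConstraint_comp nat unit tensor p
    have hq := wordConstraint_comp nat unit tensor q
    rw [wordConstraint_tensor, wordConstraint_tensor]
    exact paste_squares ((tensorHom_comp_tensorHom _ _ _ _).trans ((congrArg₂ _ hp hq).trans
      (tensorHom_comp_tensorHom _ _ _ _).symm)) (tensor _ _).symm

theorem horizontalConstraint_comp (nat : F.functor ⟶ G.functor)
    (tensor : ∀ a b, F.verticalConstraint a b ≫ nat.app (a ⊗ b) =
      (nat.app a ⊗ₘ nat.app b) ≫ G.verticalConstraint a b) (a b : C) :
    hHom (nat.app a) (nat.app b) ≫ G.horizontalConstraint a b =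
      F.horizontalConstraint a b ≫ nat.app (hObj a b) := by
  simp only [horizontalConstraint, Category.assoc]
  rw [Iso.eq_inv_comp, ← tensorIsoHObj_naturality_assoc, Iso.hom_inv_id_assoc, nat.naturality,
    ← Category.assoc, ← Category.assoc, tensor]

/-- A monoidal transformation is a transformation of weak maps. -/
def ofMonoidal (nat : F.functor ⟶ G.functor)
    (unit : F.unitConstraint ≫ nat.app (𝟙_ C) = G.unitConstraint)
    (tensor : ∀ a b, F.verticalConstraint a b ≫ nat.app (a ⊗ b) =
      (nat.app a ⊗ₘ nat.app b) ≫ G.verticalConstraint a b) : Transformation F G where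
  nat := nat
  comm g := by
    induction g with
    | nil => exact (Category.id_comp _).trans unit.symm
    | cons p g ih =>
      rw [constraint_cons, constraint_cons]
      exact paste_squares ((hHom_comp _ _ _ _).symm.trans
        ((congrArg₂ _ (wordConstraint_comp nat unit tensor p) ih).trans (hHom_comp _ _ _ _)))
        (horizontalConstraint_comp nat tensor _ _)

end WeakMap.Transformation
end DDB

/-! ### The weak map of a braided monoidal functor -/

namespace DDB

open MonoidalCategory HorizontalStructure Functor.LaxMonoidal Functor.Monoidal

theorem comp_heq_self {D : Type u} [Category.{v} D] {x y z : D} (f : x ⟶ y) (e : y ⟶ z)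
    (h : z = y) (he : e ≍ 𝟙 y) : f ≫ e ≍ f := by
  subst h
  rw [eq_of_heq he, Category.comp_id]

theorem id_heq {D : Type u} [Category.{v} D] {x y : D} (h : x = y) : 𝟙 x ≍ 𝟙 y := by
  subst h; rfl

theorem map_inv_square {C : Type u} [Category.{v} C] {D : Type u'} [Category.{v'} D] (F : C ⥤ D)
    {x y : D} {a b : C} {e : x ≅ y} {e' : a ≅ b} {f : x ⟶ F.obj a} {g : y ⟶ F.obj b}
    (h : e.hom ≫ g = f ≫ F.map e'.hom) : e.inv ≫ f = g ≫ F.map e'.inv := by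
  rw [Iso.inv_comp_eq, ← Category.assoc, h, Category.assoc, ← F.map_comp, Iso.hom_inv_id,
    F.map_id, Category.comp_id]

namespace BraidedLift

variable {C : Type u} [Category.{v} C] [MonoidalCategory C] [HorizontalStructure C]
variable {D : Type u'} [Category.{v'} D] [MonoidalCategory D] [HorizontalStructure D]
variable (F : C ⥤ D) [F.Braided] {ι : Type w} {κ : Type w'}

/-- Horizontal composition of isomorphisms. -/
def hIso {a a' b b' : C} (e : a ≅ a') (f : b ≅ b') : hObj a b ≅ hObj a' b' where
  hom := hHom e.hom f.hom
  inv := hHom e.inv f.inv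
  hom_inv_id := by rw [← hHom_comp, e.hom_inv_id, f.hom_inv_id, hHom_id]
  inv_hom_id := by rw [← hHom_comp, e.inv_hom_id, f.inv_hom_id, hHom_id]

/-- The horizontal monoidality constraint. -/
def horizontalμ (a b : C) : hObj (F.obj a) (F.obj b) ≅ F.obj (hObj a b) :=
  (tensorIsoHObj _ _).symm ≪≫ μIso F a b ≪≫ F.mapIso (tensorIsoHObj a b)

theorem tensorIsoHObj_comp_horizontalμ (a b : C) :
    (tensorIsoHObj (F.obj a) (F.obj b)).hom ≫ (horizontalμ F a b).hom =
      μ F a b ≫ F.map (tensorIsoHObj a b).hom := by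
  simp [horizontalμ]

theorem horizontalμ_natural {a a' b b' : C} (f : a ⟶ a') (g : b ⟶ b') :
    hHom (F.map f) (F.map g) ≫ (horizontalμ F a' b').hom =
      (horizontalμ F a b).hom ≫ F.map (hHom f g) := by
  rw [← cancel_epi (tensorIsoHObj _ _).hom, ← tensorIsoHObj_naturality_assoc,
    tensorIsoHObj_comp_horizontalμ, reassoc_of% (tensorIsoHObj_comp_horizontalμ F a b),
    ← F.map_comp, ← tensorIsoHObj_naturality, F.map_comp, μ_natural_assoc]

/-- Precomposing with `tensorIsoHObj` turns both sides into the associativity axiom for `μ`, by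
`tensorIsoHObj_assoc` in `D` and, under `F`, in `C`. -/
theorem horizontalμ_assoc (a b c : C) :
    hHom (horizontalμ F a b).hom (𝟙 (F.obj c)) ≫ (horizontalμ F (hObj a b) c).hom ≍
      hHom (𝟙 (F.obj a)) (horizontalμ F b c).hom ≫ (horizontalμ F a (hObj b c)).hom := by
  have h₁ : (tensorIsoHObj (F.obj a) (F.obj b)).hom ▷ F.obj c ≫ (tensorIsoHObj _ _).hom ≫
      hHom (horizontalμ F a b).hom (𝟙 (F.obj c)) ≫ (horizontalμ F (hObj a b) c).hom ≫
      F.map (eqToHom (hObj_assoc a b c)) = μ F a b ▷ F.obj c ≫ μ F (a ⊗ b) c ≫ F.map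
      ((tensorIsoHObj a b).hom ▷ c ≫ (tensorIsoHObj (hObj a b) c).hom ≫
        eqToHom (hObj_assoc a b c)) := by
    rw [← tensorIsoHObj_naturality_assoc, tensorHom_id, ← comp_whiskerRight_assoc,
      tensorIsoHObj_comp_horizontalμ, reassoc_of% (tensorIsoHObj_comp_horizontalμ F (hObj a b) c)]
    simp
  have h₂ : (α_ _ _ _).hom ≫ F.obj a ◁ (tensorIsoHObj (F.obj b) (F.obj c)).hom ≫
      (tensorIsoHObj _ _).hom ≫
      hHom (𝟙 (F.obj a)) (horizontalμ F b c).hom ≫ (horizontalμ F a (hObj b c)).hom =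
      (α_ _ _ _).hom ≫ F.obj a ◁ μ F b c ≫ μ F a (b ⊗ c) ≫ F.map
      (a ◁ (tensorIsoHObj b c).hom ≫ (tensorIsoHObj a (hObj b c)).hom) := by
    rw [← tensorIsoHObj_naturality_assoc, id_tensorHom, ← MonoidalCategory.whiskerLeft_comp_assoc,
      tensorIsoHObj_comp_horizontalμ, tensorIsoHObj_comp_horizontalμ]
    simp
  have h₃ := tensorIsoHObj_assoc (F.obj a) (F.obj b) (F.obj c)
  rw [reassoc_of% h₃.symm, ← associativity_assoc, ← F.map_comp, ← tensorIsoHObj_assoc, ← h₁] at h₂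
  -- The common comparison isomorphisms are cancelled.
  simp only [cancel_epi] at h₂
  have h₄ : (hHom (horizontalμ F a b).hom (𝟙 (F.obj c)) ≫ (horizontalμ F (hObj a b) c).hom) ≫
      eqToHom (congrArg F.obj (hObj_assoc a b c)) = eqToHom (hObj_assoc _ _ _) ≫
      hHom (𝟙 (F.obj a)) (horizontalμ F b c).hom ≫ (horizontalμ F a (hObj b c)).hom := by
    rw [h₂, eqToHom_map, Category.assoc]
  exact (comp_eqToHom_heq _ _).symm.trans ((heq_of_eq h₄).trans (eqToHom_comp_heq _ _))

/-- For `f` an identity this is right unitality of `μ` after the comparison isomorphism is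
cancelled. A general `f` is needed because `ε F` occurs as the end of a grid, next to the constraint
of a column. -/
theorem horizontalμ_unit_right {x : D} {c : C} (f : x ⟶ F.obj c) :
    hHom f (ε F) ≫ (horizontalμ F c (𝟙_ C)).hom ≍ f := by
  have h : hHom (𝟙 (F.obj c)) (ε F) ≫ (horizontalμ F c (𝟙_ C)).hom ≍ 𝟙 (F.obj c) := by
    refine heq_of_comp_heq_comp (hObj_unit _) (congrArg F.obj (hObj_unit _)) rfl
      (tensorIsoHObj_unit (F.obj c)) ?_
    rw [← tensorIsoHObj_naturality_assoc, tensorIsoHObj_comp_horizontalμ, Category.comp_id,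
      id_tensorHom, right_unitality]
    exact comp_heq_comp rfl rfl (congrArg F.obj (hObj_unit _)) HEq.rfl
      (comp_heq_comp rfl rfl (congrArg F.obj (hObj_unit _)) HEq.rfl
        (map_heq _ rfl (hObj_unit _) (tensorIsoHObj_unit c)))
  have h' : hHom f (ε F) = hHom f (𝟙 _) ≫ hHom (𝟙 (F.obj c)) (ε F) := by
    rw [← hHom_comp, Category.comp_id, Category.id_comp]
  rw [h', Category.assoc]
  exact (comp_heq_comp (hObj_unit _) (hObj_unit _) (congrArg F.obj (hObj_unit _)) (hHom_unit f)
    h).trans (heq_of_eq (Category.comp_id f))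

theorem horizontalμ_unit_left {x : D} {c : C} (f : x ⟶ F.obj c) :
    hHom (ε F) f ≫ (horizontalμ F (𝟙_ C) c).hom ≍ f := by
  have h : hHom (ε F) (𝟙 (F.obj c)) ≫ (horizontalμ F (𝟙_ C) c).hom ≍ 𝟙 (F.obj c) := by
    refine heq_of_comp_heq_comp (unit_hObj _) (congrArg F.obj (unit_hObj _)) rfl
      (tensorIsoHObj_unit_left (F.obj c)) ?_
    rw [← tensorIsoHObj_naturality_assoc, tensorIsoHObj_comp_horizontalμ, Category.comp_id,
      tensorHom_id, left_unitality]
    exact comp_heq_comp rfl rfl (congrArg F.obj (unit_hObj _)) HEq.rfl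
      (comp_heq_comp rfl rfl (congrArg F.obj (unit_hObj _)) HEq.rfl
        (map_heq _ rfl (unit_hObj _) (tensorIsoHObj_unit_left c)))
  have h' : hHom (ε F) f = hHom (𝟙 _) f ≫ hHom (ε F) (𝟙 (F.obj c)) := by
    rw [← hHom_comp, Category.comp_id, Category.id_comp]
  rw [h', Category.assoc]
  exact (comp_heq_comp (unit_hObj _) (unit_hObj _) (congrArg F.obj (unit_hObj _)) (unit_hHom f)
    h).trans (heq_of_eq (Category.comp_id f))

/-- This is where braidedness of `F` enters, as compatibility of `μ` with `tensorμ`. On either side,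
`tensorIsoHObj_interchange` trades `tensorμ` for strict interchange. -/
theorem horizontalμ_interchange (a b c d : C) :
    ((horizontalμ F a b).hom ⊗ₘ (horizontalμ F c d).hom) ≫ μ F (hObj a b) (hObj c d) ≍
      hHom (μ F a c) (μ F b d) ≫ (horizontalμ F (a ⊗ c) (b ⊗ d)).hom := by
  have h : tensorμ (F.obj a) (F.obj b) (F.obj c) (F.obj d) ≫ (tensorIsoHObj _ _).hom ≫
      eqToHom (interchange_obj _ _ _ _) ≫
      ((horizontalμ F a b).hom ⊗ₘ (horizontalμ F c d).hom) ≫ μ F (hObj a b) (hObj c d) =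
      tensorμ (F.obj a) (F.obj b) (F.obj c) (F.obj d) ≫ (tensorIsoHObj _ _).hom ≫
      hHom (μ F a c) (μ F b d) ≫ (horizontalμ F (a ⊗ c) (b ⊗ d)).hom ≫
      F.map (eqToHom (interchange_obj a b c d)) := by
    rw [reassoc_of% (tensorIsoHObj_interchange (F.obj a) (F.obj b) (F.obj c) (F.obj d)),
      tensorHom_comp_tensorHom_assoc, tensorIsoHObj_comp_horizontalμ,
      tensorIsoHObj_comp_horizontalμ, ← tensorHom_comp_tensorHom_assoc, μ_natural,
      ← tensorIsoHObj_interchange, F.map_comp,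
      ← tensorμ_comp_μ_tensorHom_μ_comp_μ_assoc, F.map_comp,
      ← reassoc_of% (tensorIsoHObj_comp_horizontalμ F (a ⊗ c) (b ⊗ d)),
      tensorIsoHObj_naturality_assoc]
  replace h := congrArg (tensorδ _ _ _ _ ≫ ·) h
  simp only [tensorδ_tensorμ_assoc, cancel_epi] at h
  rw [eqToHom_map, ← Category.assoc (hHom _ _)] at h
  exact (eqToHom_comp_heq _ _).symm.trans ((heq_of_eq h).trans (comp_eqToHom_heq _ _))

/-- Left unitality of `F` at the unit, where strictness makes the unitors identities. It is the case
of length zero in `gridIso_ofFn_tensor`. -/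
theorem ε_heq : (ε F ⊗ₘ ε F) ≫ μ F (𝟙_ C) (𝟙_ C) ≍ ε F := by
  have h : (ε F ⊗ₘ ε F) ≫ μ F (𝟙_ C) (𝟙_ C) ≫ F.map (λ_ (𝟙_ C)).hom = (λ_ _).hom ≫ ε F := by
    rw [← leftUnitor_naturality, left_unitality, tensorHom_def', Category.assoc]
  rw [← Category.assoc] at h
  refine (comp_heq_self _ _ (congrArg F.obj unit_tensor_unit.symm) ?_).symm.trans
    ((heq_of_eq h).trans ?_)
  · exact (map_heq F unit_tensor_unit rfl leftUnitor_unit).trans ((heq_of_eq (F.map_id _)).trans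
      (id_heq (congrArg F.obj unit_tensor_unit.symm)))
  · exact (comp_heq_comp unit_tensor_unit rfl rfl leftUnitor_unit HEq.rfl).trans
      (heq_of_eq (Category.id_comp _))

theorem μ_congr {a a' b b' : C} (ha : a = a') (hb : b = b') : μ F a b ≍ μ F a' b' := by
  subst ha hb; rfl

theorem horizontalμ_congr {a a' b b' : C} (ha : a = a') (hb : b = b') :
    (horizontalμ F a b).hom ≍ (horizontalμ F a' b').hom := by
  subst ha hb; rfl

/-- The constraint of the lifted weak map at a word. -/
def wordIso (x : ι → C) : ∀ p : Word ι, p.eval (fun i => F.obj (x i)) ≅ F.obj (p.eval x)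
  | .of _ => Iso.refl _
  | .unit => εIso F
  | .tensor p q => (wordIso x p ⊗ᵢ wordIso x q) ≪≫ μIso F _ _

/-- The constraint of the lifted weak map at a grid. -/
def gridIso (x : ι → C) : ∀ g : Grid ι, g.eval (fun i => F.obj (x i)) ≅ F.obj (g.eval x)
  | [] => εIso F
  | p :: g => hIso (wordIso F x p) (gridIso x g) ≪≫ horizontalμ F _ _

theorem wordIso_map (f : ι → κ) (x : κ → C) : ∀ p : Word ι,
    (wordIso F x (p.map f)).hom ≍ (wordIso F (fun i => x (f i)) p).hom
  | .of i => HEq.rfl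
  | .unit => HEq.rfl
  | .tensor p q => by
    have ep := Word.eval_map f x p
    have eq := Word.eval_map f x q
    refine comp_heq_comp ?_ (by rw [ep, eq]) ?_ (tensorHom_heq (Word.eval_map _ _ _) (by rw [ep])
      (Word.eval_map _ _ _) (by rw [eq]) (wordIso_map f x p) (wordIso_map f x q)) (μ_congr F ep eq)
    · exact congrArg₂ _ (Word.eval_map _ _ _) (Word.eval_map _ _ _)
    · exact congrArg F.obj (congrArg₂ _ ep eq)

theorem gridIso_map (f : ι → κ) (x : κ → C) : ∀ g : Grid ι,
    (gridIso F x (g.map f)).hom ≍ (gridIso F (fun i => x (f i)) g).hom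
  | [] => HEq.rfl
  | p :: g => by
    have ep := Word.eval_map f x p
    have eg := Grid.eval_map f x g
    refine comp_heq_comp ?_ ?_ ?_
      (hHom_heq (Word.eval_map _ _ _) (by rw [ep])
      (Grid.eval_map _ _ _) (congrArg F.obj eg) (wordIso_map F f x p) (gridIso_map f x g))
      (horizontalμ_congr F ep eg)
    · exact congrArg₂ _ (Word.eval_map _ _ _) (Grid.eval_map _ _ _)
    · exact congrArg₂ _ (congrArg F.obj ep) (congrArg F.obj eg)
    · exact congrArg F.obj (congrArg₂ _ ep eg)

theorem constraintAt_gridIso (x : ι → C) (g : Grid ι) :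
    (constraintAt F (fun g => gridIso F (𝟭 C).obj g) x g).hom = (gridIso F x g).hom := by
  apply eq_of_heq
  refine HEq.trans ?_ (gridIso_map F x (𝟭 C).obj g)
  simp [constraintAt]

/-- Induction on the first grid: the empty grid is absorbed by unitality, and adding a column is
`horizontalμ_assoc`. -/
theorem gridIso_append (x : ι → C) (g h : Grid ι) :
    (gridIso F x (g ++ h)).hom ≍
      hHom (gridIso F x g).hom (gridIso F x h).hom ≫ (horizontalμ F _ _).hom := by
  induction g with
  | nil => exact (horizontalμ_unit_left F _).symm
  | cons p g ih =>
    change hHom (wordIso F x p).hom (gridIso F x (g ++ h)).hom ≫ (horizontalμ F _ _).hom ≍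
      hHom (hHom (wordIso F x p).hom (gridIso F x g).hom ≫ (horizontalμ F _ _).hom)
        (gridIso F x h).hom ≫ (horizontalμ F _ _).hom
    have e₁ := Grid.eval_append (fun i => F.obj (x i)) g h
    have e₂ := Grid.eval_append x g h
    refine (comp_heq_comp (congrArg _ e₁) (congrArg (fun y => hObj _ (F.obj y)) e₂)
      (congrArg (fun y => F.obj (hObj _ y)) e₂) (hHom_heq rfl rfl e₁ (congrArg F.obj e₂) HEq.rfl ih)
      (horizontalμ_congr F rfl e₂)).trans ?_
    have h₁ := hHom_comp (wordIso F x p).hom (𝟙 _) (hHom (gridIso F x g).hom (gridIso F x h).hom)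
      (horizontalμ F _ _).hom
    have h₂ := hHom_comp (hHom (wordIso F x p).hom (gridIso F x g).hom) (horizontalμ F _ _).hom
      (gridIso F x h).hom (𝟙 _)
    rw [Category.comp_id] at h₁ h₂
    refine (heq_of_eq ((congrArg (· ≫ _) h₁).trans (Category.assoc _ _ _))).trans (HEq.trans ?_
      (heq_of_eq ((congrArg (· ≫ _) h₂).trans (Category.assoc _ _ _))).symm)
    exact comp_heq_comp (hObj_assoc _ _ _).symm (hObj_assoc _ _ _).symm
      (congrArg F.obj (hObj_assoc _ _ _).symm) (hHom_assoc _ _ _).symm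
      (horizontalμ_assoc F _ _ _).symm

theorem gridIso_ofFn_unit (x : ι → C) (n : ℕ) :
    (gridIso F x (List.ofFn fun _ : Fin n => Word.unit)).hom ≍ ε F := by
  induction n with
  | zero => rfl
  | succ n ih =>
    rw [List.ofFn_succ]
    have e₁ := Grid.eval_ofFn_unit (fun i => F.obj (x i)) n
    have e₂ := Grid.eval_ofFn_unit x n
    exact (comp_heq_comp (congrArg _ e₁) (congrArg (fun y => hObj _ (F.obj y)) e₂)
      (congrArg (fun y => F.obj (hObj _ y)) e₂) (hHom_heq rfl rfl e₁ (congrArg F.obj e₂) HEq.rfl ih)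
      (horizontalμ_congr F rfl e₂)).trans (horizontalμ_unit_right F _)

/-- Two rows above each other are interchanged column by column, by `horizontalμ_interchange`. -/
theorem gridIso_ofFn_tensor (x : ι → C) (n : ℕ) (r s : Fin n → Word ι) :
    (gridIso F x (List.ofFn fun k => Word.tensor (r k) (s k))).hom ≍
      ((gridIso F x (List.ofFn r)).hom ⊗ₘ (gridIso F x (List.ofFn s)).hom) ≫ μ F _ _ := by
  induction n with
  | zero => exact (ε_heq F).symm
  | succ n ih =>
    rw [List.ofFn_succ, List.ofFn_succ, List.ofFn_succ]
    have e₁ := Grid.eval_ofFn_tensor (fun i => F.obj (x i)) n (fun k => r k.succ) fun k => s k.succ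
    have e₂ := Grid.eval_ofFn_tensor x n (fun k => r k.succ) fun k => s k.succ
    refine (comp_heq_comp (congrArg _ e₁) (congrArg (fun y => hObj _ (F.obj y)) e₂)
      (congrArg (fun y => F.obj (hObj _ y)) e₂)
      (hHom_heq rfl rfl e₁ (congrArg F.obj e₂) HEq.rfl (ih (fun k => r k.succ) fun k => s k.succ))
      (horizontalμ_congr F rfl e₂)).trans ?_
    have h₁ := hHom_comp ((wordIso F x (r 0)).hom ⊗ₘ (wordIso F x (s 0)).hom) (μ F _ _)
      ((gridIso F x (List.ofFn fun k => r k.succ)).hom ⊗ₘ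
        (gridIso F x (List.ofFn fun k => s k.succ)).hom) (μ F _ _)
    refine (heq_of_eq ((congrArg (· ≫ _) h₁).trans (Category.assoc _ _ _))).trans ?_
    refine (comp_heq_comp (interchange_obj _ _ _ _) (interchange_obj _ _ _ _)
      (congrArg F.obj (interchange_obj _ _ _ _)) (interchange_hom _ _ _ _)
      (horizontalμ_interchange F _ _ _ _).symm).trans (heq_of_eq ?_)
    exact (Category.assoc _ _ _).symm.trans (congrArg (· ≫ μ F _ _)
      (tensorHom_comp_tensorHom _ _ _ _))

theorem gridIso_row (x : ι → C) (n : ℕ) (p : Word (Fin n → Word ι)) :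
    (gridIso F x (List.ofFn fun k => p.bind fun r => r k)).hom ≍
      p.evalMap (fun r => (gridIso F x (List.ofFn r)).hom) ≫
        (wordIso F (fun r => Grid.eval x (List.ofFn r)) p).hom := by
  induction p with
  | of r => exact heq_of_eq (Category.comp_id _).symm
  | unit => exact (gridIso_ofFn_unit F x n).trans (heq_of_eq (Category.id_comp _).symm)
  | tensor p q hp hq =>
    have e := Grid.eval_row x n
    have e' := Grid.eval_row (fun i => F.obj (x i)) n
    refine (gridIso_ofFn_tensor F x n _ _).trans ((comp_heq_comp (congrArg₂ _ (e' p) (e' q))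
      (congrArg₂ _ (congrArg F.obj (e p)) (congrArg F.obj (e q)))
      (congrArg F.obj (congrArg₂ _ (e p) (e q)))
      (tensorHom_heq (e' p) (congrArg F.obj (e p)) (e' q) (congrArg F.obj (e q)) hp hq)
      (μ_congr F (e p) (e q))).trans (heq_of_eq ?_))
    rw [← tensorHom_comp_tensorHom, Category.assoc]
    rfl

/-- The substance of the multiplication axiom: `gridIso_append` separates the blocks, and
`gridIso_row` treats the vertical composite inside each block. -/
theorem gridIso_flatten (x : ι → C) (N : Nested ι) :
    (gridIso F x N.flatten).hom ≍ Grid.evalMap (fun g => (gridIso F x g).hom) N.rows ≫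
      (gridIso F (fun g => g.eval x) N.rows).hom := by
  induction N with
  | nil => exact heq_of_eq (Category.id_comp _).symm
  | cons p N ih =>
    have e₁ := Grid.eval_row x p.1 p.2
    have e₂ := Nested.eval_flatten x N
    have e₁' := Grid.eval_row (fun i => F.obj (x i)) p.1 p.2
    have e₂' := Nested.eval_flatten (fun i => F.obj (x i)) N
    have hp : (gridIso F x (List.ofFn fun k => p.2.bind fun r => r k)).hom ≍
        (p.2.map (fun r => List.ofFn r)).evalMap (fun g => (gridIso F x g).hom) ≫
          (wordIso F (fun g => Grid.eval x g) (p.2.map (fun r => List.ofFn r))).hom :=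
      (gridIso_row F x p.1 p.2).trans (comp_heq_comp (Word.eval_map _ _ _).symm
        (Word.eval_map (fun r => List.ofFn r) (fun g => F.obj (Grid.eval x g)) _).symm (congrArg F.obj (Word.eval_map _ _ _).symm)
        (Word.evalMap_map (fun r => List.ofFn r) (fun g => (gridIso F x g).hom) _).symm (wordIso_map F _ _ _).symm)
    refine (gridIso_append F x (List.ofFn fun k => p.2.bind fun r => r k)
      (Nested.flatten N)).trans ?_
    refine (comp_heq_comp
      (congrArg₂ hObj (e₁'.trans (Word.eval_map _ _ _).symm) e₂')
      (congrArg₂ (fun a b => hObj (F.obj a) (F.obj b)) (e₁.trans (Word.eval_map _ _ _).symm) e₂)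
      (congrArg₂ (fun a b => F.obj (hObj a b)) (e₁.trans (Word.eval_map _ _ _).symm) e₂)
      (hHom_heq (e₁'.trans (Word.eval_map _ _ _).symm)
        (congrArg F.obj (e₁.trans (Word.eval_map _ _ _).symm)) e₂' (congrArg F.obj e₂) hp ih)
      (horizontalμ_congr F (e₁.trans (Word.eval_map _ _ _).symm) e₂)).trans (heq_of_eq ?_)
    rw [hHom_comp, Category.assoc]
    rfl

theorem μ_associator {x y z : D} {a b c : C} (f : x ⟶ F.obj a) (g : y ⟶ F.obj b)
    (h : z ⟶ F.obj c) : (α_ x y z).hom ≫ (f ⊗ₘ ((g ⊗ₘ h) ≫ μ F b c)) ≫ μ F a (b ⊗ c) =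
      ((((f ⊗ₘ g) ≫ μ F a b) ⊗ₘ h) ≫ μ F (a ⊗ b) c) ≫ F.map (α_ a b c).hom := by
  have h₁ : f ⊗ₘ ((g ⊗ₘ h) ≫ μ F b c) = (f ⊗ₘ (g ⊗ₘ h)) ≫ F.obj a ◁ μ F b c := by
    simp [MonoidalCategory.tensorHom_def]
  have h₂ : ((f ⊗ₘ g) ≫ μ F a b) ⊗ₘ h = ((f ⊗ₘ g) ⊗ₘ h) ≫ μ F a b ▷ F.obj c := by
    simp [MonoidalCategory.tensorHom_def']
  rw [h₁, h₂, Category.assoc, Category.assoc, Category.assoc, associativity,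
    associator_naturality_assoc]

theorem μ_leftUnitor {x : D} {a : C} (f : x ⟶ F.obj a) :
    (λ_ x).hom ≫ f = ((ε F ⊗ₘ f) ≫ μ F (𝟙_ C) a) ≫ F.map (λ_ a).hom := by
  rw [← leftUnitor_naturality, left_unitality, MonoidalCategory.tensorHom_def', Category.assoc,
    Category.assoc]

theorem μ_rightUnitor {x : D} {a : C} (f : x ⟶ F.obj a) :
    (ρ_ x).hom ≫ f = ((f ⊗ₘ ε F) ≫ μ F a (𝟙_ C)) ≫ F.map (ρ_ a).hom := by
  rw [← rightUnitor_naturality, right_unitality, MonoidalCategory.tensorHom_def, Category.assoc,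
    Category.assoc]

/-- The formal constraints are covered by the monoidal axioms of `F`, and their inverses by
inverting those squares. -/
theorem wordIso_naturality {p q : Word C} (φ : Word.Hom p q) :
    φ.eval F ≫ (wordIso F (𝟭 C).obj q).hom =
      (wordIso F (𝟭 C).obj p).hom ≫ F.map (φ.eval (𝟭 C)) := by
  induction φ with
  | of f => exact (Category.comp_id _).trans (Category.id_comp _).symm
  | id p => exact (Category.id_comp _).trans ((congrArg _ (F.map_id _)).trans
      (Category.comp_id _)).symm
  | comp φ ψ hφ hψ =>
    change (φ.eval F ≫ ψ.eval F) ≫ _ = _ ≫ F.map (φ.eval (𝟭 C) ≫ ψ.eval (𝟭 C))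
    rw [Category.assoc, hψ, ← Category.assoc, hφ, Category.assoc, F.map_comp]
  | @tensor p p' q q' φ ψ hφ hψ =>
    change (φ.eval F ⊗ₘ ψ.eval F) ≫ ((wordIso F (𝟭 C).obj p').hom ⊗ₘ
      (wordIso F (𝟭 C).obj q').hom) ≫ μ F _ _ = (((wordIso F (𝟭 C).obj p).hom ⊗ₘ
      (wordIso F (𝟭 C).obj q).hom) ≫ μ F _ _) ≫ F.map (φ.eval (𝟭 C) ⊗ₘ ψ.eval (𝟭 C))
    rw [tensorHom_comp_tensorHom_assoc, hφ, hψ, ← tensorHom_comp_tensorHom_assoc, μ_natural,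
      Category.assoc]
  | associator p q r => exact μ_associator F _ _ _
  | associatorInv p q r => exact map_inv_square F (μ_associator F _ _ _)
  | leftUnitor p => exact μ_leftUnitor F _
  | leftUnitorInv p => exact map_inv_square F (μ_leftUnitor F _)
  | rightUnitor p => exact μ_rightUnitor F _
  | rightUnitorInv p => exact map_inv_square F (μ_rightUnitor F _)

theorem gridIso_naturality {g h : Grid C} (Φ : Grid.Hom g h) :
    Φ.eval F ≫ (gridIso F (𝟭 C).obj h).hom =
      (gridIso F (𝟭 C).obj g).hom ≫ F.map (Φ.eval (𝟭 C)) := by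
  induction Φ with
  | nil => exact (Category.id_comp _).trans ((congrArg _ (F.map_id _)).trans
      (Category.comp_id _)).symm
  | @cons p q g h φ Φ ih =>
    change hHom (φ.eval F) (Φ.eval F) ≫ hHom (wordIso F (𝟭 C).obj q).hom
      (gridIso F (𝟭 C).obj h).hom ≫ (horizontalμ F _ _).hom = (hHom (wordIso F (𝟭 C).obj p).hom
      (gridIso F (𝟭 C).obj g).hom ≫ (horizontalμ F _ _).hom) ≫
        F.map (hHom (φ.eval (𝟭 C)) (Φ.eval (𝟭 C)))
    rw [← Category.assoc, ← hHom_comp, wordIso_naturality, ih, hHom_comp, Category.assoc,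
      horizontalμ_natural, Category.assoc]

/-- The weak map given by a braided monoidal functor. -/
def weakMap : WeakMap C D where
  functor := F
  constraint g := gridIso F (𝟭 C).obj g
  naturality Φ := gridIso_naturality F Φ
  unit c := by
    refine eq_of_heq ((horizontalμ_unit_right F (𝟙 (F.obj c))).trans ?_)
    refine HEq.symm ((eqToHom_heq_id_cod _ _ _).trans ?_)
    exact id_heq (congrArg F.obj (hObj_unit c))
  mult N := by
    refine eq_of_heq ((gridIso_flatten F _ N).trans ?_)
    refine HEq.trans ?_ (eqToHom_comp_heq_comp' _ _ _ _).symm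
    rw [constraintAt_gridIso]

theorem weakMap_verticalConstraint (a b : C) : (weakMap F).verticalConstraint a b = μ F a b := by
  refine eq_of_heq ((eqToHom_comp_heq_comp _ _ _).trans
    ((horizontalμ_unit_right F ((𝟙 (F.obj a) ⊗ₘ 𝟙 (F.obj b)) ≫ μ F a b)).trans (heq_of_eq ?_)))
  rw [id_tensorHom_id, Category.id_comp]

end BraidedLift
end DDB

/-! ### Strictification of a braided monoidal category -/

namespace DDB

/-- Formal composites of the objects of a braided monoidal category: a list of objects, which are
composed horizontally, next to a vertical composite of two formal composites. -/
inductive Strictification (S : Type u) : Type u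
  | nil
  | node (s : List S) (l r : Strictification S)

namespace Strictification

/-- Formal horizontal composition. -/
def merge {S : Type u} : Strictification S → Strictification S → Strictification S
  | nil, y => y
  | node s l r, nil => node s l r
  -- The two vertical factors are merged separately, so that interchange holds on the nose.
  | node s l r, node s' l' r' => node (s ++ s') (merge l l') (merge r r')

/-- Formal vertical composition. -/
def stack {S : Type u} : Strictification S → Strictification S → Strictification S
  -- The only clause that removes units: it makes `1 / 1 = 1` strict, while `1 / x` stays different
  -- from `x` for any other `x`.
  | nil, nil => nil
  | nil, node s l r => node [] nil (node s l r)
  | node s l r, y => node [] (node s l r) y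

theorem merge_nil {S : Type u} : ∀ x : Strictification S, merge x nil = x
  | nil => rfl
  | node _ _ _ => rfl

theorem merge_assoc {S : Type u} :
    ∀ x y z : Strictification S, merge (merge x y) z = merge x (merge y z)
  | nil, _, _ => rfl
  | node _ _ _, nil, _ => rfl
  | node _ _ _, node _ _ _, nil => rfl
  | node s l r, node s' l' r', node s'' l'' r'' => by
    simp only [merge]
    rw [List.append_assoc, merge_assoc l l' l'', merge_assoc r r' r'']

/-- A stack other than `nil` has an empty list, and `merge` acts on its two factors separately, so
each case is definitional. -/
theorem merge_stack {S : Type u} (a c b d : Strictification S) :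
    merge (stack a c) (stack b d) = stack (merge a b) (merge c d) := by
  cases a <;> cases b <;> cases c <;> cases d <;> rfl

open MonoidalCategory

variable {B : Type u} [Category.{v} B] [MonoidalCategory B]

/-- The value of a list of objects. -/
def listObj : List B → B
  | [] => 𝟙_ B
  | a :: s => a ⊗ listObj s

/-- The value of a formal composite. -/
def evalObj : Strictification B → B
  | nil => 𝟙_ B
  | node s l r => listObj s ⊗ (evalObj l ⊗ evalObj r)

/-- With morphisms taken between values, evaluation is fully faithful by construction, and the
strictness is a matter of objects alone. -/
instance : Category (Strictification B) where
  Hom x y := evalObj x ⟶ evalObj y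
  id x := 𝟙 (evalObj x)
  comp f g := CategoryStruct.comp (obj := B) f g
  id_comp f := Category.id_comp (obj := B) f
  comp_id f := Category.comp_id (obj := B) f
  assoc f g h := Category.assoc (obj := B) f g h

variable (B) in
/-- The evaluation of formal composites. -/
def eval : Strictification B ⥤ B where
  obj := evalObj
  map f := f

instance : (eval B).Faithful := ⟨fun h => h⟩

instance : (eval B).Full := ⟨fun f => ⟨f, rfl⟩⟩

/-- Turns a strict equation between morphisms of formal composites into a coherence equation in `B`:
both are compared with one morphism `t`, along comparison maps that differ by the image of the
equality of objects. -/
theorem heq_of_squares {x x' y y' : Strictification B} (hx : x = x') (hy : y = y')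
    {f : x ⟶ y} {f' : x' ⟶ y'} {z w : B} {p : (eval B).obj x ⟶ z} {q : (eval B).obj y ⟶ w}
    {p' : (eval B).obj x' ⟶ z} {q' : (eval B).obj y' ⟶ w} [Mono q] (t : z ⟶ w)
    (hp : p = (eval B).map (eqToHom hx) ≫ p') (hq : q = (eval B).map (eqToHom hy) ≫ q')
    (h : (eval B).map f ≫ q = p ≫ t) (h' : (eval B).map f' ≫ q' = p' ≫ t) : f ≍ f' := by
  subst hx hy
  rw [eqToHom_refl, CategoryTheory.Functor.map_id, Category.id_comp] at hp hq
  subst hp hq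
  exact heq_of_eq ((eval B).map_injective ((cancel_mono q).1 (h.trans h'.symm)))

/-- The image of an equality of formal composites is an equality. -/
theorem eval_eqToHom_node {s s' : List B} {l l' r r' : Strictification B} (hs : s = s')
    (hl : l = l') (hr : r = r') (h : node s l r = node s' l' r') :
    (eval B).map (eqToHom h) = eqToHom (congrArg listObj hs) ⊗ₘ
      ((eval B).map (eqToHom hl) ⊗ₘ (eval B).map (eqToHom hr)) := by
  subst hs hl hr
  change _ = 𝟙 (listObj s) ⊗ₘ (𝟙 (evalObj l) ⊗ₘ 𝟙 (evalObj r))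
  rw [id_tensorHom_id, id_tensorHom_id]
  rfl

/-- The comparison of the value of a concatenated list with the tensor product of the values. -/
def listIso : ∀ s s' : List B, listObj (s ++ s') ≅ listObj s ⊗ listObj s'
  | [], _ => (λ_ _).symm
  | a :: s, s' => whiskerLeftIso a (listIso s s') ≪≫ (α_ _ _ _).symm

/-- Strict associativity of concatenation lies over the associator of `B`. This is the list part of
`mergeIso_assoc`. -/
theorem listIso_assoc : ∀ s s' s'' : List B,
    (listIso (s ++ s') s'').hom ≫ (listIso s s').hom ▷ _ ≫ (α_ _ _ _).hom =
      (eqToHom (congrArg listObj (List.append_assoc s s' s'')) ≫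
        (listIso s (s' ++ s'')).hom) ≫ listObj s ◁ (listIso s' s'').hom
  | [], s', s'' => by
    change (listIso s' s'').hom ≫ (λ_ _).inv ▷ _ ≫ (α_ _ _ _).hom =
      (𝟙 _ ≫ (λ_ _).inv) ≫ 𝟙_ B ◁ (listIso s' s'').hom
    rw [Category.id_comp, ← leftUnitor_inv_naturality]
    simp
  | a :: s, s', s'' => by
    have ih := listIso_assoc s s' s''
    have e : eqToHom (congrArg listObj (List.append_assoc (a :: s) s' s'')) =
        a ◁ eqToHom (congrArg listObj (List.append_assoc s s' s'')) := by
      rw [whiskerLeft_eqToHom]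
      rfl
    rw [e]
    change (a ◁ (listIso (s ++ s') s'').hom ≫ (α_ _ _ _).inv) ≫
      (a ◁ (listIso s s').hom ≫ (α_ _ _ _).inv) ▷ _ ≫ (α_ _ _ _).hom =
      (a ◁ _ ≫ a ◁ (listIso s (s' ++ s'')).hom ≫ (α_ _ _ _).inv) ≫
        (a ⊗ listObj s) ◁ (listIso s' s'').hom
    replace ih := congrArg (fun k => a ◁ k ≫ (α_ _ _ _).inv) ih
    simp only [MonoidalCategory.whiskerLeft_comp, Category.assoc] at ih
    simp only [Category.assoc, comp_whiskerRight, tensor_whiskerLeft, Iso.inv_hom_id_assoc, ← ih]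
    monoidal

theorem comp_tensorHom_comp_tensorHom {x₁ x₂ x₃ y₁ y₂ y₃ z₁ z₂ z₃ w t : B} (e₁ : x₁ ⟶ y₁)
    (e₂ : x₂ ⟶ y₂) (e₃ : x₃ ⟶ y₃) (p₁ : y₁ ⟶ z₁) (p₂ : y₂ ⟶ z₂) (p₃ : y₃ ⟶ z₃)
    (m : z₂ ⊗ z₃ ⟶ w) (m' : z₁ ⊗ w ⟶ t) :
    ((e₁ ≫ p₁) ⊗ₘ (((e₂ ≫ p₂) ⊗ₘ (e₃ ≫ p₃)) ≫ m)) ≫ m' =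
      (e₁ ⊗ₘ (e₂ ⊗ₘ e₃)) ≫ (p₁ ⊗ₘ ((p₂ ⊗ₘ p₃) ≫ m)) ≫ m' := by
  rw [tensorHom_comp_tensorHom_assoc, tensorHom_comp_tensorHom_assoc]

section Braided

variable [BraidedCategory B]

/-- The middle-four interchange. -/
def tensorμIso (a b c d : B) : (a ⊗ b) ⊗ (c ⊗ d) ≅ (a ⊗ c) ⊗ (b ⊗ d) where
  hom := tensorμ a b c d
  inv := tensorδ a b c d

/-- The comparison of the value of a horizontal composite with the tensor product of the values. -/
def mergeIso : ∀ x y : Strictification B,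
    (eval B).obj (merge x y) ≅ (eval B).obj x ⊗ (eval B).obj y
  | nil, _ => (λ_ _).symm
  | node _ _ _, nil => (ρ_ _).symm
  | node s l r, node s' l' r' =>
    (listIso s s' ⊗ᵢ ((mergeIso l l' ⊗ᵢ mergeIso r r') ≪≫ tensorμIso _ _ _ _)) ≪≫
      tensorμIso _ _ _ _

/-- The comparison of the value of a vertical composite with the tensor product of the values. -/
def stackIso : ∀ x y : Strictification B,
    (eval B).obj (stack x y) ≅ (eval B).obj x ⊗ (eval B).obj y
  | nil, nil => (λ_ _).symm
  -- The list of this stack is empty, so its value is the wanted product with a further factor `𝟙_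
  -- B` on the left.
  | nil, node _ _ _ => λ_ _
  | node _ _ _, _ => λ_ _

/-- The braiding makes `⊗ : B × B → B` compatible with associators (`associator_monoidal`). Hence
two coassociative splittings, tensored and followed by the middle-four interchange, give a
coassociative splitting. -/
theorem tensorμ_assoc_of {t p₁ p₂ p₃ p₁₂ p₂₃ t' q₁ q₂ q₃ q₁₂ q₂₃ : B}
    {f : t ⟶ p₁₂ ⊗ p₃} {g : p₁₂ ⟶ p₁ ⊗ p₂} {h : t ⟶ p₁ ⊗ p₂₃} {k : p₂₃ ⟶ p₂ ⊗ p₃}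
    {f' : t' ⟶ q₁₂ ⊗ q₃} {g' : q₁₂ ⟶ q₁ ⊗ q₂} {h' : t' ⟶ q₁ ⊗ q₂₃} {k' : q₂₃ ⟶ q₂ ⊗ q₃}
    (e : f ≫ g ▷ p₃ ≫ (α_ _ _ _).hom = h ≫ p₁ ◁ k)
    (e' : f' ≫ g' ▷ q₃ ≫ (α_ _ _ _).hom = h' ≫ q₁ ◁ k') :
    ((f ⊗ₘ f') ≫ tensorμ _ _ _ _) ≫ ((g ⊗ₘ g') ≫ tensorμ _ _ _ _) ▷ (p₃ ⊗ q₃) ≫ (α_ _ _ _).hom =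
      ((h ⊗ₘ h') ≫ tensorμ _ _ _ _) ≫ (p₁ ⊗ q₁) ◁ ((k ⊗ₘ k') ≫ tensorμ _ _ _ _) := by
  have h₁ : tensorμ p₁₂ p₃ q₁₂ q₃ ≫ (g ⊗ₘ g') ▷ (p₃ ⊗ q₃) =
      (g ▷ p₃ ⊗ₘ g' ▷ q₃) ≫ tensorμ _ _ _ _ := by
    simpa using (tensorμ_natural g (𝟙 p₃) g' (𝟙 q₃)).symm
  have h₂ : tensorμ p₁ p₂₃ q₁ q₂₃ ≫ (p₁ ⊗ q₁) ◁ (k ⊗ₘ k') =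
      (p₁ ◁ k ⊗ₘ q₁ ◁ k') ≫ tensorμ _ _ _ _ := by
    simpa using (tensorμ_natural (𝟙 p₁) k (𝟙 q₁) k').symm
  rw [comp_whiskerRight, MonoidalCategory.whiskerLeft_comp, Category.assoc, Category.assoc,
    Category.assoc, reassoc_of% h₁, associator_monoidal, reassoc_of% h₂,
    tensorHom_comp_tensorHom_assoc, tensorHom_comp_tensorHom_assoc, tensorHom_comp_tensorHom_assoc,
    Category.assoc, Category.assoc, e, e']

theorem mergeIso_nil : ∀ x : Strictification B, (mergeIso x nil).hom =
    (eval B).map (eqToHom (merge_nil x)) ≫ (ρ_ ((eval B).obj x)).inv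
  | nil => by
    change (λ_ (𝟙_ B)).inv = 𝟙 (𝟙_ B) ≫ (ρ_ (𝟙_ B)).inv
    rw [Category.id_comp, unitors_inv_equal]
  | node s l r => (Category.id_comp (ρ_ ((eval B).obj (node s l r))).inv).symm

theorem mergeIso_assoc : ∀ x y z : Strictification B,
    (mergeIso (merge x y) z).hom ≫ (mergeIso x y).hom ▷ _ ≫ (α_ _ _ _).hom =
      ((eval B).map (eqToHom (merge_assoc x y z)) ≫ (mergeIso x (merge y z)).hom) ≫
        (eval B).obj x ◁ (mergeIso y z).hom
  | nil, y, z => by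
    change (mergeIso y z).hom ≫ (λ_ _).inv ▷ _ ≫ (α_ _ _ _).hom =
      (𝟙 _ ≫ (λ_ _).inv) ≫ 𝟙_ B ◁ (mergeIso y z).hom
    rw [Category.id_comp, ← leftUnitor_inv_naturality]
    simp
  | node s l r, nil, z => by
    change (mergeIso (node s l r) z).hom ≫ (ρ_ _).inv ▷ _ ≫ (α_ _ _ _).hom =
      (𝟙 _ ≫ (mergeIso (node s l r) z).hom) ≫ _ ◁ (λ_ _).inv
    rw [Category.id_comp]
    congr 1
    monoidal
  | node s l r, node s' l' r', nil => by
    change (ρ_ _).inv ≫ (mergeIso (node s l r) (node s' l' r')).hom ▷ _ ≫ (α_ _ _ _).hom =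
      (𝟙 _ ≫ (mergeIso (node s l r) (node s' l' r')).hom) ≫ _ ◁ (ρ_ _).inv
    rw [Category.id_comp, ← rightUnitor_inv_naturality_assoc]
    congr 1
    monoidal
  | node s l r, node s' l' r', node s'' l'' r'' => by
    -- Applied twice, since the value of a node is nested as `s ⊗ (l ⊗ r)`.
    have h := tensorμ_assoc_of (listIso_assoc s s' s'')
      (tensorμ_assoc_of (mergeIso_assoc l l' l'') (mergeIso_assoc r r' r''))
    refine h.trans (congrArg (· ≫ _) ?_)
    exact (comp_tensorHom_comp_tensorHom _ _ _ _ _ _ _ _).trans (congrArg (· ≫ _)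
      (eval_eqToHom_node (List.append_assoc s s' s'') (merge_assoc l l' l'')
        (merge_assoc r r' r'') _).symm)

end Braided
end Strictification
end DDB

namespace DDB
namespace Strictification

open MonoidalCategory

variable {B : Type u} [Category.{v} B] [MonoidalCategory B]

/-! #### The vertical structure -/

/-- The morphism of formal composites given by a morphism of values. -/
def homMk {x y : Strictification B} (f : (eval B).obj x ⟶ (eval B).obj y) : x ⟶ y := f

theorem eval_homMk {x y : Strictification B} (f : (eval B).obj x ⟶ (eval B).obj y) :
    (eval B).map (homMk f) = f := rfl

/-- The isomorphism of formal composites given by an isomorphism of values. -/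
def isoMk {x y : Strictification B} (e : (eval B).obj x ≅ (eval B).obj y) : x ≅ y where
  hom := homMk e.hom
  inv := homMk e.inv
  hom_inv_id := e.hom_inv_id
  inv_hom_id := e.inv_hom_id

/-- The structure is transported from `B` with `stackIso` as comparison, so that its axioms follow
from faithfulness of evaluation. -/
instance : MonoidalCategoryStruct (Strictification B) where
  tensorObj := stack
  whiskerLeft x _ _ f := homMk
    ((stackIso _ _).hom ≫ (eval B).obj x ◁ (eval B).map f ≫ (stackIso _ _).inv)
  whiskerRight f y := homMk
    ((stackIso _ _).hom ≫ (eval B).map f ▷ (eval B).obj y ≫ (stackIso _ _).inv)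
  tensorHom f g := homMk
    ((stackIso _ _).hom ≫ ((eval B).map f ⊗ₘ (eval B).map g) ≫ (stackIso _ _).inv)
  tensorUnit := nil
  associator x y z := isoMk (stackIso (stack x y) z ≪≫
    whiskerRightIso (stackIso x y) _ ≪≫ α_ _ _ _ ≪≫ whiskerLeftIso _ (stackIso y z).symm ≪≫
      (stackIso x (stack y z)).symm)
  leftUnitor x := isoMk (stackIso nil x ≪≫ λ_ ((eval B).obj x))
  rightUnitor x := isoMk (stackIso x nil ≪≫ ρ_ ((eval B).obj x))

theorem comp_eq_comp_id_tensorHom_id {x a b y : B} (f : x ⟶ a ⊗ b) (g : a ⊗ b ⟶ y) :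
    f ≫ g = (f ≫ (𝟙 a ⊗ₘ 𝟙 b)) ≫ g := by
  rw [id_tensorHom_id, Category.comp_id]

variable (B) in
/-- The data that make the evaluation monoidal. -/
def inducingData : Monoidal.InducingFunctorData (eval B) where
  μIso x y := (stackIso x y).symm
  whiskerLeft_eq _ _ _ _ := rfl
  whiskerRight_eq _ _ := rfl
  tensorHom_eq _ _ := rfl
  εIso := Iso.refl _
  associator_eq x y z := by
    change (stackIso (stack x y) z).hom ≫ (stackIso x y).hom ▷ _ ≫ (α_ _ _ _).hom ≫
      _ ◁ (stackIso y z).inv ≫ (stackIso x (stack y z)).inv = ((stackIso (stack x y) z).hom ≫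
        ((stackIso x y).hom ⊗ₘ 𝟙 _)) ≫ (α_ _ _ _).hom ≫ (𝟙 _ ⊗ₘ (stackIso y z).inv) ≫
          (stackIso x (stack y z)).inv
    rw [tensorHom_id, id_tensorHom, Category.assoc]
  leftUnitor_eq _ := comp_eq_comp_id_tensorHom_id _ _
  rightUnitor_eq _ := comp_eq_comp_id_tensorHom_id _ _

instance : MonoidalCategory (Strictification B) := Monoidal.induced (eval B) (inducingData B)

instance : (eval B).Monoidal := Monoidal.fromInducedMonoidal (eval B) (inducingData B)

/-- The comparison of the value of a vertical composite with the tensor product of the values. -/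
def tensorIso (x y : Strictification B) : (eval B).obj (x ⊗ y) ≅ (eval B).obj x ⊗ (eval B).obj y :=
  stackIso x y

theorem μ_eval (x y : Strictification B) :
    Functor.LaxMonoidal.μ (eval B) x y = (tensorIso x y).inv := rfl

theorem eval_tensorHom {x x' y y' : Strictification B} (f : x ⟶ x') (g : y ⟶ y') :
    (eval B).map (f ⊗ₘ g) ≫ (tensorIso x' y').hom =
      (tensorIso x y).hom ≫ ((eval B).map f ⊗ₘ (eval B).map g) :=
  (Category.assoc _ _ _).trans (congrArg (_ ≫ ·) ((Category.assoc _ _ _).trans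
    ((congrArg (_ ≫ ·) (Iso.inv_hom_id _)).trans (Category.comp_id _))))

theorem eval_associator (x y z : Strictification B) :
    (eval B).map (α_ x y z).hom ≫ (tensorIso x (y ⊗ z)).hom ≫ _ ◁ (tensorIso y z).hom =
      ((tensorIso (x ⊗ y) z).hom ≫ (tensorIso x y).hom ▷ _) ≫ (α_ _ _ _).hom := by
  have h : (eval B).map (α_ x y z).hom = (tensorIso (x ⊗ y) z).hom ≫ (tensorIso x y).hom ▷ _ ≫
      (α_ _ _ _).hom ≫ _ ◁ (tensorIso y z).inv ≫ (tensorIso x (y ⊗ z)).inv := rfl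
  rw [h]
  simp

/-! #### Interchange -/

variable [BraidedCategory B]

theorem tensorμ_unit_unit_leftUnitor {a b c d x y : B} (m : x ⟶ a ⊗ b) (m' : y ⟶ c ⊗ d) :
    (((λ_ (𝟙_ B)).inv ⊗ₘ ((m ⊗ₘ m') ≫ tensorμ a b c d)) ≫ tensorμ (𝟙_ B) (𝟙_ B) _ _) ≫
      ((λ_ (a ⊗ c)).hom ⊗ₘ (λ_ (b ⊗ d)).hom) =
    𝟙 _ ≫ (λ_ (x ⊗ y)).hom ≫ (m ⊗ₘ m') ≫ tensorμ a b c d := by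
  rw [MonoidalCategory.tensorHom_def', Category.assoc, Category.assoc, ← tensor_left_unitality,
    leftUnitor_naturality, Category.id_comp]

theorem leftUnitor_inv_comp_tensorμ {x a b : B} (w : x ⟶ a ⊗ b) :
    (λ_ x).inv ≫ ((λ_ (𝟙_ B)).inv ⊗ₘ w) =
      𝟙 _ ≫ w ≫ ((λ_ a).inv ⊗ₘ (λ_ b).inv) ≫ tensorμ (𝟙_ B) a (𝟙_ B) b := by
  have h : ((λ_ a).inv ⊗ₘ (λ_ b).inv) ≫ tensorμ (𝟙_ B) a (𝟙_ B) b =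
      (λ_ (a ⊗ b)).inv ≫ (λ_ (𝟙_ B)).inv ▷ (a ⊗ b) := by
    rw [← cancel_mono ((λ_ (𝟙_ B)).hom ▷ (a ⊗ b) ≫ (λ_ (a ⊗ b)).hom), Category.assoc,
      ← leftUnitor_monoidal, tensorHom_comp_tensorHom]
    simp
  rw [h, Category.id_comp, leftUnitor_inv_naturality_assoc, MonoidalCategory.tensorHom_def']

/-- The maps `m`, `m'` are components of `mergeIso _ nil`, which is defined by a left unitor at
`nil` and a right unitor at a node. The hypotheses allow both forms. -/
theorem rightUnitor_inv_comp_tensorμ {x a b : B} (w : x ⟶ a ⊗ b) {m : a ⟶ a ⊗ 𝟙_ B}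
    {m' : b ⟶ b ⊗ 𝟙_ B} (hm : m = (ρ_ a).inv) (hm' : m' = (ρ_ b).inv) :
    (ρ_ x).inv ≫ (w ⊗ₘ (λ_ (𝟙_ B)).inv) = 𝟙 _ ≫ w ≫ (m ⊗ₘ m') ≫ tensorμ a (𝟙_ B) b (𝟙_ B) := by
  have h : ((ρ_ a).inv ⊗ₘ (ρ_ b).inv) ≫ tensorμ a (𝟙_ B) b (𝟙_ B) =
      (ρ_ (a ⊗ b)).inv ≫ (a ⊗ b) ◁ (λ_ (𝟙_ B)).inv := by
    rw [← cancel_mono ((a ⊗ b) ◁ (λ_ (𝟙_ B)).hom ≫ (ρ_ (a ⊗ b)).hom), Category.assoc,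
      ← rightUnitor_monoidal, tensorHom_comp_tensorHom]
    simp
  rw [hm, hm', h, Category.id_comp, rightUnitor_inv_naturality_assoc,
    MonoidalCategory.tensorHom_def]

/-- Strict interchange of formal composites lies over `tensorμ`. Only three situations differ: the
first stack is empty, the second is empty, or neither is; in the last one both lists are empty and
`tensor_left_unitality` removes the outer `tensorμ`. -/
theorem stackIso_interchange : ∀ a c b d : Strictification B,
    (mergeIso (stack a c) (stack b d)).hom ≫ ((stackIso a c).hom ⊗ₘ (stackIso b d).hom) =
      (eval B).map (eqToHom (merge_stack a c b d)) ≫ (stackIso (merge a b) (merge c d)).hom ≫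
        ((mergeIso a b).hom ⊗ₘ (mergeIso c d).hom) ≫ tensorμ _ _ _ _
  | nil, nil, _, _ => leftUnitor_inv_comp_tensorμ _
  | nil, node _ _ _, nil, nil => rightUnitor_inv_comp_tensorμ _ unitors_inv_equal rfl
  | node _ _ _, nil, nil, nil => rightUnitor_inv_comp_tensorμ _ rfl unitors_inv_equal
  | node _ _ _, node _ _ _, nil, nil => rightUnitor_inv_comp_tensorμ _ rfl rfl
  | nil, node _ _ _, nil, node _ _ _ => tensorμ_unit_unit_leftUnitor _ _
  | node _ _ _, nil, nil, node _ _ _ => tensorμ_unit_unit_leftUnitor _ _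
  | node _ _ _, node _ _ _, nil, node _ _ _ => tensorμ_unit_unit_leftUnitor _ _
  | nil, node _ _ _, node _ _ _, nil => tensorμ_unit_unit_leftUnitor _ _
  | node _ _ _, nil, node _ _ _, nil => tensorμ_unit_unit_leftUnitor _ _
  | node _ _ _, node _ _ _, node _ _ _, nil => tensorμ_unit_unit_leftUnitor _ _
  | nil, node _ _ _, node _ _ _, node _ _ _ => tensorμ_unit_unit_leftUnitor _ _
  | node _ _ _, nil, node _ _ _, node _ _ _ => tensorμ_unit_unit_leftUnitor _ _
  | node _ _ _, node _ _ _, node _ _ _, node _ _ _ => tensorμ_unit_unit_leftUnitor _ _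

end Strictification
end DDB

/-! ### Horizontal composition of morphisms in the strictification -/

namespace DDB
namespace Strictification

open MonoidalCategory

variable {B : Type u} [Category.{v} B] [MonoidalCategory B]

theorem merge_tensor (a c b d : Strictification B) :
    merge (a ⊗ c) (b ⊗ d) = merge a b ⊗ merge c d := merge_stack a c b d

theorem eval_eqToHom_tensor {x x' y y' : Strictification B} (hx : x = x') (hy : y = y') :
    (tensorIso x y).hom ≫ ((eval B).map (eqToHom hx) ⊗ₘ (eval B).map (eqToHom hy)) =
      (eval B).map (eqToHom (congrArg₂ (fun x y => x ⊗ y) hx hy)) ≫ (tensorIso x' y').hom := by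
  rw [← eval_tensorHom]
  subst hx hy
  rw [eqToHom_refl, eqToHom_refl, id_tensorHom_id]
  rfl

theorem leftUnitors_square {w x y a b : B} (m : w ⟶ x ⊗ y) (f : x ⟶ 𝟙_ B ⊗ a)
    (g : y ⟶ 𝟙_ B ⊗ b) : m ≫ ((f ≫ (λ_ a).hom) ⊗ₘ (g ≫ (λ_ b).hom)) =
      (m ≫ (f ⊗ₘ g)) ≫ ((λ_ a).hom ⊗ₘ (λ_ b).hom) := by
  rw [Category.assoc, tensorHom_comp_tensorHom]

theorem rightUnitors_square {w x y a b : B} (m : w ⟶ x ⊗ y) (f : x ⟶ a ⊗ 𝟙_ B)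
    (g : y ⟶ b ⊗ 𝟙_ B) : m ≫ ((f ≫ (ρ_ a).hom) ⊗ₘ (g ≫ (ρ_ b).hom)) =
      (m ≫ (f ⊗ₘ g)) ≫ ((ρ_ a).hom ⊗ₘ (ρ_ b).hom) := by
  rw [Category.assoc, tensorHom_comp_tensorHom]

variable [BraidedCategory B]

/-- Horizontal composition of morphisms of formal composites. -/
def mergeHom {a a' b b' : Strictification B} (f : a ⟶ a') (g : b ⟶ b') : merge a b ⟶ merge a' b' :=
  homMk ((mergeIso a b).hom ≫ ((eval B).map f ⊗ₘ (eval B).map g) ≫ (mergeIso a' b').inv)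

theorem eval_mergeHom {a a' b b' : Strictification B} (f : a ⟶ a') (g : b ⟶ b') :
    (eval B).map (mergeHom f g) ≫ (mergeIso a' b').hom =
      (mergeIso a b).hom ≫ ((eval B).map f ⊗ₘ (eval B).map g) := by
  rw [mergeHom, eval_homMk, Category.assoc, Category.assoc, Iso.inv_hom_id, Category.comp_id]

theorem tensorIso_interchange (a c b d : Strictification B) :
    (mergeIso (a ⊗ c) (b ⊗ d)).hom ≫ ((tensorIso a c).hom ⊗ₘ (tensorIso b d).hom) =
      (eval B).map (eqToHom (merge_tensor a c b d)) ≫ (tensorIso (merge a b) (merge c d)).hom ≫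
        ((mergeIso a b).hom ⊗ₘ (mergeIso c d).hom) ≫ tensorμ _ _ _ _ :=
  stackIso_interchange a c b d

theorem mergeHom_id (a b : Strictification B) : mergeHom (𝟙 a) (𝟙 b) = 𝟙 (merge a b) := by
  apply (eval B).map_injective
  rw [← cancel_mono (mergeIso a b).hom, eval_mergeHom, CategoryTheory.Functor.map_id,
    CategoryTheory.Functor.map_id, CategoryTheory.Functor.map_id, id_tensorHom_id,
    Category.id_comp, Category.comp_id]

theorem mergeHom_comp {a a' a'' b b' b'' : Strictification B} (f : a ⟶ a') (f' : a' ⟶ a'')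
    (g : b ⟶ b') (g' : b' ⟶ b'') :
    mergeHom (f ≫ f') (g ≫ g') = mergeHom f g ≫ mergeHom f' g' := by
  apply (eval B).map_injective
  rw [← cancel_mono (mergeIso a'' b'').hom, eval_mergeHom, Functor.map_comp, Functor.map_comp,
    Functor.map_comp, Category.assoc, eval_mergeHom, ← Category.assoc, eval_mergeHom,
    Category.assoc, tensorHom_comp_tensorHom]

theorem mergeHom_assoc {a a' b b' c c' : Strictification B} (f : a ⟶ a') (g : b ⟶ b')
    (k : c ⟶ c') : mergeHom (mergeHom f g) k ≍ mergeHom f (mergeHom g k) := by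
  have hm : ∀ x y z : Strictification B, (mergeIso (merge x y) z).hom ≫ (mergeIso x y).hom ▷ _ =
      (eval B).map (eqToHom (merge_assoc x y z)) ≫ (mergeIso x (merge y z)).hom ≫
        (eval B).obj x ◁ (mergeIso y z).hom ≫ (α_ _ _ _).inv := fun x y z => by
    rw [← cancel_mono (α_ _ _ _).hom, Category.assoc, mergeIso_assoc]
    simp
  refine heq_of_squares (merge_assoc _ _ _) (merge_assoc _ _ _)
    (((eval B).map f ⊗ₘ (eval B).map g) ⊗ₘ (eval B).map k) (hm _ _ _) (hm _ _ _) ?_ ?_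
  · rw [← Category.assoc, eval_mergeHom, Category.assoc, ← tensorHom_id,
      tensorHom_comp_tensorHom, eval_mergeHom, ← tensorHom_id, Category.assoc,
      tensorHom_comp_tensorHom, Category.comp_id, Category.id_comp]
  · rw [← Category.assoc, eval_mergeHom, Category.assoc, Category.assoc, ← id_tensorHom,
      tensorHom_comp_tensorHom_assoc, eval_mergeHom, ← id_tensorHom, Category.assoc,
      ← associator_inv_naturality, tensorHom_comp_tensorHom_assoc, Category.id_comp,
      Category.comp_id]

theorem unit_mergeHom {a a' : Strictification B} (f : a ⟶ a') :
    mergeHom (𝟙 (𝟙_ (Strictification B))) f ≍ f := by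
  refine heq_of_squares (x := a) (y := a') rfl rfl (p := (λ_ _).inv)
    (q := (λ_ _).inv) (p' := (λ_ _).inv) (q' := (λ_ _).inv)
    (𝟙 (𝟙_ B) ⊗ₘ (eval B).map f) ?_ ?_ (eval_mergeHom (𝟙 nil) f) ?_
  · exact (Category.id_comp _).symm
  · exact (Category.id_comp _).symm
  · rw [leftUnitor_inv_naturality, id_tensorHom]

theorem mergeHom_unit {a a' : Strictification B} (f : a ⟶ a') :
    mergeHom f (𝟙 (𝟙_ (Strictification B))) ≍ f := by
  have h := eval_mergeHom f (𝟙 nil)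
  rw [mergeIso_nil, mergeIso_nil] at h
  exact heq_of_squares (merge_nil a) (merge_nil a')
    (q := (eval B).map (eqToHom (merge_nil a')) ≫ (ρ_ ((eval B).obj a')).inv)
    ((eval B).map f ⊗ₘ 𝟙 (𝟙_ B)) rfl rfl h
    ((rightUnitor_inv_naturality _).trans (congrArg (_ ≫ ·) (tensorHom_id _ _).symm))

/-- Evaluated in `B`, this is naturality of `tensorμ`. -/
theorem mergeHom_tensorHom {a a' b b' c c' d d' : Strictification B}
    (f : a ⟶ a') (g : b ⟶ b') (k : c ⟶ c') (l : d ⟶ d') :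
    mergeHom (f ⊗ₘ k) (g ⊗ₘ l) ≍ mergeHom f g ⊗ₘ mergeHom k l := by
  refine heq_of_squares (merge_stack _ _ _ _) (merge_stack _ _ _ _)
    (((eval B).map f ⊗ₘ (eval B).map k) ⊗ₘ ((eval B).map g ⊗ₘ (eval B).map l))
    (tensorIso_interchange a c b d) (tensorIso_interchange a' c' b' d') ?_ ?_
  · rw [← Category.assoc, eval_mergeHom, Category.assoc, tensorHom_comp_tensorHom,
      eval_tensorHom, eval_tensorHom, Category.assoc, tensorHom_comp_tensorHom]
  · rw [← Category.assoc, eval_tensorHom, Category.assoc, tensorHom_comp_tensorHom_assoc,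
      eval_mergeHom, eval_mergeHom, Category.assoc, Category.assoc, ← tensorμ_natural,
      tensorHom_comp_tensorHom_assoc]

/-- Two uses of `tensorIso_interchange` identify the comparison maps on the sources of the two sides
of `mergeHom_associator`; `associator_square_right` does the same for the targets. -/
theorem associator_square_left (a a' b b' c c' : Strictification B)
    (e : merge ((a ⊗ b) ⊗ c) ((a' ⊗ b') ⊗ c') = (merge a a' ⊗ merge b b') ⊗ merge c c') :
    (mergeIso ((a ⊗ b) ⊗ c) ((a' ⊗ b') ⊗ c')).hom ≫
      (((tensorIso (a ⊗ b) c).hom ≫ (tensorIso a b).hom ▷ _) ⊗ₘ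
        ((tensorIso (a' ⊗ b') c').hom ≫ (tensorIso a' b').hom ▷ _)) =
    (eval B).map (eqToHom e) ≫ (tensorIso (merge a a' ⊗ merge b b') (merge c c')).hom ≫
      (tensorIso (merge a a') (merge b b')).hom ▷ _ ≫
      ((((mergeIso a a').hom ⊗ₘ (mergeIso b b').hom) ≫ tensorμ _ _ _ _) ⊗ₘ (mergeIso c c').hom) ≫
        tensorμ _ _ _ _ := by
  have h := tensorIso_interchange a b a' b'
  have h' := eval_eqToHom_tensor (merge_tensor a b a' b') (Eq.refl (merge c c'))
  rw [eqToHom_refl, CategoryTheory.Functor.map_id, tensorHom_id] at h'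
  have hs : ∀ {x y z w t : B} (f : x ⟶ y) (g : y ⟶ z) (k : w ⟶ t),
      (f ≫ g) ⊗ₘ k = f ▷ w ≫ (g ⊗ₘ k) := fun f g k => by
    rw [← tensorHom_id, tensorHom_comp_tensorHom, Category.id_comp]
  rw [← tensorHom_comp_tensorHom, ← Category.assoc, tensorIso_interchange, Category.assoc,
    Category.assoc, Category.assoc, ← tensorHom_id, ← tensorHom_id, ← tensorμ_natural,
    tensorHom_comp_tensorHom_assoc, h, id_tensorHom_id, Category.comp_id, hs,
    Category.assoc, reassoc_of% h', ← Functor.map_comp_assoc, eqToHom_trans, hs, Category.assoc]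

theorem associator_square_right (a a' b b' c c' : Strictification B)
    (e : merge (a ⊗ (b ⊗ c)) (a' ⊗ (b' ⊗ c')) = merge a a' ⊗ (merge b b' ⊗ merge c c')) :
    (mergeIso (a ⊗ b ⊗ c) (a' ⊗ b' ⊗ c')).hom ≫
      (((tensorIso a (b ⊗ c)).hom ≫ _ ◁ (tensorIso b c).hom) ⊗ₘ
        ((tensorIso a' (b' ⊗ c')).hom ≫ _ ◁ (tensorIso b' c').hom)) =
    (eval B).map (eqToHom e) ≫ (tensorIso (merge a a') (merge b b' ⊗ merge c c')).hom ≫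
      _ ◁ (tensorIso (merge b b') (merge c c')).hom ≫
      ((mergeIso a a').hom ⊗ₘ (((mergeIso b b').hom ⊗ₘ (mergeIso c c').hom) ≫ tensorμ _ _ _ _)) ≫
        tensorμ _ _ _ _ := by
  have h := tensorIso_interchange b c b' c'
  have h' := eval_eqToHom_tensor (Eq.refl (merge a a')) (merge_tensor b c b' c')
  rw [eqToHom_refl, CategoryTheory.Functor.map_id, id_tensorHom] at h'
  have hs : ∀ {x y z w t : B} (k : w ⟶ t) (f : x ⟶ y) (g : y ⟶ z),
      k ⊗ₘ (f ≫ g) = w ◁ f ≫ (k ⊗ₘ g) := fun f g k => by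
    rw [← id_tensorHom, tensorHom_comp_tensorHom, Category.id_comp]
  rw [← tensorHom_comp_tensorHom, ← Category.assoc, tensorIso_interchange, Category.assoc,
    Category.assoc, Category.assoc, ← id_tensorHom, ← id_tensorHom, ← tensorμ_natural,
    tensorHom_comp_tensorHom_assoc, h, id_tensorHom_id, Category.comp_id, hs,
    Category.assoc, reassoc_of% h', ← Functor.map_comp_assoc, eqToHom_trans, hs, Category.assoc]

/-- The coherence equation left over in `B` is `tensor_associativity`. The unitors below reduce
likewise to `tensor_left_unitality` and `tensor_right_unitality`. -/
theorem mergeHom_associator (a a' b b' c c' : Strictification B) :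
    mergeHom (α_ a b c).hom (α_ a' b' c').hom ≍ (α_ (merge a a') (merge b b') (merge c c')).hom := by
  have e₁ : merge ((a ⊗ b) ⊗ c) ((a' ⊗ b') ⊗ c') = (merge a a' ⊗ merge b b') ⊗ merge c c' := by
    rw [merge_tensor, merge_tensor]
  have e₂ : merge (a ⊗ (b ⊗ c)) (a' ⊗ (b' ⊗ c')) = merge a a' ⊗ (merge b b' ⊗ merge c c') := by
    rw [merge_tensor, merge_tensor]
  refine heq_of_squares e₁ e₂
    ((α_ _ _ _).hom ⊗ₘ (α_ _ _ _).hom) (associator_square_left a a' b b' c c' e₁)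
    (associator_square_right a a' b b' c c' e₂) ?_ ?_
  · rw [← Category.assoc, eval_mergeHom, Category.assoc, Category.assoc, tensorHom_comp_tensorHom,
      tensorHom_comp_tensorHom, eval_associator, eval_associator]
  · have h := eval_associator (merge a a') (merge b b') (merge c c')
    rw [reassoc_of% h]
    have h₁ : ∀ {x y z x' y' z' w : B} (f : x ⟶ x') (g : y ⟶ y') (k : z ⟶ z') (l : y' ⊗ z' ⟶ w),
        (α_ _ _ _).hom ≫ (f ⊗ₘ ((g ⊗ₘ k) ≫ l)) = ((f ⊗ₘ g) ⊗ₘ k) ≫ (α_ _ _ _).hom ≫ x' ◁ l :=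
      fun f g k l => by
        rw [associator_naturality_assoc, ← id_tensorHom, tensorHom_comp_tensorHom,
          Category.comp_id]
    have h₂ : ∀ {x y z x' : B} {w : B} (f : x ⟶ y) (g : y ⟶ z) (k : x' ⟶ w),
        (f ≫ g) ⊗ₘ k = (f ⊗ₘ k) ≫ g ▷ w := fun f g k => by
      rw [← tensorHom_id, tensorHom_comp_tensorHom, Category.comp_id]
    rw [reassoc_of% h₁, h₂, Category.assoc, Category.assoc, Category.assoc, Category.assoc,
      tensor_associativity]

theorem leftUnitors_square' {w x a b : B} (f : w ⟶ 𝟙_ B ⊗ x) (m : x ⟶ a ⊗ b) :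
    (f ≫ (λ_ x).hom) ≫ m = (f ≫ ((λ_ (𝟙_ B)).inv ⊗ₘ m) ≫ tensorμ (𝟙_ B) (𝟙_ B) a b) ≫
      ((λ_ a).hom ⊗ₘ (λ_ b).hom) := by
  rw [MonoidalCategory.tensorHom_def', Category.assoc, Category.assoc, Category.assoc,
    Category.assoc, ← tensor_left_unitality, leftUnitor_naturality]

theorem rightUnitors_square' {w x a b : B} (f : w ⟶ x ⊗ 𝟙_ B) (m : x ⟶ a ⊗ b) :
    (f ≫ (ρ_ x).hom) ≫ m = (f ≫ (m ⊗ₘ (λ_ (𝟙_ B)).inv) ≫ tensorμ a b (𝟙_ B) (𝟙_ B)) ≫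
      ((ρ_ a).hom ⊗ₘ (ρ_ b).hom) := by
  rw [MonoidalCategory.tensorHom_def, Category.assoc, Category.assoc, Category.assoc,
    Category.assoc, ← tensor_right_unitality, rightUnitor_naturality]

theorem mergeHom_leftUnitor (a a' : Strictification B) :
    mergeHom (λ_ a).hom (λ_ a').hom ≍ (λ_ (merge a a')).hom := by
  refine heq_of_squares (merge_stack nil a nil a') rfl
    (p := (mergeIso (stack nil a) (stack nil a')).hom ≫
      ((stackIso nil a).hom ⊗ₘ (stackIso nil a').hom)) (q' := (mergeIso a a').hom)
    ((λ_ _).hom ⊗ₘ (λ_ _).hom) (tensorIso_interchange (𝟙_ _) a (𝟙_ _) a')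
    (Category.id_comp _).symm ((eval_mergeHom _ _).trans (leftUnitors_square _ _ _)) ?_
  exact leftUnitors_square' _ _

theorem mergeHom_rightUnitor (a a' : Strictification B) :
    mergeHom (ρ_ a).hom (ρ_ a').hom ≍ (ρ_ (merge a a')).hom := by
  refine heq_of_squares (merge_stack a nil a' nil) rfl
    (p := (mergeIso (stack a nil) (stack a' nil)).hom ≫
      ((stackIso a nil).hom ⊗ₘ (stackIso a' nil).hom)) (q' := (mergeIso a a').hom)
    ((ρ_ _).hom ⊗ₘ (ρ_ _).hom) (tensorIso_interchange a (𝟙_ _) a' (𝟙_ _))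
    (Category.id_comp _).symm ((eval_mergeHom _ _).trans (rightUnitors_square _ _ _)) ?_
  exact rightUnitors_square' _ _

instance : HorizontalStructure (Strictification B) where
  hObj := merge
  hHom := mergeHom
  hHom_id := mergeHom_id
  hHom_comp := mergeHom_comp
  hObj_assoc := merge_assoc
  hHom_assoc := mergeHom_assoc
  unit_hObj _ := rfl
  unit_hHom := unit_mergeHom
  hObj_unit := merge_nil
  hHom_unit := mergeHom_unit
  interchange_obj a b c d := merge_stack a c b d
  interchange_hom := mergeHom_tensorHom
  hHom_associator := mergeHom_associator
  hHom_leftUnitor := mergeHom_leftUnitor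
  hHom_rightUnitor := mergeHom_rightUnitor
  unit_tensor_unit := rfl
  associator_unit := heq_of_eq (show (λ_ (𝟙_ B)).inv ≫ (λ_ (𝟙_ B)).inv ▷ 𝟙_ B ≫ (α_ _ _ _).hom ≫
    𝟙_ B ◁ (λ_ (𝟙_ B)).hom ≫ (λ_ (𝟙_ B)).hom = 𝟙 (𝟙_ B) by monoidal)
  leftUnitor_unit := heq_of_eq ((λ_ (𝟙_ B)).inv_hom_id)
  rightUnitor_unit := heq_of_eq (show (λ_ (𝟙_ B)).inv ≫ (ρ_ (𝟙_ B)).hom = 𝟙 (𝟙_ B) by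
    rw [← unitors_equal, Iso.inv_hom_id])

end Strictification
end DDB

namespace DDB

open MonoidalCategory

/-! #### The evaluation is a braided equivalence -/

namespace Strictification

variable {B : Type u} [Category.{v} B] [MonoidalCategory B] [BraidedCategory B]

theorem tensorμ_unit_braiding (a b : B) :
    tensorμ (𝟙_ B) a b (𝟙_ B) ≫ ((λ_ b).hom ⊗ₘ (ρ_ a).hom) =
      ((λ_ a).hom ⊗ₘ (ρ_ b).hom) ≫ (β_ a b).hom := by
  -- The braiding is padded with units to the shape in which it occurs in `tensorμ (𝟙_ B) a b (𝟙_
  -- B)`.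
  have h : (β_ a b).hom = (λ_ (a ⊗ b)).inv ≫ 𝟙_ B ◁ (ρ_ (a ⊗ b)).inv ≫
      𝟙_ B ◁ (β_ a b).hom ▷ 𝟙_ B ≫ 𝟙_ B ◁ (ρ_ (b ⊗ a)).hom ≫ (λ_ (b ⊗ a)).hom := by
    simp
  rw [h, tensorμ]
  monoidal

theorem tensorμ_braiding_unit (a b : B) :
    tensorμ a (𝟙_ B) (𝟙_ B) b ≫ ((ρ_ a).hom ⊗ₘ (λ_ b).hom) =
      (ρ_ a).hom ⊗ₘ (λ_ b).hom := by
  have h : (β_ (𝟙_ B) (𝟙_ B)).hom = 𝟙 _ := by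
    rw [braiding_tensorUnit_left, unitors_equal, Iso.hom_inv_id]
  rw [tensorμ, h]
  monoidal

theorem interchange_braiding {w w' x y y' t a b : B} {m : w ⟶ x ⊗ y} {f : x ⟶ 𝟙_ B ⊗ b}
    {g : y ⟶ a ⊗ 𝟙_ B} {e : w ⟶ w'} {t' : w' ⟶ a ⊗ y'} {k : y' ⟶ b ⊗ 𝟙_ B} {e' : y' ⟶ b}
    {e'' : w' ⟶ t} {n : t ⟶ a ⊗ b}
    (h : m ≫ (f ⊗ₘ g) = e ≫ t' ≫ ((λ_ a).inv ⊗ₘ k) ≫ tensorμ (𝟙_ B) a b (𝟙_ B))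
    (hk : k = e' ≫ (ρ_ b).inv) (ht : t' ≫ (𝟙 a ⊗ₘ e') = e'' ≫ n) :
    m ≫ ((f ≫ (λ_ b).hom) ⊗ₘ (g ≫ (ρ_ a).hom)) = (e ≫ e'') ≫ n ≫ (β_ a b).hom := by
  rw [← tensorHom_comp_tensorHom, reassoc_of% h, tensorμ_unit_braiding,
    tensorHom_comp_tensorHom_assoc, hk, Category.assoc, Iso.inv_hom_id, Iso.inv_hom_id,
    Category.comp_id, reassoc_of% ht, Category.assoc]

theorem interchange_units {w w' x y y' t a b : B} {m : w ⟶ x ⊗ y} {f : x ⟶ b ⊗ 𝟙_ B}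
    {g : y ⟶ 𝟙_ B ⊗ a} {e : w ⟶ w'} {t' : w' ⟶ y' ⊗ a} {k : y' ⟶ b ⊗ 𝟙_ B} {e' : y' ⟶ b}
    {e'' : w' ⟶ t} {n : t ⟶ b ⊗ a}
    (h : m ≫ (f ⊗ₘ g) = e ≫ t' ≫ (k ⊗ₘ (λ_ a).inv) ≫ tensorμ b (𝟙_ B) (𝟙_ B) a)
    (hk : k = e' ≫ (ρ_ b).inv) (ht : t' ≫ (e' ⊗ₘ 𝟙 a) = e'' ≫ n) :
    m ≫ ((f ≫ (ρ_ b).hom) ⊗ₘ (g ≫ (λ_ a).hom)) = (e ≫ e'') ≫ n := by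
  rw [← tensorHom_comp_tensorHom, reassoc_of% h, tensorμ_braiding_unit,
    tensorHom_comp_tensorHom, hk, Category.assoc, Iso.inv_hom_id, Iso.inv_hom_id,
    Category.comp_id, ht, Category.assoc]

/-- The first half of the standard braiding. Its interchange involves `tensorμ` with outer units,
which leaves the braiding of `B`. -/
theorem eval_mergeHom_unitors (a b : Strictification B)
    (e : merge (𝟙_ _ ⊗ b) (a ⊗ 𝟙_ _) = a ⊗ b) :
    (eval B).map (mergeHom (λ_ b).hom (ρ_ a).hom) ≫ (mergeIso b a).hom =
      (eval B).map (eqToHom e) ≫ (tensorIso a b).hom ≫ (β_ _ _).hom := by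
  have ht := eval_eqToHom_tensor (Eq.refl a) (merge_nil b)
  rw [eqToHom_refl, CategoryTheory.Functor.map_id] at ht
  have h := interchange_braiding (tensorIso_interchange (𝟙_ _) b a (𝟙_ _)) (mergeIso_nil b) ht
  exact ((eval_mergeHom _ _).trans h).trans (congrArg (· ≫ _)
    (((eval B).map_comp _ _).symm.trans (congrArg (eval B).map (eqToHom_trans _ _))))

/-- The second half, inverted. Its interchange involves `tensorμ` with inner units, so only the
trivial braiding of the unit with itself occurs. -/
theorem eval_mergeHom_unitors' (a b : Strictification B)
    (e : merge (b ⊗ 𝟙_ _) (𝟙_ _ ⊗ a) = b ⊗ a) :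
    (eval B).map (mergeHom (ρ_ b).hom (λ_ a).hom) ≫ (mergeIso b a).hom =
      (eval B).map (eqToHom e) ≫ (tensorIso b a).hom := by
  have ht := eval_eqToHom_tensor (merge_nil b) (Eq.refl a)
  rw [eqToHom_refl, CategoryTheory.Functor.map_id] at ht
  have h := interchange_units (tensorIso_interchange b (𝟙_ _) (𝟙_ _) a) (mergeIso_nil b) ht
  exact ((eval_mergeHom _ _).trans h).trans (congrArg (· ≫ _)
    (((eval B).map_comp _ _).symm.trans (congrArg (eval B).map (eqToHom_trans _ _))))

theorem eval_braiding (a b : Strictification B) :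
    (eval B).map (β_ a b).hom ≫ (tensorIso b a).hom = (tensorIso a b).hom ≫ (β_ _ _).hom := by
  have e₁ : merge (𝟙_ _ ⊗ b) (a ⊗ 𝟙_ _) = a ⊗ b := by
    rw [merge_tensor]
    exact congrArg (a ⊗ ·) (merge_nil b)
  have e₂ : merge (b ⊗ 𝟙_ _) (𝟙_ _ ⊗ a) = b ⊗ a := by
    rw [merge_tensor]
    exact congrArg (· ⊗ a) (merge_nil b)
  have hβ : (β_ a b).hom = eqToHom e₁.symm ≫ mergeHom (λ_ b).hom (ρ_ a).hom ≫
    mergeHom (ρ_ b).inv (λ_ a).inv ≫ eqToHom e₂ := rfl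
  have h₁ := eval_mergeHom_unitors a b e₁
  have h₂ := eval_mergeHom_unitors' a b e₂
  have h₃ : (eval B).map (mergeHom (ρ_ b).inv (λ_ a).inv) ≫
      (eval B).map (mergeHom (ρ_ b).hom (λ_ a).hom) = 𝟙 _ := by
    rw [← Functor.map_comp, ← mergeHom_comp, Iso.inv_hom_id, Iso.inv_hom_id, mergeHom_id,
      CategoryTheory.Functor.map_id]
  rw [hβ, Functor.map_comp, Functor.map_comp, Functor.map_comp, Category.assoc, Category.assoc,
    Category.assoc, ← h₂, reassoc_of% h₃, h₁, ← Functor.map_comp_assoc, eqToHom_trans, eqToHom_refl,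
    CategoryTheory.Functor.map_id, Category.id_comp]

instance : (eval B).Braided where
  braided a b := by
    rw [μ_eval, μ_eval, Iso.inv_comp_eq, ← Category.assoc, ← eval_braiding, Category.assoc,
      Iso.hom_inv_id, Category.comp_id]

instance : (eval B).EssSurj where
  -- The value of this node is `(b ⊗ 𝟙_ B) ⊗ (𝟙_ B ⊗ 𝟙_ B)`.
  mem_essImage b := ⟨node [b] nil nil,
    ⟨(ρ_ b ⊗ᵢ λ_ (𝟙_ B)) ≪≫ ρ_ b⟩⟩

instance : (eval B).IsEquivalence where

end Strictification

/-! ### Inverses of braided equivalences -/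

section Inverse

variable {C : Type u} [Category.{v} C] [MonoidalCategory C]
variable {D : Type u'} [Category.{v'} D] [MonoidalCategory D]

theorem inverseMonoidal_isMonoidal (e : C ≌ D) [e.functor.Monoidal] :
    letI := e.inverseMonoidal
    e.toAdjunction.IsMonoidal := by
  let := e.toAdjunction.rightAdjointLaxMonoidal
  exact (inferInstance : e.toAdjunction.IsMonoidal)

variable [BraidedCategory C] [BraidedCategory D]


/-- Passing to mates reduces the claim to braidedness of `F` and naturality of the braiding at the
counit. -/
theorem rightAdjoint_braided {F : C ⥤ D} {G : D ⥤ C} (adj : F ⊣ G) [F.Braided] [G.Monoidal]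
    [adj.IsMonoidal] (x y : D) :
    Functor.LaxMonoidal.μ G x y ≫ G.map (β_ x y).hom =
      (β_ (G.obj x) (G.obj y)).hom ≫ Functor.LaxMonoidal.μ G y x := by
  have h₁ := adj.map_μ_comp_counit_app_tensor x y
  have h₂ := adj.map_μ_comp_counit_app_tensor y x
  apply (adj.homEquiv _ _).symm.injective
  rw [Adjunction.homEquiv_counit, Adjunction.homEquiv_counit, Functor.map_comp, Functor.map_comp,
    Category.assoc, Category.assoc, h₂, Adjunction.counit_naturality, reassoc_of% h₁,
    Functor.map_braiding, Category.assoc, Category.assoc, Functor.Monoidal.μ_δ_assoc,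
    ← BraidedCategory.braiding_naturality]
  rfl

/-- The inverse of a braided equivalence is braided. -/
@[reducible]
noncomputable def inverseBraided (e : C ≌ D) [e.functor.Braided] : e.inverse.Braided :=
  letI := e.inverseMonoidal
  { braided := fun x y =>
      haveI := inverseMonoidal_isMonoidal e
      rightAdjoint_braided e.toAdjunction x y }

end Inverse

namespace Strictification

variable (B : Type u) [Category.{v} B] [MonoidalCategory B]

/-- The evaluation as an equivalence of categories. -/
noncomputable def equivalence : Strictification B ≌ B := (eval B).asEquivalence

/-- The inverse of the evaluation. -/
noncomputable def toFormal : B ⥤ Strictification B := (equivalence B).inverse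

/-- The counit of the equivalence given by the evaluation. -/
noncomputable def counitIso : toFormal B ⋙ eval B ≅ 𝟭 B := (equivalence B).counitIso

/-- The unit of the equivalence given by the evaluation. -/
noncomputable def unitIso : 𝟭 (Strictification B) ≅ eval B ⋙ toFormal B := (equivalence B).unitIso

theorem eval_unitIso (x : Strictification B) :
    (eval B).map ((unitIso B).hom.app x) ≫ (counitIso B).hom.app ((eval B).obj x) = 𝟙 _ :=
  (equivalence B).functor_unit_comp x

theorem toFormal_counitIso (b : B) :
    (unitIso B).hom.app ((toFormal B).obj b) ≫ (toFormal B).map ((counitIso B).hom.app b) = 𝟙 _ :=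
  (equivalence B).unit_inverse_comp b

variable [BraidedCategory B]

noncomputable instance : (equivalence B).functor.Braided := inferInstanceAs (eval B).Braided

noncomputable instance : (equivalence B).inverse.Braided := inverseBraided (equivalence B)

instance : (equivalence B).IsMonoidal := inverseMonoidal_isMonoidal (equivalence B)

noncomputable instance : (toFormal B).Braided := inferInstanceAs (equivalence B).inverse.Braided

instance : NatTrans.IsMonoidal (counitIso B).hom :=
  inferInstanceAs (NatTrans.IsMonoidal (equivalence B).counit)

instance : NatTrans.IsMonoidal (unitIso B).hom :=
  inferInstanceAs (NatTrans.IsMonoidal (equivalence B).unit)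

end Strictification
end DDB

/-! ### The strict 2-functor to braided monoidal categories -/

namespace DDB

open MonoidalCategory HorizontalStructure

namespace WeakMap

variable {C : Type u} [Category.{v} C] [MonoidalCategory C] [HorizontalStructure C]
variable {D : Type u'} [Category.{v'} D] [MonoidalCategory D] [HorizontalStructure D]
variable {E : Type u''} [Category.{v''} E] [MonoidalCategory E] [HorizontalStructure E]

/-- The monoidality constraints of a weak map. -/
noncomputable def coreMonoidal (F : WeakMap C D) : F.functor.CoreMonoidal where
  εIso := asIso F.unitConstraint
  μIso a b := asIso (F.verticalConstraint a b)
  μIso_hom_natural_left f c := by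
    have := F.verticalConstraint_naturality f (𝟙 c)
    rwa [CategoryTheory.Functor.map_id, tensorHom_id, tensorHom_id] at this
  μIso_hom_natural_right c f := by
    have := F.verticalConstraint_naturality (𝟙 c) f
    rwa [CategoryTheory.Functor.map_id, id_tensorHom, id_tensorHom] at this
  associativity := F.verticalConstraint_assoc
  left_unitality := F.verticalConstraint_unit_left
  right_unitality := F.verticalConstraint_unit_right

/-- The braided strong monoidal structure of the functor underlying a weak map. -/
noncomputable abbrev braided (F : WeakMap C D) : F.functor.Braided where
  toMonoidal := F.coreMonoidal.toMonoidal
  braided := F.verticalConstraint_braiding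

theorem eqToHom_comp_eqToHom_of_heq {C : Type u} [Category.{v} C] {a b c d : C} (h : a = b)
    (f : b ⟶ c) (h' : c = d) (e : a = d) (hf : f ≍ 𝟙 b) : eqToHom h ≫ f ≫ eqToHom h' = eqToHom e := by
  subst h h'
  cases e
  simpa using eq_of_heq hf

theorem id_verticalConstraint (a b : C) : (WeakMap.id C).verticalConstraint a b = 𝟙 (a ⊗ b) :=
  eqToHom_comp_eqToHom_of_heq _ _ _ rfl HEq.rfl

theorem comp_unitConstraint (F : WeakMap C D) (G : WeakMap D E) :
    (F.comp G).unitConstraint = G.unitConstraint ≫ G.functor.map F.unitConstraint := by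
  have h : (G.at_ F.functor.obj ([] : Grid C)).hom = (G.constraint []).hom :=
    eq_of_heq (G.at_heq F.functor.obj ([] : Grid C))
  exact congrArg (· ≫ G.functor.map F.unitConstraint) h

theorem comp_verticalConstraint (F : WeakMap C D) (G : WeakMap D E) (a b : C) :
    (F.comp G).verticalConstraint a b =
      G.verticalConstraint _ _ ≫ G.functor.map (F.verticalConstraint a b) := by
  have h := G.at_heq F.functor.obj [Word.tensor (.of a) (.of b)]
  apply eq_of_heq
  refine ((F.comp G).constraint_tensor_of a b).symm.trans ?_
  refine comp_heq_comp (hObj_unit _) (congrArg G.functor.obj (hObj_unit _))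
    (congrArg (fun x => G.functor.obj (F.functor.obj x)) (hObj_unit _))
    (h.trans (G.constraint_tensor_of _ _))
    (map_heq _ (hObj_unit _) (congrArg F.functor.obj (hObj_unit _)) (F.constraint_tensor_of a b))

end WeakMap

namespace DDBicatsCat

attribute [local instance] WeakMap.braided

/-- The underlying braided monoidal category. -/
abbrev underlying (X : DDBicatsCat.{v, u}) : BrMonCat.{v, u} := BrMonCat.mk X.carrier

/-- The underlying braided strong monoidal functor. -/
noncomputable abbrev underlyingMap {X Y : DDBicatsCat.{v, u}} (F : X ⟶ Y) :
    X.underlying ⟶ Y.underlying :=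
  BrMonCat.Hom.mk (A := X.underlying) (B := Y.underlying) (WeakMap.functor F)
    (braided := WeakMap.braided F)

/-- The underlying monoidal transformation. -/
noncomputable abbrev underlyingMap₂ {X Y : DDBicatsCat.{v, u}} {F G : X ⟶ Y} (θ : F ⟶ G) :
    underlyingMap F ⟶ underlyingMap G :=
  BrMonCat.Hom₂.mk (F := underlyingMap F) (G := underlyingMap G) (WeakMap.Transformation.nat θ)
    (isMonoidal :=
      { unit := WeakMap.Transformation.unitConstraint_comp θ
        tensor := WeakMap.Transformation.verticalConstraint_comp θ })

theorem underlyingMap_id (X : DDBicatsCat.{v, u}) : underlyingMap (𝟙 X) = 𝟙 X.underlying :=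
  BrMonCat.Hom.ext' rfl HEq.rfl fun a b =>
    heq_of_eq (WeakMap.id_verticalConstraint (C := X.carrier) a b)

theorem underlyingMap_comp {X Y Z : DDBicatsCat.{v, u}} (F : X ⟶ Y) (G : Y ⟶ Z) :
    underlyingMap (F ≫ G) = underlyingMap F ≫ underlyingMap G :=
  BrMonCat.Hom.ext' rfl (heq_of_eq (WeakMap.comp_unitConstraint F G)) fun a b =>
    heq_of_eq (WeakMap.comp_verticalConstraint F G a b)

/-- Strict preservation of whiskering is stated with `eqToHom`s between 1-cells. Their components
are `eqToHom`s between objects, and for the forgetful 2-functor these objects agree definitionally.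
-/
theorem eqToHom_conj {A B : BrMonCat.{v, u}} {F F' G G' : A ⟶ B} (h : F = G) (h' : G' = F')
    (θ : F ⟶ F') (φ : G ⟶ G')
    (hF : ∀ x, (BrMonCat.Hom.functor F).obj x = (BrMonCat.Hom.functor G).obj x)
    (hF' : ∀ x, (BrMonCat.Hom.functor G').obj x = (BrMonCat.Hom.functor F').obj x)
    (e : ∀ x, (BrMonCat.Hom₂.nat θ).app x =
      eqToHom (hF x) ≫ (BrMonCat.Hom₂.nat φ).app x ≫ eqToHom (hF' x)) :
    θ = eqToHom h ≫ φ ≫ eqToHom h' := by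
  subst h h'
  apply BrMonCat.Hom₂.ext'
  ext x
  rw [e]
  simp

/-- The strict 2-functor to braided monoidal categories. -/
noncomputable def forgetToBrMonCat : StrictPseudofunctor DDBicatsCat.{v, u} BrMonCat.{v, u} :=
  StrictPseudofunctor.mk''
    { obj := underlying
      map := underlyingMap
      map₂ := underlyingMap₂
      map₂_id := fun _ => rfl
      map₂_comp := fun _ _ => rfl
      map_id := underlyingMap_id
      map_comp := underlyingMap_comp
      map₂_whisker_left := fun _ _ _ _ => eqToHom_conj _ _ _ _ (fun _ => rfl) (fun _ => rfl)
        fun _ => ((Category.id_comp _).trans (Category.comp_id _)).symm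
      map₂_whisker_right := fun _ _ => eqToHom_conj _ _ _ _ (fun _ => rfl) (fun _ => rfl)
        fun _ => ((Category.id_comp _).trans (Category.comp_id _)).symm }

end DDBicatsCat

end DDB

/-! ### Lifting 1-cells and 2-cells along the forgetful 2-functor -/

namespace DDB

open MonoidalCategory Bicategory

namespace BrMonCat

/-- The functor underlying a 1-cell. -/
abbrev fn {A B : BrMonCat.{v, u}} (F : A ⟶ B) : A.carrier ⥤ B.carrier := Hom.functor F

/-- The components of a 2-cell. -/
abbrev app {A B : BrMonCat.{v, u}} {F G : A ⟶ B} (θ : F ⟶ G) (x : A.carrier) :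
    (fn F).obj x ⟶ (fn G).obj x := (Hom₂.nat θ).app x

theorem hom₂_ext {A B : BrMonCat.{v, u}} {F G : A ⟶ B} {θ φ : F ⟶ G}
    (h : ∀ x, app θ x = app φ x) : θ = φ :=
  Hom₂.ext' (NatTrans.ext (funext h))

/-- Transport of a 2-cell along equalities of 1-cells, with prescribed components. -/
def homOfEq {A B : BrMonCat.{v, u}} {F F' G G' : A ⟶ B} (hF : F = F') (hG : G = G')
    (φ : F' ⟶ G') (nat : fn F ⟶ fn G)
    (h : ∀ x, nat.app x = eqToHom (by rw [hF]) ≫ app φ x ≫ eqToHom (by rw [hG])) : F ⟶ G where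
  nat := nat
  isMonoidal := by
    subst hF hG
    have : nat = Hom₂.nat φ := by ext x; simpa using h x
    rw [this]
    exact Hom₂.isMonoidal φ

/-- Transport of an invertible 2-cell along equalities of 1-cells, with prescribed components. -/
def isoOfEq {A B : BrMonCat.{v, u}} {F F' G G' : A ⟶ B} (hF : F = F') (hG : G = G')
    (φ : F' ⟶ G') (e : fn F ≅ fn G)
    (h : ∀ x, e.hom.app x = eqToHom (by rw [hF]) ≫ app φ x ≫ eqToHom (by rw [hG])) : F ≅ G :=
  haveI : NatTrans.IsMonoidal e.hom := Hom₂.isMonoidal (homOfEq hF hG φ e.hom h)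
  isoMk e

end BrMonCat

namespace DDBicatsCat

/-- The functor underlying a 1-cell. -/
abbrev fn {X Y : DDBicatsCat.{v, u}} (F : X ⟶ Y) : X.carrier ⥤ Y.carrier := WeakMap.functor F

/-- The components of a 2-cell. -/
abbrev app {X Y : DDBicatsCat.{v, u}} {F G : X ⟶ Y} (θ : F ⟶ G) (x : X.carrier) :
    (fn F).obj x ⟶ (fn G).obj x := (WeakMap.Transformation.nat θ).app x

theorem hom₂_ext {X Y : DDBicatsCat.{v, u}} {F G : X ⟶ Y} {θ φ : F ⟶ G}
    (h : ∀ x, app θ x = app φ x) : θ = φ :=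
  WeakMap.Transformation.ext' (NatTrans.ext (funext h))

/-- A 2-cell with a given underlying monoidal transformation. -/
noncomputable def lift₂ {X Y : DDBicatsCat.{v, u}} {F G : X ⟶ Y}
    (θ : underlyingMap F ⟶ underlyingMap G) : F ⟶ G :=
  WeakMap.Transformation.ofMonoidal (BrMonCat.Hom₂.nat θ)
    (BrMonCat.Hom₂.isMonoidal θ).unit (BrMonCat.Hom₂.isMonoidal θ).tensor

/-- An invertible 2-cell with a given underlying monoidal transformation. -/
noncomputable def liftIso {X Y : DDBicatsCat.{v, u}} {F G : X ⟶ Y}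
    (θ : underlyingMap F ≅ underlyingMap G) : F ≅ G where
  hom := lift₂ θ.hom
  inv := lift₂ θ.inv
  hom_inv_id := WeakMap.Transformation.ext' (congrArg BrMonCat.Hom₂.nat θ.hom_inv_id)
  inv_hom_id := WeakMap.Transformation.ext' (congrArg BrMonCat.Hom₂.nat θ.inv_hom_id)

/-- The weak map with a given underlying braided strong monoidal functor. -/
noncomputable def lift {X Y : DDBicatsCat.{v, u}} (K : X.underlying ⟶ Y.underlying) : X ⟶ Y :=
  letI : (BrMonCat.Hom.functor K : X.carrier ⥤ Y.carrier).Braided := BrMonCat.Hom.braided K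
  BraidedLift.weakMap (C := X.carrier) (D := Y.carrier) (BrMonCat.Hom.functor K)

/-- The constraint of the lift at a grid with one column and two letters reduces to `μ`. So every
braided functor is reached on the nose, not only up to isomorphism. -/
theorem underlyingMap_lift {X Y : DDBicatsCat.{v, u}} (K : X.underlying ⟶ Y.underlying) :
    underlyingMap (lift K) = K :=
  letI : (BrMonCat.Hom.functor K : X.carrier ⥤ Y.carrier).Braided := BrMonCat.Hom.braided K
  BrMonCat.Hom.ext' rfl HEq.rfl fun a b => heq_of_eq
    (BraidedLift.weakMap_verticalConstraint (C := X.carrier) (D := Y.carrier)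
      (BrMonCat.Hom.functor K) a b)

end DDBicatsCat

namespace BrMonCat

/-- The free doubly-degenerate `Bicat_s`-category equivalent to a braided monoidal category. -/
noncomputable abbrev str (c : BrMonCat.{v, u}) : DDBicatsCat.{v, u} := ⟨Strictification c.carrier⟩

/-- Evaluation of the strictification. -/
noncomputable abbrev ev (c : BrMonCat.{v, u}) : c.str.underlying ⟶ c :=
  Hom.mk (A := c.str.underlying) (Strictification.eval c.carrier)

/-- The section of the evaluation. -/
noncomputable abbrev sec (c : BrMonCat.{v, u}) : c ⟶ c.str.underlying :=
  Hom.mk (B := c.str.underlying) (Strictification.toFormal c.carrier)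

/-- The section is a right inverse of evaluation. -/
noncomputable def secEv (c : BrMonCat.{v, u}) : c.sec ≫ c.ev ≅ 𝟙 c :=
  isoMk (F := c.sec ≫ c.ev) (G := 𝟙 c) (Strictification.counitIso c.carrier)

/-- The section is a left inverse of evaluation. -/
noncomputable def evSec (c : BrMonCat.{v, u}) : c.ev ≫ c.sec ≅ 𝟙 _ :=
  (isoMk (F := 𝟙 c.str.underlying) (G := c.ev ≫ c.sec) (Strictification.unitIso c.carrier)).symm

end BrMonCat

end DDB

/-! ### Strictification as a pseudofunctor -/

namespace DDB

open Bicategory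

namespace BrMonCat

variable {c c' c'' c''' : BrMonCat.{v, u}}

/-- Evaluation of the strictification, as a functor. -/
abbrev E (c : BrMonCat.{v, u}) : Strictification c.carrier ⥤ c.carrier :=
  Strictification.eval c.carrier

/-- The section of the evaluation, as a functor. -/
noncomputable abbrev S (c : BrMonCat.{v, u}) : c.carrier ⥤ Strictification c.carrier :=
  Strictification.toFormal c.carrier

/-- This lemma and the two after it are the components of the whiskering and associativity axioms
for `strictification`, whose composition constraint inserts the inverse of `r`. -/
theorem app_conj {A : Type u} [Category.{v} A] {B : Type u'} [Category.{v'} B] {F G : A ⥤ B}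
    (θ : F ⟶ G) {a b : A} (e : a ≅ b) : θ.app b = F.map e.inv ≫ θ.app a ≫ G.map e.hom := by
  rw [← θ.naturality, ← Functor.map_comp_assoc, e.inv_hom_id, CategoryTheory.Functor.map_id, Category.id_comp]

theorem map_conj {A : Type u} [Category.{v} A] {F : A ⥤ A} (e : F ≅ 𝟭 A) {a b : A} (f : a ⟶ b) :
    f = e.inv.app a ≫ F.map f ≫ e.hom.app b := by
  simp

theorem map_naturality_cancel {A : Type u} [Category.{v} A] {B : Type u'} [Category.{v'} B]
    {F : A ⥤ A} (e : F ≅ 𝟭 A) (K : A ⥤ B) {a b : A} (f : a ≅ b) :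
    𝟙 (K.obj b) = K.map (e.inv.app b) ≫ K.map (F.map f.inv) ≫ 𝟙 _ ≫ K.map (e.hom.app a) ≫
      K.map f.hom := by
  simp only [Category.id_comp, ← CategoryTheory.Functor.map_comp]
  simp

/-- The isomorphism `S E ≅ 1` for a section `S` of the evaluation `E`. -/
noncomputable abbrev r (c : BrMonCat.{v, u}) : c.S ⋙ c.E ≅ 𝟭 c.carrier :=
  Strictification.counitIso c.carrier

/-- The isomorphism `1 ≅ E S` for a section `S` of the evaluation `E`. -/
noncomputable abbrev q (c : BrMonCat.{v, u}) :
    𝟭 (Strictification c.carrier) ≅ c.E ⋙ c.S :=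
  Strictification.unitIso c.carrier

-- A triangle identity of the adjoint equivalence, solved for the inverse of `q`.
@[simp]
theorem eval_q_inv (x : Strictification c.carrier) :
    c.E.map (c.q.inv.app x) = c.r.hom.app (c.E.obj x) := by
  rw [← cancel_epi (c.E.map (c.q.hom.app x)), ← CategoryTheory.Functor.map_comp,
    Iso.hom_inv_id_app, Strictification.eval_unitIso]
  exact c.E.map_id x

@[simp]
theorem q_inv_toFormal (b : c.carrier) :
    c.q.inv.app (c.S.obj b) = c.S.map (c.r.hom.app b) := by
  rw [← cancel_epi (c.q.hom.app (c.S.obj b)), Iso.hom_inv_id_app,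
    Strictification.toFormal_counitIso]

theorem map_r_inv_eval_q_inv {A : Type u'} [Category.{v'} A] (K : c.carrier ⥤ A)
    (x : Strictification c.carrier) :
    𝟙 (K.obj (c.E.obj x)) = K.map (c.r.inv.app (c.E.obj x)) ≫ K.map (c.E.map (c.q.inv.app x)) ≫
      𝟙 _ := by
  rw [eval_q_inv, Category.comp_id, ← CategoryTheory.Functor.map_comp, Iso.inv_hom_id_app]
  exact (K.map_id _).symm

theorem map_r_inv_q_inv (b : c.carrier) :
    𝟙 (c.S.obj b) = c.S.map (c.r.inv.app b) ≫ c.q.inv.app (c.S.obj b) ≫ 𝟙 _ := by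
  rw [q_inv_toFormal, Category.comp_id, ← CategoryTheory.Functor.map_comp, Iso.inv_hom_id_app]
  exact (c.S.map_id _).symm

/-- The weak map between strictifications induced by a braided strong monoidal functor. -/
noncomputable abbrev strMap (k : c ⟶ c') : c.str ⟶ c'.str := DDBicatsCat.lift (c.ev ≫ k ≫ c'.sec)

/-- The transformation between strictifications induced by a monoidal transformation. -/
noncomputable def strMap₂ {k l : c ⟶ c'} (θ : k ⟶ l) : strMap k ⟶ strMap l :=
  -- The equality `underlyingMap_lift` is not definitional, so the whiskered 2-cell is transported
  -- along it. Prescribing the natural transformation keeps its components free of casts.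
  DDBicatsCat.lift₂ (homOfEq (DDBicatsCat.underlyingMap_lift _) (DDBicatsCat.underlyingMap_lift _)
    (c.ev ◁ θ ▷ c'.sec)
    (Functor.whiskerLeft c.E (Functor.whiskerRight θ.nat c'.S))
    fun _ => ((Category.id_comp _).trans (Category.comp_id _)).symm)

/-- Preservation of identities by strictification. -/
noncomputable def strMapId (c : BrMonCat.{v, u}) : strMap (𝟙 c) ≅ 𝟙 c.str :=
  DDBicatsCat.liftIso (isoOfEq (F' := c.ev ≫ c.sec) (G' := 𝟙 c.str.underlying)
    (by rw [DDBicatsCat.underlyingMap_lift, Bicategory.Strict.id_comp])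
    (DDBicatsCat.underlyingMap_id _) c.evSec.hom c.q.symm
    fun _ => ((Category.id_comp _).trans (Category.comp_id _)).symm)

theorem strMap_comp_eq (k : c ⟶ c') (k' : c' ⟶ c'') :
    DDBicatsCat.underlyingMap (strMap k ≫ strMap k') =
      (c.ev ≫ k) ≫ (c'.sec ≫ c'.ev) ≫ k' ≫ c''.sec := by
  rw [DDBicatsCat.underlyingMap_comp, DDBicatsCat.underlyingMap_lift,
    DDBicatsCat.underlyingMap_lift]
  simp

/-- Preservation of composites by strictification. -/
noncomputable def strMapComp (k : c ⟶ c') (k' : c' ⟶ c'') :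
    strMap (k ≫ k') ≅ strMap k ≫ strMap k' :=
  DDBicatsCat.liftIso (isoOfEq
    (by rw [DDBicatsCat.underlyingMap_lift]; simp)
    (strMap_comp_eq k k')
    ((c.ev ≫ k) ◁ c'.secEv.inv ▷ (k' ≫ c''.sec))
    (Functor.isoWhiskerLeft (c.E ⋙ Hom.functor k)
      (Functor.isoWhiskerRight c'.r.symm (Hom.functor k' ⋙ c''.S)))
    fun _ => ((Category.id_comp _).trans (Category.comp_id _)).symm)

/-- The pseudofunctor of strictification. -/
noncomputable def strictification : BrMonCat.{v, u} ⥤ᵖ DDBicatsCat.{v, u} where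
  obj c := c.str
  map k := strMap k
  map₂ θ := strMap₂ θ
  map₂_id k := DDBicatsCat.hom₂_ext fun x => (S _).map_id _
  map₂_comp θ φ := DDBicatsCat.hom₂_ext fun x => (S _).map_comp _ _
  mapId := strMapId
  mapComp := strMapComp
  map₂_whisker_left {a b c} f {g h} η := DDBicatsCat.hom₂_ext fun x => by
    change (S _).map (app η _) = (S _).map ((fn g).map (b.r.inv.app _)) ≫
      (S _).map (app η _) ≫ (S _).map ((fn h).map (b.r.hom.app _))
    rw [← CategoryTheory.Functor.map_comp, ← CategoryTheory.Functor.map_comp]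
    exact congrArg (S _).map (app_conj (Hom₂.nat η) (b.r.app _))
  map₂_whisker_right {a b c} f g η h := DDBicatsCat.hom₂_ext fun x => by
    change (S _).map ((fn h).map (app η _)) = (S _).map ((fn h).map (b.r.inv.app _)) ≫
      (S _).map ((fn h).map ((E _).map ((S _).map (app η _)))) ≫
      (S _).map ((fn h).map (b.r.hom.app _))
    simp only [← CategoryTheory.Functor.map_comp]
    exact congrArg (S _).map (congrArg (fn h).map (map_conj b.r (app η _)))
  map₂_associator {a b c d} f g h := DDBicatsCat.hom₂_ext fun x =>
    (d.S.map_id _).trans (map_naturality_cancel c.r (fn h ⋙ d.S) ((fn g).mapIso (b.r.app _)))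
  map₂_left_unitor {a b} f := DDBicatsCat.hom₂_ext fun x =>
    (b.S.map_id _).trans (map_r_inv_eval_q_inv (fn f ⋙ b.S) x)
  map₂_right_unitor {a b} f := DDBicatsCat.hom₂_ext fun x =>
    (b.S.map_id _).trans (map_r_inv_q_inv ((fn f).obj (a.E.obj x)))

end BrMonCat

end DDB

/-! ### The unit equivalence -/

namespace DDB

open Bicategory BrMonCat
open scoped Pseudofunctor.StrongTrans

namespace BrMonCat

theorem app_eqToHom {A B : BrMonCat.{v, u}} {F G : A ⟶ B} (h : F = G) (x : A.carrier) :
    app (eqToHom h) x = eqToHom (by rw [h]) := by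
  subst h; rfl

section Components

variable (c d : BrMonCat.{v, u})

/-- Here and below the expressions have the shape of unfolded coherence axioms, identities included.
The variable `t` stands for a component of `forget.mapId` or `forget.mapComp`, which comes from
`eqToHom` and is an identity only propositionally. -/
theorem section_id (x : c.carrier) {t : c.E.obj (c.S.obj x) ⟶ c.E.obj (c.S.obj x)} (ht : t = 𝟙 _) :
    c.S.map (c.r.inv.app x) ≫ c.S.map t ≫ c.q.inv.app (c.S.obj x) = c.S.map (𝟙 x) ≫ 𝟙 _ ≫ 𝟙 _ := by
  subst ht
  refine (congrArg (c.S.map (c.r.inv.app x) ≫ ·) ((congrArg (· ≫ c.q.inv.app _)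
    (c.S.map_id _)).trans (Category.id_comp _))).trans ?_
  refine ((congrArg (_ ≫ ·) (Category.comp_id _).symm).trans (map_r_inv_q_inv x).symm).trans ?_
  simp

theorem section_id' (x : c.carrier) {t : c.S.obj x ⟶ c.S.obj x} (ht : t = 𝟙 _) :
    c.S.map (c.r.inv.app x) ≫ c.q.inv.app (c.S.obj x) ≫ t = c.S.map (𝟙 x) ≫ 𝟙 _ ≫ 𝟙 _ := by
  subst ht
  exact (map_r_inv_q_inv x).symm.trans (by simp)

theorem section_comp {A : Type u'} [Category.{v'} A] {A' : Type u''} [Category.{v''} A']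
    (G : c.carrier ⥤ A) (S' : A ⥤ A') {a b : c.carrier} (f : a ⟶ b) (t : G.obj b ⟶ G.obj b)
    (ht : t = 𝟙 _) :
    S'.map (G.map f) ≫ S'.map t ≫ S'.map (G.map (c.r.inv.app b)) = S'.map (𝟙 _) ≫ 𝟙 _ ≫
      S'.map (G.map (c.r.inv.app a)) ≫ 𝟙 _ ≫ S'.map (G.map (c.E.map (c.S.map f))) ≫ 𝟙 _ := by
  subst ht
  simp only [CategoryTheory.Functor.map_id, Category.id_comp, Category.comp_id,
    ← CategoryTheory.Functor.map_comp]
  exact congrArg S'.map (congrArg G.map (c.r.inv.naturality f))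

theorem section_comp' {A : Type u'} [Category.{v'} A] {A' : Type u''} [Category.{v''} A']
    (G : c.carrier ⥤ A) (S' : A ⥤ A') {a b : c.carrier} (f : a ⟶ b)
    (t : S'.obj (G.obj (c.E.obj (c.S.obj b))) ⟶ S'.obj (G.obj (c.E.obj (c.S.obj b))))
    (ht : t = 𝟙 _) :
    S'.map (G.map f) ≫ S'.map (G.map (c.r.inv.app b)) ≫ t = S'.map (𝟙 _) ≫ 𝟙 _ ≫
      S'.map (G.map (c.r.inv.app a)) ≫ 𝟙 _ ≫ S'.map (G.map (c.E.map (c.S.map f))) ≫ 𝟙 _ := by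
  subst ht
  have h : S'.map (G.map f) ≫ S'.map (G.map (c.r.inv.app b)) =
      S'.map (G.map (c.r.inv.app a)) ≫ S'.map (G.map (c.E.map (c.S.map f))) := by
    rw [← CategoryTheory.Functor.map_comp, ← CategoryTheory.Functor.map_comp,
      ← CategoryTheory.Functor.map_comp, ← CategoryTheory.Functor.map_comp]
    exact congrArg S'.map (congrArg G.map (c.r.inv.naturality f))
  refine (congrArg (S'.map (G.map f) ≫ ·) (Category.comp_id _)).trans (h.trans ?_)
  simp only [CategoryTheory.Functor.map_id, Category.id_comp, Category.comp_id]

theorem evaluation_id (x : Strictification c.carrier) {t : c.E.obj x ⟶ c.E.obj x} (ht : t = 𝟙 _) :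
    c.r.hom.app (c.E.obj x) ≫ 𝟙 _ = c.E.map (c.S.map t ≫ c.q.inv.app x) ≫ 𝟙 _ ≫ 𝟙 _ := by
  subst ht
  rw [CategoryTheory.Functor.map_id, Category.id_comp, eval_q_inv]
  exact congrArg (_ ≫ ·) (Category.id_comp _).symm

theorem evaluation_id' (x : Strictification c.carrier) {t : x ⟶ x} (ht : t = 𝟙 _) :
    c.r.hom.app (c.E.obj x) ≫ 𝟙 _ = c.E.map (c.q.inv.app x ≫ t) ≫ 𝟙 _ ≫ 𝟙 _ := by
  subst ht
  have h : c.E.map (c.q.inv.app x ≫ 𝟙 x) = c.r.hom.app (c.E.obj x) :=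
    (congrArg c.E.map (Category.comp_id _)).trans (eval_q_inv x)
  exact (congrArg₂ (· ≫ ·) h (Category.id_comp _)).symm

/-- Naturality of `r` carries the inserted inverse of `r` past the evaluation, where it cancels. -/
theorem evaluation_comp (G : c.carrier ⥤ d.carrier) (b : c.carrier) (t : G.obj b ⟶ G.obj b)
    (ht : t = 𝟙 _) :
    d.r.hom.app (G.obj b) ≫ 𝟙 _ = d.E.map (d.S.map t ≫ d.S.map (G.map (c.r.inv.app b))) ≫ 𝟙 _ ≫
      d.r.hom.app (G.obj (c.E.obj (c.S.obj b))) ≫ 𝟙 _ ≫ G.map (c.r.hom.app b) ≫ 𝟙 _ := by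
  subst ht
  have h := d.r.hom.naturality (G.map (c.r.inv.app b))
  have h' : d.E.map (d.S.map (G.map (c.r.inv.app b))) ≫
      d.r.hom.app (G.obj (c.E.obj (c.S.obj b))) = d.r.hom.app (G.obj b) ≫ G.map (c.r.inv.app b) := h
  simp only [CategoryTheory.Functor.map_id, Category.id_comp, Category.comp_id]
  rw [reassoc_of% h', ← CategoryTheory.Functor.map_comp, Iso.inv_hom_id_app]
  exact ((congrArg (_ ≫ ·) (G.map_id b)).trans (Category.comp_id _)).symm

theorem evaluation_comp' (G : c.carrier ⥤ d.carrier) (b : c.carrier)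
    (t : d.S.obj (G.obj (c.E.obj (c.S.obj b))) ⟶ d.S.obj (G.obj (c.E.obj (c.S.obj b))))
    (ht : t = 𝟙 _) :
    d.r.hom.app (G.obj b) ≫ 𝟙 _ = d.E.map (d.S.map (G.map (c.r.inv.app b)) ≫ t) ≫ 𝟙 _ ≫
      d.r.hom.app (G.obj (c.E.obj (c.S.obj b))) ≫ 𝟙 _ ≫ G.map (c.r.hom.app b) ≫ 𝟙 _ := by
  subst ht
  have h : d.S.map (𝟙 _) ≫ d.S.map (G.map (c.r.inv.app b)) =
      d.S.map (G.map (c.r.inv.app b)) ≫ 𝟙 _ := by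
    rw [CategoryTheory.Functor.map_id, Category.id_comp]
    exact (Category.comp_id _).symm
  exact (evaluation_comp c d G b _ rfl).trans (congrArg (fun u => d.E.map u ≫ 𝟙 _ ≫
    d.r.hom.app (G.obj (c.E.obj (c.S.obj b))) ≫ 𝟙 _ ≫ G.map (c.r.hom.app b) ≫ 𝟙 _) h)

theorem section_evaluation {a b : c.carrier} (f : a ⟶ b) :
    c.r.inv.app a ≫ 𝟙 _ ≫ c.E.map (c.S.map f) ≫ 𝟙 _ ≫ c.r.hom.app b ≫ 𝟙 _ = (𝟙 _ ≫ 𝟙 _) ≫ f := by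
  simp only [Category.id_comp, Category.comp_id]
  exact (map_conj c.r f).symm

theorem evaluation_section (G : c.carrier ⥤ d.carrier) (x : Strictification c.carrier) :
    d.q.inv.app (d.S.obj (G.obj (c.E.obj x))) ≫ 𝟙 _ ≫ 𝟙 _ =
      (𝟙 _ ≫ d.S.map (d.r.hom.app (G.obj (c.E.obj x))) ≫ 𝟙 _ ≫
        d.S.map (G.map (c.r.inv.app (c.E.obj x))) ≫ 𝟙 _) ≫
        d.S.map (G.map (c.E.map (c.q.inv.app x))) := by
  have h : d.S.map (G.map (c.r.inv.app (c.E.obj x))) ≫ d.S.map (G.map (c.r.hom.app (c.E.obj x))) =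
      𝟙 _ := by
    rw [← CategoryTheory.Functor.map_comp, ← CategoryTheory.Functor.map_comp, Iso.inv_hom_id_app]
    exact (congrArg d.S.map (G.map_id _)).trans (d.S.map_id _)
  rw [q_inv_toFormal, eval_q_inv]
  simp only [Category.id_comp, Category.comp_id, Category.assoc]
  exact ((congrArg (_ ≫ ·) h).trans (Category.comp_id _)).symm

end Components

end BrMonCat

namespace DDBicatsCat

/-- The pseudofunctor to braided monoidal categories. -/
noncomputable abbrev forget : DDBicatsCat.{v, u} ⥤ᵖ BrMonCat.{v, u} :=
  forgetToBrMonCat.toPseudofunctor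

theorem forget_mapId_hom_app (X : DDBicatsCat.{v, u}) (x : X.carrier) :
    BrMonCat.app (forget.mapId X).hom x = 𝟙 x :=
  BrMonCat.app_eqToHom (underlyingMap_id X) x

theorem forget_mapId_inv_app (X : DDBicatsCat.{v, u}) (x : X.carrier) :
    BrMonCat.app (forget.mapId X).inv x = 𝟙 x :=
  BrMonCat.app_eqToHom (underlyingMap_id X).symm x

theorem forget_mapComp_hom_app {X Y Z : DDBicatsCat.{v, u}} (F : X ⟶ Y) (G : Y ⟶ Z)
    (x : X.carrier) : BrMonCat.app (forget.mapComp F G).hom x = 𝟙 ((fn G).obj ((fn F).obj x)) :=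
  BrMonCat.app_eqToHom (underlyingMap_comp F G) x

theorem forget_mapComp_inv_app {X Y Z : DDBicatsCat.{v, u}} (F : X ⟶ Y) (G : Y ⟶ Z)
    (x : X.carrier) : BrMonCat.app (forget.mapComp F G).inv x = 𝟙 ((fn G).obj ((fn F).obj x)) :=
  BrMonCat.app_eqToHom (underlyingMap_comp F G).symm x

variable {X Y : DDBicatsCat.{v, u}}

/-- Naturality of the sections of the evaluations with respect to weak maps. -/
noncomputable def secNat (F : X ⟶ Y) :
    F ≫ lift Y.underlying.sec ≅ lift X.underlying.sec ≫ strMap (underlyingMap F) :=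
  liftIso (isoOfEq (F' := 𝟙 _ ≫ underlyingMap F ≫ Y.underlying.sec)
    (G' := (X.underlying.sec ≫ X.underlying.ev) ≫ underlyingMap F ≫ Y.underlying.sec)
    (by rw [underlyingMap_comp, underlyingMap_lift, Bicategory.Strict.id_comp])
    (by rw [underlyingMap_comp, underlyingMap_lift, underlyingMap_lift]; simp)
    (X.underlying.secEv.inv ▷ (underlyingMap F ≫ Y.underlying.sec))
    (Functor.isoWhiskerRight X.underlying.r.symm (fn F ⋙ Y.underlying.S))
    fun _ => ((Category.id_comp _).trans (Category.comp_id _)).symm)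

/-- Naturality of the evaluations with respect to weak maps. -/
noncomputable def evNat (F : X ⟶ Y) :
    strMap (underlyingMap F) ≫ lift Y.underlying.ev ≅ lift X.underlying.ev ≫ F :=
  liftIso (isoOfEq
    (F' := (X.underlying.ev ≫ underlyingMap F) ≫ (Y.underlying.sec ≫ Y.underlying.ev))
    (G' := (X.underlying.ev ≫ underlyingMap F) ≫ 𝟙 _)
    (by rw [underlyingMap_comp, underlyingMap_lift, underlyingMap_lift]; simp)
    (by rw [underlyingMap_comp, underlyingMap_lift]; simp)
    ((X.underlying.ev ≫ underlyingMap F) ◁ Y.underlying.secEv.hom)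
    (Functor.isoWhiskerLeft (X.underlying.E ⋙ fn F) Y.underlying.r)
    fun _ => ((Category.id_comp _).trans (Category.comp_id _)).symm)

/-- The sections of the evaluations as a strong transformation. -/
noncomputable def unit :
    Pseudofunctor.id DDBicatsCat.{v, u} ⟶ forget.comp strictification.{v, u} where
  app X := lift X.underlying.sec
  naturality F := secNat F
  naturality_naturality {X Y F G} θ := hom₂_ext fun x => by
    change Y.underlying.S.map (app θ x) ≫ Y.underlying.S.map ((fn G).map (X.underlying.r.inv.app x)) =
      Y.underlying.S.map ((fn F).map (X.underlying.r.inv.app x)) ≫ Y.underlying.S.map (app θ _)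
    simp only [← CategoryTheory.Functor.map_comp]
    exact congrArg Y.underlying.S.map ((WeakMap.Transformation.nat θ).naturality _).symm
  naturality_id X := hom₂_ext fun x => by
    change X.underlying.S.map (X.underlying.r.inv.app x) ≫ X.underlying.S.map
      (BrMonCat.app (forget.mapId X).hom _) ≫ X.underlying.q.inv.app (X.underlying.S.obj x) =
      X.underlying.S.map (𝟙 _) ≫ 𝟙 _ ≫ 𝟙 _
    exact section_id _ _ (forget_mapId_hom_app X _)
  naturality_comp {X Y Z} F G := hom₂_ext fun x => by
    change Z.underlying.S.map ((fn G).map ((fn F).map (X.underlying.r.inv.app x))) ≫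
      Z.underlying.S.map (BrMonCat.app (forget.mapComp F G).hom _) ≫
        Z.underlying.S.map ((fn G).map (Y.underlying.r.inv.app _)) =
      Z.underlying.S.map (𝟙 _) ≫ 𝟙 _ ≫ Z.underlying.S.map ((fn G).map (Y.underlying.r.inv.app _)) ≫
        𝟙 _ ≫ Z.underlying.S.map ((fn G).map (Y.underlying.E.map (Y.underlying.S.map ((fn F).map
          (X.underlying.r.inv.app x))))) ≫ 𝟙 _
    exact section_comp Y.underlying (fn G) Z.underlying.S _ _ (forget_mapComp_hom_app F G _)

/-- The evaluations as a strong transformation. -/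
noncomputable def unitInv :
    forget.comp strictification.{v, u} ⟶ Pseudofunctor.id DDBicatsCat.{v, u} where
  app X := lift X.underlying.ev
  naturality F := evNat F
  naturality_naturality {X Y F G} θ := hom₂_ext fun x => by
    change Y.underlying.E.map (Y.underlying.S.map (app θ _)) ≫ Y.underlying.r.hom.app _ =
      Y.underlying.r.hom.app _ ≫ app θ _
    exact Y.underlying.r.hom.naturality _
  naturality_id X := hom₂_ext fun x => by
    change X.underlying.r.hom.app _ ≫ 𝟙 _ = X.underlying.E.map (X.underlying.S.map
      (BrMonCat.app (forget.mapId X).hom _) ≫ X.underlying.q.inv.app x) ≫ 𝟙 _ ≫ 𝟙 _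
    exact evaluation_id _ _ (forget_mapId_hom_app X _)
  naturality_comp {X Y Z} F G := hom₂_ext fun x => by
    change Z.underlying.r.hom.app _ ≫ 𝟙 _ = Z.underlying.E.map (Z.underlying.S.map
      (BrMonCat.app (forget.mapComp F G).hom _) ≫
        Z.underlying.S.map ((fn G).map (Y.underlying.r.inv.app _))) ≫ 𝟙 _ ≫
        Z.underlying.r.hom.app _ ≫ 𝟙 _ ≫ (fn G).map (Y.underlying.r.hom.app _) ≫ 𝟙 _
    exact evaluation_comp Y.underlying Z.underlying (fn G) _ _ (forget_mapComp_hom_app F G _)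

/-- The isomorphism `1 ≅ S E` in doubly-degenerate `Bicat_s`-categories. -/
noncomputable def secEvIso (X : DDBicatsCat.{v, u}) :
    𝟙 X ≅ lift X.underlying.sec ≫ lift X.underlying.ev :=
  liftIso (isoOfEq (F' := 𝟙 _) (G' := X.underlying.sec ≫ X.underlying.ev) (underlyingMap_id X)
    (by rw [underlyingMap_comp, underlyingMap_lift, underlyingMap_lift])
    X.underlying.secEv.inv X.underlying.r.symm
    fun _ => ((Category.id_comp _).trans (Category.comp_id _)).symm)

/-- The isomorphism `E S ≅ 1` in doubly-degenerate `Bicat_s`-categories. -/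
noncomputable def evSecIso (X : DDBicatsCat.{v, u}) :
    lift X.underlying.ev ≫ lift X.underlying.sec ≅ 𝟙 X.underlying.str :=
  liftIso (isoOfEq (F' := X.underlying.ev ≫ X.underlying.sec) (G' := 𝟙 _)
    (by rw [underlyingMap_comp, underlyingMap_lift, underlyingMap_lift])
    (underlyingMap_id _) X.underlying.evSec.hom X.underlying.q.symm
    fun _ => ((Category.id_comp _).trans (Category.comp_id _)).symm)

/-- The composite of section and evaluation is the identity transformation. -/
noncomputable def unitUnitInv : 𝟙 (Pseudofunctor.id DDBicatsCat.{v, u}) ≅ unit ≫ unitInv :=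
  Pseudofunctor.StrongTrans.isoMk secEvIso fun {X Y} F => hom₂_ext fun x => by
    change Y.underlying.r.inv.app _ ≫ 𝟙 _ ≫ Y.underlying.E.map (Y.underlying.S.map
      ((fn F).map (X.underlying.r.inv.app x))) ≫ 𝟙 _ ≫ Y.underlying.r.hom.app _ ≫ 𝟙 _ =
      (𝟙 _ ≫ 𝟙 _) ≫ (fn F).map (X.underlying.r.inv.app x)
    exact section_evaluation _ _

/-- The composite of evaluation and section is the identity transformation. -/
noncomputable def unitInvUnit :
    unitInv ≫ unit ≅ 𝟙 (forget.comp strictification.{v, u}) :=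
  Pseudofunctor.StrongTrans.isoMk evSecIso fun {X Y} F => hom₂_ext fun x => by
    change Y.underlying.q.inv.app (Y.underlying.S.obj _) ≫ 𝟙 _ ≫ 𝟙 _ =
      (𝟙 _ ≫ Y.underlying.S.map (Y.underlying.r.hom.app _) ≫ 𝟙 _ ≫
      Y.underlying.S.map ((fn F).map (X.underlying.r.inv.app _)) ≫ 𝟙 _) ≫
      Y.underlying.S.map ((fn F).map (X.underlying.E.map (X.underlying.q.inv.app x)))
    exact evaluation_section X.underlying Y.underlying (fn F) x

end DDBicatsCat

end DDB

/-! ### The counit equivalence, the triangles and the swallowtails -/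

namespace DDB

open Bicategory
open scoped Pseudofunctor.StrongTrans

namespace BrMonCat

open DDBicatsCat (forget underlyingMap_lift underlyingMap_comp underlyingMap_id)

section Components

variable (c d : BrMonCat.{v, u})

variable {c} in
theorem r_naturality {a b : c.carrier} (f : a ⟶ b) :
    c.E.map (c.S.map f) ≫ c.r.hom.app b = c.r.hom.app a ≫ f :=
  c.r.hom.naturality f

variable {c} in
theorem r_inv_naturality {a b : c.carrier} (f : a ⟶ b) :
    f ≫ c.r.inv.app b = c.r.inv.app a ≫ c.E.map (c.S.map f) :=
  c.r.inv.naturality f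

variable {c} in
theorem eval_q_hom (x : Strictification c.carrier) :
    c.E.map (c.q.hom.app x) = c.r.inv.app (c.E.obj x) := by
  rw [← cancel_mono (c.r.hom.app (c.E.obj x)), Strictification.eval_unitIso, Iso.inv_hom_id_app]
  rfl

variable {c} in
theorem q_hom_toFormal (b : c.carrier) :
    c.q.hom.app (c.S.obj b) = c.S.map (c.r.inv.app b) := by
  rw [← cancel_mono (c.S.map (c.r.hom.app b)), Strictification.toFormal_counitIso,
    ← CategoryTheory.Functor.map_comp, Iso.inv_hom_id_app]
  exact (c.S.map_id b).symm

variable {c} in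
theorem r_inv_hom (b : c.carrier) : c.r.inv.app b ≫ c.r.hom.app b = 𝟙 b :=
  c.r.inv_hom_id_app b

/-- Naturality of the left triangulator, on components: `r` of `d` is natural, and then `r` of `c`
cancels its inverse. -/
theorem triangle_section (G : c.carrier ⥤ d.carrier) (x : c.carrier)
    {t : d.S.obj (G.obj x) ⟶ d.S.obj (G.obj x)} (ht : t = 𝟙 _)
    {t' : d.S.obj (G.obj (c.E.obj (c.S.obj x))) ⟶ d.S.obj (G.obj (c.E.obj (c.S.obj x)))}
    (ht' : t' = 𝟙 _) :
    d.r.hom.app (G.obj x) ≫ 𝟙 _ = (𝟙 _ ≫ d.E.map (t ≫ d.S.map (G.map (c.r.inv.app x)) ≫ t') ≫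
      𝟙 _ ≫ d.r.hom.app (G.obj (c.E.obj (c.S.obj x))) ≫ 𝟙 _) ≫ G.map (c.r.hom.app x) ≫ 𝟙 _ := by
  subst ht ht'
  dsimp only [Functor.comp_obj, Functor.id_obj]
  simp only [Category.id_comp, Category.comp_id]
  rw [r_naturality, Category.assoc, ← CategoryTheory.Functor.map_comp, r_inv_hom,
    CategoryTheory.Functor.map_id]
  exact (Category.comp_id _).symm

theorem evaluation_section' (G : c.carrier ⥤ d.carrier) (x : Strictification c.carrier) :
    d.q.hom.app (d.S.obj (G.obj (c.E.obj x))) ≫ (𝟙 _ ≫ d.S.map (d.r.hom.app (G.obj (c.E.obj x))) ≫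
      𝟙 _ ≫ d.S.map (G.map (c.r.inv.app (c.E.obj x))) ≫ 𝟙 _) =
      (𝟙 _ ≫ 𝟙 _) ≫ d.S.map (G.map (c.E.map (c.q.hom.app x))) := by
  rw [q_hom_toFormal, eval_q_hom]
  dsimp only [Functor.comp_obj, Functor.id_obj]
  simp only [Category.id_comp, Category.comp_id]
  rw [← CategoryTheory.Functor.map_comp_assoc, r_inv_hom, CategoryTheory.Functor.map_id,
    Category.id_comp]

theorem section_evaluation' (G : c.carrier ⥤ d.carrier) (x : c.carrier) :
    d.r.hom.app (G.obj x) ≫ 𝟙 _ ≫ 𝟙 _ = (𝟙 _ ≫ d.E.map (d.S.map (G.map (c.r.inv.app x))) ≫ 𝟙 _ ≫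
      d.r.hom.app (G.obj (c.E.obj (c.S.obj x))) ≫ 𝟙 _) ≫ G.map (c.r.hom.app x) := by
  dsimp only [Functor.comp_obj, Functor.id_obj]
  simp only [Category.id_comp, Category.comp_id]
  rw [r_naturality, Category.assoc, ← CategoryTheory.Functor.map_comp, r_inv_hom,
    CategoryTheory.Functor.map_id]
  exact (Category.comp_id _).symm

/-- For the composites in which the strictification is itself strictified: naturality of the inner
`r` removes the second level, and naturality of `r` for `c` the first. -/
theorem eval_r_conj {a b : c.carrier} (f : a ⟶ b) :
    c.E.map (c.str.underlying.r.inv.app (c.S.obj a)) ≫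
      c.E.map (c.str.underlying.E.map (c.str.underlying.S.map (c.S.map f))) ≫
      c.E.map (c.str.underlying.r.hom.app (c.S.obj b)) ≫ c.r.hom.app b = c.r.hom.app a ≫ f := by
  have h : c.str.underlying.r.inv.app (c.S.obj a) ≫
      c.str.underlying.E.map (c.str.underlying.S.map (c.S.map f)) ≫
      c.str.underlying.r.hom.app (c.S.obj b) = c.S.map f :=
    (map_conj c.str.underlying.r (c.S.map f)).symm
  rw [← r_naturality f]
  exact (by simp only [CategoryTheory.Functor.map_comp, Category.assoc] :
    _ = c.E.map (c.str.underlying.r.inv.app (c.S.obj a) ≫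
      c.str.underlying.E.map (c.str.underlying.S.map (c.S.map f)) ≫
      c.str.underlying.r.hom.app (c.S.obj b)) ≫ c.r.hom.app b).trans
    (congrArg (fun u => c.E.map u ≫ c.r.hom.app b) h)

/-- Naturality of the right triangulator, on components. After `eval_r_conj` and cancellation,
naturality of the inverse of `r` remains. -/
theorem triangle_evaluation (G : c.carrier ⥤ d.carrier) (x : Strictification c.carrier) :
    𝟙 _ ≫ (d.q.hom.app (d.S.obj (G.obj (c.E.obj x))) ≫ d.S.map (d.E.map
      (d.str.underlying.r.inv.app (d.S.obj (G.obj (c.E.obj x)))))) ≫ 𝟙 _ ≫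
      d.S.map (d.E.map (d.str.underlying.E.map (d.str.underlying.S.map (d.S.map (G.map
        (c.E.map (c.str.underlying.r.inv.app x))))))) ≫ 𝟙 _ ≫
      (d.S.map (d.E.map (d.str.underlying.r.hom.app (d.S.obj (G.obj (c.E.obj
        (c.str.underlying.E.obj (c.str.underlying.S.obj x))))))) ≫ d.S.map (d.r.hom.app _) ≫
        d.S.map (G.map (c.r.inv.app _))) ≫ 𝟙 _ =
      𝟙 _ ≫ d.S.map (G.map (c.E.map (c.q.hom.app x ≫
        c.S.map (c.E.map (c.str.underlying.r.inv.app x))))) := by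
  rw [q_hom_toFormal]
  dsimp only [Functor.comp_obj, Functor.id_obj]
  simp only [Category.id_comp, Category.comp_id, ← CategoryTheory.Functor.map_comp]
  refine congrArg d.S.map ?_
  have h := eval_r_conj d (G.map (c.E.map (c.str.underlying.r.inv.app x)))
  rw [Category.assoc, reassoc_of% h, reassoc_of% r_inv_hom (c := d),
    CategoryTheory.Functor.map_comp c.E, eval_q_hom]
  exact (G.map_comp _ _).symm.trans <| congrArg G.map (r_inv_naturality (c.E.map (c.str.underlying.r.inv.app x)))

theorem swallowtail_section (x : c.carrier) :
    𝟙 _ ≫ (c.q.hom.app (c.S.obj x) ≫ c.S.map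
      (c.E.map (c.str.underlying.r.inv.app (c.S.obj x)))) ≫ 𝟙 _ ≫
      c.S.map (c.E.map (c.str.underlying.E.map
        (c.str.underlying.S.map (c.S.map (c.r.inv.app x))))) ≫ 𝟙 _ ≫
      (c.S.map (c.E.map (c.str.underlying.r.hom.app (c.S.obj (c.E.obj (c.S.obj x))))) ≫
        c.S.map (c.r.hom.app (c.E.obj (c.S.obj x))) ≫ c.q.inv.app (c.S.obj x)) ≫ 𝟙 _ = 𝟙 _ := by
  rw [q_hom_toFormal, q_inv_toFormal]
  dsimp only [Functor.comp_obj, Functor.id_obj]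
  simp only [Category.id_comp, Category.comp_id, ← CategoryTheory.Functor.map_comp]
  rw [← c.S.map_id]
  refine congrArg c.S.map ?_
  have h := eval_r_conj c (c.r.inv.app x)
  dsimp only [Functor.comp_obj, Functor.id_obj] at h
  rw [Category.assoc, reassoc_of% h, r_inv_hom, Category.comp_id, r_inv_hom]

theorem swallowtail_evaluation (x : Strictification c.carrier) {t : x ⟶ x} (ht : t = 𝟙 _)
    {t' : c.S.obj (c.E.obj (c.str.underlying.E.obj (c.str.underlying.S.obj x))) ⟶
      c.S.obj (c.E.obj (c.str.underlying.E.obj (c.str.underlying.S.obj x)))} (ht' : t' = 𝟙 _) :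
    𝟙 _ ≫ c.E.map (t ≫ (c.q.hom.app x ≫
      c.S.map (c.E.map (c.str.underlying.r.inv.app x))) ≫ t') ≫ 𝟙 _ ≫ c.r.hom.app _ ≫ 𝟙 _ ≫
        c.E.map (c.str.underlying.r.hom.app x) ≫ 𝟙 _ = 𝟙 _ := by
  subst ht ht'
  dsimp only [Functor.comp_obj, Functor.id_obj]
  simp only [Category.id_comp, Category.comp_id, CategoryTheory.Functor.map_comp]
  have h := r_naturality (c.E.map (c.str.underlying.r.inv.app x))
  dsimp only [Functor.comp_obj, Functor.id_obj] at h
  rw [eval_q_hom, Category.assoc, reassoc_of% h, reassoc_of% r_inv_hom (c := c),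
    ← CategoryTheory.Functor.map_comp, r_inv_hom, CategoryTheory.Functor.map_id]

end Components

variable {c c' : BrMonCat.{v, u}}

theorem strMap_comp_ev_eq (k : c ⟶ c') :
    DDBicatsCat.underlyingMap (strMap k) ≫ c'.ev = (c.ev ≫ k) ≫ c'.sec ≫ c'.ev := by
  rw [underlyingMap_lift]
  simp

/-- Naturality of the evaluations with respect to braided functors. -/
noncomputable def evNat (k : c ⟶ c') :
    DDBicatsCat.underlyingMap (strMap k) ≫ c'.ev ≅ c.ev ≫ k :=
  isoOfEq (G' := (c.ev ≫ k) ≫ 𝟙 _) (strMap_comp_ev_eq k) (by simp)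
    ((c.ev ≫ k) ◁ c'.secEv.hom) (Functor.isoWhiskerLeft (c.E ⋙ fn k) c'.r)
    fun _ => ((Category.id_comp _).trans (Category.comp_id _)).symm

/-- Naturality of the sections of the evaluations with respect to braided functors. -/
noncomputable def secNat (k : c ⟶ c') :
    k ≫ c'.sec ≅ c.sec ≫ DDBicatsCat.underlyingMap (strMap k) :=
  isoOfEq (F' := 𝟙 _ ≫ k ≫ c'.sec) (G' := (c.sec ≫ c.ev) ≫ k ≫ c'.sec) (by simp)
    (by rw [underlyingMap_lift]; simp) (c.secEv.inv ▷ (k ≫ c'.sec))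
    (Functor.isoWhiskerRight c.r.symm (fn k ⋙ c'.S))
    fun _ => ((Category.id_comp _).trans (Category.comp_id _)).symm

/-- The evaluations as a strong transformation. -/
noncomputable def counit :
    strictification.{v, u}.comp forget ⟶ Pseudofunctor.id BrMonCat.{v, u} where
  app c := c.ev
  naturality k := evNat k
  naturality_naturality {_ c' _ _} _ := hom₂_ext fun _ => c'.r.hom.naturality _
  naturality_id c := hom₂_ext fun x => evaluation_id' c x (DDBicatsCat.forget_mapId_hom_app c.str x)
  naturality_comp {c c' c''} k l := hom₂_ext fun x =>
    evaluation_comp' c' c'' (fn l) _ _ (DDBicatsCat.forget_mapComp_hom_app (strMap k) (strMap l) x)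

/-- The sections of the evaluations as a strong transformation. -/
noncomputable def counitInv :
    Pseudofunctor.id BrMonCat.{v, u} ⟶ strictification.{v, u}.comp forget where
  app c := c.sec
  naturality k := secNat k
  naturality_naturality {c c' k l} θ := hom₂_ext fun x => by
    change c'.S.map (app θ x) ≫ c'.S.map ((fn l).map (c.r.inv.app x)) =
      c'.S.map ((fn k).map (c.r.inv.app x)) ≫ c'.S.map (app θ _)
    simp only [← CategoryTheory.Functor.map_comp]
    exact congrArg c'.S.map ((Hom₂.nat θ).naturality _).symm
  naturality_id c := hom₂_ext fun x =>
    section_id' c x (DDBicatsCat.forget_mapId_hom_app c.str (c.S.obj x))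
  naturality_comp {c c' c''} k l := hom₂_ext fun x =>
    section_comp' c' (fn l) c''.S ((fn k).map (c.r.inv.app x)) _
      (DDBicatsCat.forget_mapComp_hom_app (strMap k) (strMap l) (c.S.obj x))

/-- The composite of evaluation and section is the identity transformation. -/
noncomputable def counitCounitInv :
    𝟙 (strictification.{v, u}.comp forget) ≅ counit ≫ counitInv :=
  Pseudofunctor.StrongTrans.isoMk (fun c => c.evSec.symm) fun {c c'} k => hom₂_ext fun x => by
    exact evaluation_section' c c' (fn k) x

/-- The composite of section and evaluation is the identity transformation. -/
noncomputable def counitInvCounit :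
    counitInv ≫ counit ≅ 𝟙 (Pseudofunctor.id BrMonCat.{v, u}) :=
  Pseudofunctor.StrongTrans.isoMk secEv fun {c c'} k => hom₂_ext fun x => by
    exact section_evaluation' c c' (fn k) x

theorem strTriangle_eq (c : BrMonCat.{v, u}) :
    DDBicatsCat.underlyingMap (DDBicatsCat.lift c.str.underlying.sec ≫ strMap c.ev) =
      (c.str.underlying.sec ≫ c.str.underlying.ev) ≫ c.ev ≫ c.sec := by
  rw [underlyingMap_comp, underlyingMap_lift, underlyingMap_lift]
  simp

/-- The modification filling the triangle at a strictification. -/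
noncomputable def strTriangle (c : BrMonCat.{v, u}) :
    𝟙 c.str ≅ DDBicatsCat.lift c.str.underlying.sec ≫ strMap c.ev :=
  DDBicatsCat.liftIso (isoOfEq (F' := 𝟙 c.str.underlying) (underlyingMap_id _) (strTriangle_eq c)
    -- The first factor inserts evaluation and section of `c`, the last one section and evaluation
    -- at the second level.
    (c.evSec.inv ≫ (λ_ _).inv ≫ c.str.underlying.secEv.inv ▷ (c.ev ≫ c.sec))
    (c.q ≪≫ Functor.isoWhiskerRight c.str.underlying.r.symm (c.E ⋙ c.S))
    fun _ => ((Category.id_comp _).trans ((Category.comp_id _).trans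
      (congrArg (_ ≫ ·) (Category.id_comp _)))).symm)

end BrMonCat

open BrMonCat DDBicatsCat in
/-- The biadjoint biequivalence between doubly-degenerate `Bicat_s`-categories and braided monoidal
categories. -/
noncomputable def biadjointBiequivalence :
    BiadjointBiequivalence DDBicatsCat.{v, u} BrMonCat.{v, u} where
  functor := forgetToBrMonCat.toPseudofunctor
  inverse := strictification
  -- Adjusting one 2-cell yields an adjoint equivalence. Its 1-cell is unchanged, and only the
  -- 1-cells enter the triangulators and swallowtails.
  unit := Equivalence.mkOfAdjointifyCounit unitUnitInv unitInvUnit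
  counit := Equivalence.mkOfAdjointifyCounit counitCounitInv counitInvCounit
  leftTriangulator X := BrMonCat.isoOfEq (F' := X.underlying.sec ≫ X.underlying.ev) (G' := 𝟙 _)
    (congrArg (· ≫ X.underlying.ev) (underlyingMap_lift X.underlying.sec)) rfl
    X.underlying.secEv.hom X.underlying.r
    fun _ => ((Category.id_comp _).trans (Category.comp_id _)).symm
  leftTriangulator_naturality {X Y} F := BrMonCat.hom₂_ext fun x =>
    triangle_section X.underlying Y.underlying (DDBicatsCat.fn F) x
      (forget_mapComp_inv_app F (lift Y.underlying.sec) x)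
      (forget_mapComp_hom_app (lift X.underlying.sec) (strMap (underlyingMap F)) x)
  rightTriangulator c := c.strTriangle
  rightTriangulator_naturality {c c'} k := DDBicatsCat.hom₂_ext fun x =>
    triangle_evaluation c c' (BrMonCat.fn k) x
  swallowtail_unit X := DDBicatsCat.hom₂_ext fun x => swallowtail_section X.underlying x
  swallowtail_counit c := BrMonCat.hom₂_ext fun x => swallowtail_evaluation c x
    (forget_mapId_inv_app c.str x) (forget_mapComp_hom_app (lift c.str.underlying.sec) (strMap c.ev) x)

end DDB

theorem theorem4p1 :
    ∃ (br : ∀ X : DDB.DDBicatsCat.{v, u}, BraidedCategory X.carrier)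
      (mon : ∀ {X Y : DDB.DDBicatsCat.{v, u}} (F : X ⟶ Y),
        letI := br X; letI := br Y; (DDB.WeakMap.functor F).Braided)
      (U : StrictPseudofunctor DDB.DDBicatsCat.{v, u} DDB.BrMonCat.{v, u}),
      (∀ (X : DDB.DDBicatsCat.{v, u}) (a b : X.carrier),
        ((br X).braiding a b).hom = DDB.standardBraiding a b) ∧
      (∀ {X Y : DDB.DDBicatsCat.{v, u}} (F : X ⟶ Y),
        (mon F).ε = DDB.WeakMap.unitConstraint F ∧
        ∀ a b : X.carrier, (mon F).μ a b = DDB.WeakMap.verticalConstraint F a b) ∧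
      (∀ X : DDB.DDBicatsCat.{v, u}, U.obj X = DDB.BrMonCat.mk X.carrier (braided := br X)) ∧
      (∀ {X Y : DDB.DDBicatsCat.{v, u}} (F : X ⟶ Y),
        U.map F ≍ DDB.BrMonCat.Hom.mk (A := DDB.BrMonCat.mk X.carrier (braided := br X))
          (B := DDB.BrMonCat.mk Y.carrier (braided := br Y)) (DDB.WeakMap.functor F)
          (braided := mon F)) ∧
      (∀ {X Y : DDB.DDBicatsCat.{v, u}} {F G : X ⟶ Y} (θ : F ⟶ G),
        DDB.BrMonCat.Hom₂.nat (U.map₂ θ) ≍ DDB.WeakMap.Transformation.nat θ) ∧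
      ∃ E : DDB.BiadjointBiequivalence DDB.DDBicatsCat.{v, u} DDB.BrMonCat.{v, u},
        E.functor = U.toPseudofunctor :=
  -- The 2-functor was assembled from the standard braiding and the constraints at grids, so the
  -- listed properties are definitional.
  ⟨fun _ => DDB.standardBraided, fun F => DDB.WeakMap.braided F, DDB.DDBicatsCat.forgetToBrMonCat,
    fun _ _ _ => rfl, fun _ => ⟨rfl, fun _ _ => rfl⟩, fun _ => rfl, fun _ => HEq.rfl,
    fun _ => HEq.rfl, DDB.biadjointBiequivalence, rfl⟩
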